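/- Let $\Bbbk$ be a field and let $A,Q$ be cocommutative Hopf algebras over $\Bbbk$ (all coalgebras, extensions and Hopf algebras below are cocommutative). **The wreath product.** For cocommutative coalgebras $C,D$ let $D^C$ be the measuring coalgebra: the internal hom from $C$ to $D$ in cocommutative coalgebras, i.e. the colimit of the finite-dimensional cocommutative coalgebras $F$ marked by a coalgebra map $F\otimes C\to D$. It carries an evaluation coalgebra map $D^C\otimes C\to D$, $f\otimes c\mapsto f@c$, and every coalgebra map $B\otimes C\to D$ with $B$ cocommutative is obtained from it along a unique coalgebra map $B\to D^C$. Then $A^Q$ is a cocommutative Hopf algebra with $(fg)@c=\sum(f@c_1)(g@c_2)$ and $1@c=\varepsilon(c)1$, and $Q$ acts on it by $(q\star f)@c=f@(cq)$. The wreath product is the smash product $A\wr Q:=A^Q\#Q$: the coalgebra $A^Q\otimes Q$ with multiplication $(h\#q)(l\#r)=\sum h(q_1\star l)\#q_2r$. Let $\tau\colon A\wr Q\to Q$, $h\#q\mapsto\varepsilon(h)q$, and view $A^Q$ as the Hopf subalgebra $A^Q\#1$. **Extensions.** An extension of $A$ by $Q$ is a Hopf algebra $E$ with an injective and a surjective Hopf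 algebra map $A\xrightarrow{\iota}E\xrightarrow{\pi}Q$ such that $\iota(A)=\{e\in E\mid\sum e_1\otimes\pi(e_2)=e\otimes1\}$. It is cleft if there is a convolution-invertible $Q$-comodule coalgebra map $Q\to E$. An isomorphism of extensions $E\to E'$ is a triple of Hopf algebra isomorphisms $\alpha\colon A\to A$, $\phi\colon E\to E'$, $\omega\colon Q\to Q$ with $\phi\iota=\iota'\alpha$ and $\omega\pi=\pi'\phi$; it is an equivalence if $\alpha$ and $\omega$ are identities. **Subalgebras.** Let $\mathcal S$ be the set of Hopf subalgebras $H\le A\wr Q$ such that $\tau(H)=Q$ and such that evaluation at $1$, $f\mapsto f@1$, restricts to an isomorphism $H\cap A^Q\to A$. Two members $H,H'$ of $\mathcal S$ are conjugate if $H'=xHS(x)=\{\sum x_1eS(x_2)\mid e\in H\}$ for some group-like $x\in A\wr Q$. **Theorem A (generalized Kaloujnine–Krasner theorem).** There is a bijection $\Phi$ from the cleft extensions of $A$ by $Q$ up to equivalence to the members of $\mathcal S$ up to conjugation in $A\wr Q$. It is characterized as follows: $\Phi[E]=[H]$ if and only if there is an injective Hopf algebra map $j\colon E\to A\wr Q$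 with image $H$ such that $\tau j=\pi$ and, for all $a\in A$, $j(\iota(a))$ lies in $A^Q$ and $j(\iota(a))@1=a$. Moreover, two cleft extensions $E,E'$ are isomorphic (by a triple $(\alpha,\phi,\omega)$) if and only if there are $H\in\Phi[E]$, $H'\in\Phi[E']$ and Hopf algebra automorphisms $\alpha$ of $A$ and $\omega$ of $Q$ such that $H'$ is the image of $H$ under the map $f\#q\mapsto(\alpha\circ f\circ\omega^{-1})\#\omega(q)$ of $A\wr Q$, where $(\alpha\circ f\circ\omega^{-1})@c=\alpha(f@\omega^{-1}(c))$. Hence $\Phi$ induces a bijection from cleft extensions up to isomorphism to members of $\mathcal S$ up to conjugation and the action of $\operatorname{Aut}(A)\times\operatorname{Aut}(Q)$. -/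

import Mathlib

universe u

open scoped TensorProduct
open Coalgebra

noncomputable section

namespace HopfWreath


section Finiteness

variable {k : Type u} [Field k] {B : Type*} [AddCommGroup B] [Module k B]

theorem tensor_ext_right {M N : Type*} [AddCommGroup M] [Module k M] [AddCommGroup N]
    [Module k N] {z w : M ⊗[k] N}
    (h : ∀ χ : N →ₗ[k] k, TensorProduct.rid k M (χ.lTensor M z) =
      TensorProduct.rid k M (χ.lTensor M w)) : z = w := by
  classical
  let b := Module.Basis.ofVectorSpace k N
  apply (TensorProduct.equivFinsuppOfBasisRight b).injective
  ext i
  have := h (b.coord i)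
  simpa only [TensorProduct.equivFinsuppOfBasisRight_apply] using this

/-- Contraction of the second tensor factor. -/
def contract (z : B ⊗[k] B) : (B →ₗ[k] k) →ₗ[k] B :=
  (TensorProduct.rid k B).toLinearMap ∘ₗ
    (LinearMap.applyₗ z ∘ₗ (LinearMap.lTensorHom B : (B →ₗ[k] k) →ₗ[k] _))

theorem contract_apply (z : B ⊗[k] B) (χ : B →ₗ[k] k) :
    contract z χ = TensorProduct.rid k B (χ.lTensor B z) := rfl

theorem finite_range_contract (z : B ⊗[k] B) :
    FiniteDimensional k (LinearMap.range (contract z)) := by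
  induction z with
  | zero =>
    have : contract (0 : B ⊗[k] B) = 0 := by
      ext χ; simp [contract_apply]
    rw [this, LinearMap.range_zero]
    infer_instance
  | tmul a b =>
    have h : LinearMap.range (contract (a ⊗ₜ[k] b)) ≤ k ∙ a := by
      rintro _ ⟨χ, rfl⟩
      simp only [contract_apply, LinearMap.lTensor_tmul, TensorProduct.rid_tmul]
      exact Submodule.smul_mem _ _ (Submodule.mem_span_singleton_self a)
    exact Submodule.finiteDimensional_of_le h
  | add z w hz hw =>
    have h : LinearMap.range (contract (z + w)) ≤
        LinearMap.range (contract z) ⊔ LinearMap.range (contract w) := by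
      rintro _ ⟨χ, rfl⟩
      have : contract (z + w) χ = contract z χ + contract w χ := by
        simp [contract_apply]
      rw [this]
      exact Submodule.add_mem_sup ⟨χ, rfl⟩ ⟨χ, rfl⟩
    exact Submodule.finiteDimensional_of_le h

variable [Coalgebra k B]

theorem contract_contract (v : B) (φ χ : B →ₗ[k] k) :
    contract (comul (R := k) (contract (comul (R := k) v) φ)) χ =
      contract (comul (R := k) v) (LinearMap.mul' k k ∘ₗ TensorProduct.map χ φ ∘ₗ comul) := by
  have h := congrArg (fun t => TensorProduct.rid k B
    ((LinearMap.mul' k k ∘ₗ TensorProduct.map χ φ).lTensor B t)) (coassoc_apply (R := k) v)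
  have e1 : ∀ z : B ⊗[k] B, TensorProduct.rid k B
      ((LinearMap.mul' k k ∘ₗ TensorProduct.map χ φ).lTensor B
        (TensorProduct.assoc k B B B (comul.rTensor B z))) =
      contract (comul (R := k) (contract z φ)) χ := by
    intro z
    induction z with
    | zero => simp [contract_apply]
    | add z w hz hw => 
      simp only [map_add, hz, hw]
      simp only [contract_apply, map_add]
    | tmul a b =>
      simp only [contract_apply, LinearMap.rTensor_tmul, LinearMap.lTensor_tmul,
        TensorProduct.rid_tmul, map_smul]
      generalize (comul (R := k) a) = y
      induction y with
      | zero => simp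
      | add z w hz hw => simp only [map_add, smul_add, hz, hw, TensorProduct.add_tmul]
      | tmul c d => simp [smul_smul, mul_comm]
  have e2 : ∀ z : B ⊗[k] B, TensorProduct.rid k B
      ((LinearMap.mul' k k ∘ₗ TensorProduct.map χ φ).lTensor B (comul.lTensor B z)) =
      contract z (LinearMap.mul' k k ∘ₗ TensorProduct.map χ φ ∘ₗ comul) := by
    intro z
    rw [contract_apply, ← LinearMap.comp_assoc, LinearMap.lTensor_comp _ _ comul]
    rfl
  simpa only [e1, e2] using h

theorem contract_comul_counit (v : B) : contract (comul (R := k) v) counit = v := by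
  simp [contract_apply]

/-- Every finite-dimensional subspace lies in a finite-dimensional subcoalgebra. -/
theorem exists_stable (V : Submodule k B) [FiniteDimensional k V] :
    ∃ S : Submodule k B, V ≤ S ∧ FiniteDimensional k S ∧
      ∀ x ∈ S, ∀ χ : B →ₗ[k] k, contract (comul (R := k) x) χ ∈ S := by
  let b := Module.finBasis k V
  let S : Submodule k B := ⨆ i, LinearMap.range (contract (comul (R := k) ((b i : V) : B)))
  have : ∀ i, FiniteDimensional k
      (LinearMap.range (contract (comul (R := k) ((b i : V) : B)))) :=
    fun i => finite_range_contract _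
  refine ⟨S, ?_, inferInstanceAs (FiniteDimensional k (iSup _ : Submodule k B)), ?_⟩
  · intro v hv
    have hv' := b.sum_repr ⟨v, hv⟩
    have hv'' : v = ∑ i, b.repr ⟨v, hv⟩ i • ((b i : V) : B) := by
      have := congrArg (V.subtype) hv'
      simpa only [map_sum, map_smul, Submodule.subtype_apply] using this.symm
    rw [hv'']
    refine Submodule.sum_mem _ fun i _ => Submodule.smul_mem _ _ ?_
    exact (le_iSup (fun i => LinearMap.range (contract (comul (R := k) ((b i : V) : B)))) i)
      ⟨counit, contract_comul_counit _⟩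
  · intro x hx χ
    induction hx using Submodule.iSup_induction' with
    | mem i x hx =>
      obtain ⟨φ, rfl⟩ := hx
      rw [contract_contract]
      exact (le_iSup (fun i => LinearMap.range (contract (comul (R := k) ((b i : V) : B)))) i)
        ⟨_, rfl⟩
    | zero => simp [contract_apply]
    | add x y _ _ hx hy =>
      have : contract (comul (R := k) (x + y)) χ =
          contract (comul (R := k) x) χ + contract (comul (R := k) y) χ := by
        simp [contract_apply]
      rw [this]
      exact S.add_mem hx hy

section Restrict

variable {V : Type*} [AddCommGroup V] [Module k V]

/-- A subspace closed under the comultiplication inherits the structure of a coalgebra. -/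
abbrev coalgebraOfInjective (j : V →ₗ[k] B) (hj : Function.Injective j) (Δ : V →ₗ[k] V ⊗[k] V)
    (hΔ : TensorProduct.map j j ∘ₗ Δ = comul ∘ₗ j) : Coalgebra k V where
  comul := Δ
  counit := counit ∘ₗ j
  coassoc := by
    have inj3 : Function.Injective (TensorProduct.map j (TensorProduct.map j j)) :=
      TensorProduct.map_injective_of_flat_flat _ _ hj
        (TensorProduct.map_injective_of_flat_flat _ _ hj hj)
    have hd : ∀ x, TensorProduct.map j j (Δ x) = comul (R := k) (j x) :=
      fun x => LinearMap.congr_fun hΔ x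
    ext x
    apply inj3
    have e1 : ∀ z : V ⊗[k] V, TensorProduct.map j (TensorProduct.map j j)
        (TensorProduct.assoc k V V V (Δ.rTensor V z)) =
        TensorProduct.assoc k B B B (comul.rTensor B (TensorProduct.map j j z)) := by
      intro z
      induction z with
      | zero => simp
      | add z w hz hw => simp only [map_add, hz, hw]
      | tmul a b =>
        simp only [LinearMap.rTensor_tmul, TensorProduct.map_tmul, ← hd]
        generalize Δ a = y
        induction y with
        | zero => simp
        | add z w hz hw => simp only [map_add, hz, hw, TensorProduct.add_tmul]
        | tmul c d => simp
    have e2 : ∀ z : V ⊗[k] V, TensorProduct.map j (TensorProduct.map j j) (Δ.lTensor V z) =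
        comul.lTensor B (TensorProduct.map j j z) := by
      intro z
      induction z with
      | zero => simp
      | add z w hz hw => simp only [map_add, hz, hw]
      | tmul a b => simp [hd]
    simp only [LinearMap.comp_apply, LinearEquiv.coe_coe, e1, e2, hd, coassoc_apply]
  rTensor_counit_comp_comul := by
    have hd : ∀ x, TensorProduct.map j j (Δ x) = comul (R := k) (j x) :=
      fun x => LinearMap.congr_fun hΔ x
    ext x
    apply TensorProduct.map_injective_of_flat_flat (LinearMap.id : k →ₗ[k] k) j
      Function.injective_id hj
    have e : ∀ z : V ⊗[k] V, TensorProduct.map (LinearMap.id : k →ₗ[k] k) j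
        ((counit ∘ₗ j).rTensor V z) = counit.rTensor B (TensorProduct.map j j z) := by
      intro z
      induction z with
      | zero => simp
      | add z w hz hw => simp only [map_add, hz, hw]
      | tmul a b => simp
    simp only [LinearMap.comp_apply, e, hd, rTensor_counit_comul]
    simp
  lTensor_counit_comp_comul := by
    have hd : ∀ x, TensorProduct.map j j (Δ x) = comul (R := k) (j x) :=
      fun x => LinearMap.congr_fun hΔ x
    ext x
    apply TensorProduct.map_injective_of_flat_flat j (LinearMap.id : k →ₗ[k] k)
      hj Function.injective_id
    have e : ∀ z : V ⊗[k] V, TensorProduct.map j (LinearMap.id : k →ₗ[k] k)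
        ((counit ∘ₗ j).lTensor V z) = counit.lTensor B (TensorProduct.map j j z) := by
      intro z
      induction z with
      | zero => simp
      | add z w hz hw => simp only [map_add, hz, hw]
      | tmul a b => simp
    simp only [LinearMap.comp_apply, e, hd, lTensor_counit_comul]
    simp

theorem cocommOfInjective [IsCocomm k B] (j : V →ₗ[k] B) (hj : Function.Injective j)
    (Δ : V →ₗ[k] V ⊗[k] V) (hΔ : TensorProduct.map j j ∘ₗ Δ = comul ∘ₗ j) :
    @IsCocomm k V _ _ _ (coalgebraOfInjective j hj Δ hΔ) := by
  let := coalgebraOfInjective j hj Δ hΔ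
  refine ⟨?_⟩
  have hd : ∀ x, TensorProduct.map j j (Δ x) = comul (R := k) (j x) :=
    fun x => LinearMap.congr_fun hΔ x
  ext x
  apply TensorProduct.map_injective_of_flat_flat j j hj hj
  change TensorProduct.map j j (TensorProduct.comm k V V (Δ x)) = TensorProduct.map j j (Δ x)
  rw [TensorProduct.map_comm, hd, comm_comul]

end Restrict

/-- The coordinate space of dimension `n`, as a type without a preferred coalgebra structure. -/
def Vec (k : Type u) (n : ℕ) : Type u := Fin n → k

instance (k : Type u) [Field k] (n : ℕ) : AddCommGroup (Vec k n) :=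
  inferInstanceAs (AddCommGroup (Fin n → k))

instance (k : Type u) [Field k] (n : ℕ) : Module k (Vec k n) :=
  inferInstanceAs (Module k (Fin n → k))

instance (k : Type u) [Field k] (n : ℕ) : FiniteDimensional k (Vec k n) :=
  inferInstanceAs (FiniteDimensional k (Fin n → k))

theorem exists_vec [IsCocomm k B] (V : Submodule k B) [FiniteDimensional k V] :
    ∃ (n : ℕ) (_ : Coalgebra k (Vec k n)) (_ : IsCocomm k (Vec k n)) (j : Vec k n →ₗc[k] B),
      Function.Injective j ∧ ∀ v ∈ V, ∃ x, j x = v := by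
  obtain ⟨S, hVS, _, hS⟩ := exists_stable V
  let e : Vec k (Module.finrank k S) ≃ₗ[k] S := (Module.finBasis k S).equivFun.symm
  let j : Vec k (Module.finrank k S) →ₗ[k] B := S.subtype ∘ₗ e.toLinearMap
  have hj : Function.Injective j := S.injective_subtype.comp e.injective
  have hjS : ∀ x, j x ∈ S := fun x => (e x).2
  have hjs : ∀ s ∈ S, ∃ x, j x = s := fun s hs => ⟨e.symm ⟨s, hs⟩, by simp [j]⟩
  obtain ⟨p, hp⟩ := LinearMap.exists_leftInverse_of_injective j (LinearMap.ker_eq_bot.2 hj)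
  have hpS : ∀ s ∈ S, j (p s) = s := by
    intro s hs
    obtain ⟨x, rfl⟩ := hjs s hs
    rw [← LinearMap.comp_apply p j, hp]; rfl
  have h1 : ∀ x, TensorProduct.map (j ∘ₗ p) LinearMap.id (comul (R := k) (j x)) =
      comul (R := k) (j x) := by
    intro x
    apply tensor_ext_right
    intro χ
    have hm := hS (j x) (hjS x) χ
    have key : ∀ z : B ⊗[k] B, TensorProduct.rid k B (χ.lTensor B
        (TensorProduct.map (j ∘ₗ p) LinearMap.id z)) = j (p (contract z χ)) := by
      intro z
      induction z with
      | zero => simp [contract_apply]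
      | add z w hz hw => simp only [map_add, hz, hw, contract_apply]
      | tmul a b => simp [contract_apply]
    rw [key, hpS _ hm, contract_apply]
  have h2 : ∀ x, TensorProduct.map LinearMap.id (j ∘ₗ p) (comul (R := k) (j x)) =
      comul (R := k) (j x) := by
    intro x
    have := congrArg (TensorProduct.comm k B B) (h1 x)
    rw [← TensorProduct.map_comm, comm_comul] at this
    exact this
  have h3 : ∀ x, TensorProduct.map (j ∘ₗ p) (j ∘ₗ p) (comul (R := k) (j x)) =
      comul (R := k) (j x) := by
    intro x
    have e : TensorProduct.map (j ∘ₗ p) (j ∘ₗ p) = TensorProduct.map (j ∘ₗ p) LinearMap.id ∘ₗ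
        TensorProduct.map (LinearMap.id : B →ₗ[k] B) (j ∘ₗ p) := by
      rw [← TensorProduct.map_comp]; rfl
    rw [e, LinearMap.comp_apply, h2, h1]
  let Δ : Vec k (Module.finrank k S) →ₗ[k]
      Vec k (Module.finrank k S) ⊗[k] Vec k (Module.finrank k S) :=
    TensorProduct.map p p ∘ₗ comul ∘ₗ j
  have hΔ : TensorProduct.map j j ∘ₗ Δ = comul ∘ₗ j := by
    ext x
    have := h3 x
    rw [TensorProduct.map_comp] at this
    exact this
  let c : Coalgebra k (Vec k (Module.finrank k S)) := coalgebraOfInjective j hj Δ hΔ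
  exact ⟨_, c, cocommOfInjective j hj Δ hΔ, ⟨j, rfl, hΔ⟩, hj, fun v hv => hjs v (hVS hv)⟩

end Finiteness

section Measuring

open scoped DirectSum

variable (k : Type u) [Field k] (C D : Type u) [AddCommGroup C] [Module k C] [Coalgebra k C]
  [AddCommGroup D] [Module k D] [Coalgebra k D]

/-- A finite-dimensional cocommutative coalgebra `F = R^*` (on a coordinate space) together with an
element of `Coalg(F ⊗ C, D)`. -/
structure Marking where
  dim : ℕ
  [coalg : Coalgebra k (Vec k dim)]
  [cocomm : IsCocomm k (Vec k dim)]
  map : Vec k dim ⊗[k] C →ₗc[k] D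

attribute [instance] Marking.coalg Marking.cocomm

variable {k C D} in
/-- Morphisms of markings: coalgebra maps that are compatible with the maps to `D`. -/
def Marking.IsHom (M N : Marking k C D) (f : Vec k M.dim →ₗc[k] Vec k N.dim) : Prop :=
  ∀ x c, N.map (f x ⊗ₜ[k] c) = M.map (x ⊗ₜ[k] c)

open Classical in
/-- The relations that identify, in the direct sum of all `F`, an element with its images under
morphisms of markings. -/
def markingRelations : Submodule k (⨁ M : Marking k C D, Vec k M.dim) :=
  Submodule.span k {z | ∃ (M N : Marking k C D) (f : Vec k M.dim →ₗc[k] Vec k N.dim)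
    (x : Vec k M.dim), M.IsHom N f ∧
      z = DirectSum.lof k (Marking k C D) (fun M => Vec k M.dim) M x -
        DirectSum.lof k (Marking k C D) (fun M => Vec k M.dim) N (f x)}

/-- The measuring coalgebra `D^C`: the colimit of all finite-dimensional cocommutative coalgebras
`F` marked by an element of `Coalg(F ⊗ C, D)`. It is the internal hom from `C` to `D` in the
category of cocommutative coalgebras, see `Measuring.lift` and `Measuring.hom_ext`. -/
def Measuring : Type u := (⨁ M : Marking k C D, Vec k M.dim) ⧸ markingRelations k C D

namespace Measuring

instance : AddCommGroup (Measuring k C D) :=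
  inferInstanceAs (AddCommGroup (_ ⧸ markingRelations k C D))

instance : Module k (Measuring k C D) :=
  inferInstanceAs (Module k (_ ⧸ markingRelations k C D))

variable {k C D}

open Classical in
/-- The canonical map from a marked coalgebra to the colimit. -/
def inc (M : Marking k C D) : Vec k M.dim →ₗ[k] Measuring k C D :=
  (markingRelations k C D).mkQ ∘ₗ DirectSum.lof k (Marking k C D) (fun M => Vec k M.dim) M

theorem inc_hom {M N : Marking k C D} {f : Vec k M.dim →ₗc[k] Vec k N.dim} (hf : M.IsHom N f)
    (x : Vec k M.dim) : inc N (f x) = inc M x := by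
  classical
  symm
  exact (Submodule.Quotient.eq _).2 (Submodule.subset_span ⟨M, N, f, x, hf, rfl⟩)

theorem linear_ext {P : Type*} [AddCommGroup P] [Module k P] {f g : Measuring k C D →ₗ[k] P}
    (h : ∀ M x, f (inc M x) = g (inc M x)) : f = g := by
  classical
  apply Submodule.linearMap_qext
  apply DirectSum.linearMap_ext
  intro M
  exact LinearMap.ext fun x => h M x

open Classical in
/-- Linear maps out of the colimit. -/
def desc {P : Type*} [AddCommGroup P] [Module k P] (φ : ∀ M : Marking k C D, Vec k M.dim →ₗ[k] P)
    (hφ : ∀ (M N : Marking k C D) (f : Vec k M.dim →ₗc[k] Vec k N.dim), M.IsHom N f →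
      ∀ x, φ N (f x) = φ M x) : Measuring k C D →ₗ[k] P :=
  (markingRelations k C D).liftQ (DirectSum.toModule k _ _ φ) <| by
    rw [markingRelations, Submodule.span_le]
    rintro _ ⟨M, N, f, x, hf, rfl⟩
    simp [DirectSum.toModule_lof, hφ M N f hf x]

@[simp] theorem desc_inc {P : Type*} [AddCommGroup P] [Module k P]
    (φ : ∀ M : Marking k C D, Vec k M.dim →ₗ[k] P) (hφ) (M : Marking k C D) (x : Vec k M.dim) :
    desc φ hφ (inc M x) = φ M x := by
  classical
  exact DirectSum.toModule_lof (R := k) (φ := φ) M x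

instance : CoalgebraStruct k (Measuring k C D) where
  comul := desc (fun M => TensorProduct.map (inc M) (inc M) ∘ₗ comul) <| by
    intro M N f hf x
    have e : inc N ∘ₗ f.toLinearMap = inc M := LinearMap.ext (inc_hom hf)
    simp only [LinearMap.comp_apply]
    rw [← CoalgHomClass.map_comp_comul_apply, ← LinearMap.comp_apply, ← TensorProduct.map_comp]
    exact congrArg (fun t => TensorProduct.map t t (comul (R := k) x)) e
  counit := desc (fun M => counit) fun M N f _ x => CoalgHomClass.counit_comp_apply f x

theorem comul_inc (M : Marking k C D) (x : Vec k M.dim) :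
    comul (R := k) (inc M x) = TensorProduct.map (inc M) (inc M) (comul (R := k) x) :=
  desc_inc _ _ M x

@[simp] theorem counit_inc (M : Marking k C D) (x : Vec k M.dim) :
    counit (R := k) (inc M x) = counit (R := k) x :=
  desc_inc _ _ M x

instance : Coalgebra k (Measuring k C D) where
  coassoc := by
    apply linear_ext
    intro M x
    simp only [LinearMap.comp_apply, LinearEquiv.coe_coe, comul_inc]
    have e1 : ∀ z : Vec k M.dim ⊗[k] Vec k M.dim,
        TensorProduct.assoc k _ _ _ (comul.rTensor _ (TensorProduct.map (inc M) (inc M) z)) =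
        TensorProduct.map (inc M) (TensorProduct.map (inc M) (inc M))
          (TensorProduct.assoc k _ _ _ (comul.rTensor _ z)) := by
      intro z
      induction z with
      | zero => simp
      | add z w hz hw => simp only [map_add, hz, hw]
      | tmul a b =>
        simp only [LinearMap.rTensor_tmul, TensorProduct.map_tmul, comul_inc]
        generalize comul (R := k) a = y
        induction y with
        | zero => simp
        | add z w hz hw => simp only [map_add, hz, hw, TensorProduct.add_tmul]
        | tmul c d => simp
    have e2 : ∀ z : Vec k M.dim ⊗[k] Vec k M.dim,
        comul.lTensor _ (TensorProduct.map (inc M) (inc M) z) =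
        TensorProduct.map (inc M) (TensorProduct.map (inc M) (inc M)) (comul.lTensor _ z) := by
      intro z
      induction z with
      | zero => simp
      | add z w hz hw => simp only [map_add, hz, hw]
      | tmul a b => simp [comul_inc]
    rw [e1, e2, coassoc_apply]
  rTensor_counit_comp_comul := by
    apply linear_ext
    intro M x
    have e : ∀ z : Vec k M.dim ⊗[k] Vec k M.dim,
        counit.rTensor _ (TensorProduct.map (inc M) (inc M) z) =
        TensorProduct.map LinearMap.id (inc M) (counit.rTensor _ z) := by
      intro z
      induction z with
      | zero => simp
      | add z w hz hw => simp only [map_add, hz, hw]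
      | tmul a b => simp
    simp only [LinearMap.comp_apply, comul_inc, e, rTensor_counit_comul]
    simp
  lTensor_counit_comp_comul := by
    apply linear_ext
    intro M x
    have e : ∀ z : Vec k M.dim ⊗[k] Vec k M.dim,
        counit.lTensor _ (TensorProduct.map (inc M) (inc M) z) =
        TensorProduct.map (inc M) LinearMap.id (counit.lTensor _ z) := by
      intro z
      induction z with
      | zero => simp
      | add z w hz hw => simp only [map_add, hz, hw]
      | tmul a b => simp
    simp only [LinearMap.comp_apply, comul_inc, e, lTensor_counit_comul]
    simp

instance : IsCocomm k (Measuring k C D) where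
  comm_comp_comul := by
    apply linear_ext
    intro M x
    change TensorProduct.comm k _ _ (comul (R := k) (inc M x)) = comul (R := k) (inc M x)
    rw [comul_inc, ← TensorProduct.map_comm, comm_comul]

/-- The canonical map from a marked coalgebra is a coalgebra map. -/
def incHom (M : Marking k C D) : Vec k M.dim →ₗc[k] Measuring k C D where
  toLinearMap := inc M
  counit_comp := by ext x; simp
  map_comp_comul := by ext x; exact (comul_inc M x).symm

/-- The linear map underlying the evaluation. -/
def evalLin : Measuring k C D →ₗ[k] C →ₗ[k] D :=
  desc (fun M => TensorProduct.curry (M.map : Vec k M.dim ⊗[k] C →ₗ[k] D))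
    fun M N f hf x => by ext c; exact hf x c

@[simp] theorem evalLin_inc (M : Marking k C D) (x : Vec k M.dim) (c : C) :
    evalLin (inc M x) c = M.map (x ⊗ₜ[k] c) := by
  rw [evalLin, desc_inc]; rfl

variable (k C D) in
/-- The evaluation `D^C ⊗ C → D`, `f ⊗ c ↦ f@c`. -/
def eval : Measuring k C D ⊗[k] C →ₗc[k] D where
  toLinearMap := TensorProduct.lift evalLin
  counit_comp := by
    apply TensorProduct.ext
    apply linear_ext
    intro M x
    ext c
    simp
  map_comp_comul := by
    apply TensorProduct.ext
    apply linear_ext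
    intro M x
    ext c
    have e : ∀ z : (Vec k M.dim ⊗[k] C) ⊗[k] (Vec k M.dim ⊗[k] C),
        TensorProduct.map (TensorProduct.lift evalLin) (TensorProduct.lift evalLin)
          (TensorProduct.map ((inc M).rTensor C) ((inc M).rTensor C) z) =
        TensorProduct.map (M.map : Vec k M.dim ⊗[k] C →ₗ[k] D)
          (M.map : Vec k M.dim ⊗[k] C →ₗ[k] D) z := by
      intro z
      rw [← LinearMap.comp_apply, ← TensorProduct.map_comp]
      have : TensorProduct.lift evalLin ∘ₗ (inc M).rTensor C =
        (M.map : Vec k M.dim ⊗[k] C →ₗ[k] D) := by ext x c; simp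
      rw [this]
    have h := CoalgHomClass.map_comp_comul_apply
      (Coalgebra.TensorProduct.map (incHom M) (CoalgHom.id k C)) (x ⊗ₜ[k] c)
    have h2 := CoalgHomClass.map_comp_comul_apply M.map (x ⊗ₜ[k] c)
    have h3 : comul (R := k) (inc M x ⊗ₜ[k] c) =
      TensorProduct.map ((inc M).rTensor C) ((inc M).rTensor C) (comul (R := k) (x ⊗ₜ[k] c)) :=
      h.symm
    change TensorProduct.map (TensorProduct.lift evalLin) (TensorProduct.lift evalLin)
      (comul (R := k) (inc M x ⊗ₜ[k] c)) = comul (R := k) (evalLin (inc M x) c)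
    rw [h3, e, evalLin_inc]
    exact h2

@[simp] theorem eval_inc (M : Marking k C D) (x : Vec k M.dim) (c : C) :
    eval k C D (inc M x ⊗ₜ[k] c) = M.map (x ⊗ₜ[k] c) := evalLin_inc M x c

section Lift

variable {B : Type*} [AddCommGroup B] [Module k B] [Coalgebra k B] 

/-- `m` is the class of `b` in some finite-dimensional coalgebra over `B`. -/
def Represents (u : B ⊗[k] C →ₗc[k] D) (b : B) (m : Measuring k C D) : Prop :=
  ∃ (M : Marking k C D) (j : Vec k M.dim →ₗc[k] B) (x : Vec k M.dim),
    (∀ y c, u (j y ⊗ₜ[k] c) = M.map (y ⊗ₜ[k] c)) ∧ j x = b ∧ inc M x = m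

/-- A coalgebra map with values in the range of an injective one factors through it. -/
theorem exists_factor {F G : Type*} [AddCommGroup F] [Module k F] [Coalgebra k F]
    [AddCommGroup G] [Module k G] [Coalgebra k G] (j : G →ₗc[k] B) (hj : Function.Injective j)
    (i : F →ₗc[k] B) (hi : ∀ y, ∃ x, j x = i y) : ∃ g : F →ₗc[k] G, ∀ y, j (g y) = i y := by
  obtain ⟨p, hp⟩ := LinearMap.exists_leftInverse_of_injective (j : G →ₗ[k] B)
    (LinearMap.ker_eq_bot.2 hj)
  have hjp : ∀ y, j (p (i y)) = i y := by
    intro y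
    obtain ⟨x, hx⟩ := hi y
    rw [← hx]
    exact congrArg j (LinearMap.congr_fun hp x)
  have hc : (j : G →ₗ[k] B) ∘ₗ (p ∘ₗ (i : F →ₗ[k] B)) = i := LinearMap.ext hjp
  refine ⟨⟨p ∘ₗ (i : F →ₗ[k] B), ?_, ?_⟩, hjp⟩
  · ext y
    have := CoalgHomClass.counit_comp_apply j (p (i y))
    rw [hjp, CoalgHomClass.counit_comp_apply] at this
    exact this.symm
  · ext y
    apply TensorProduct.map_injective_of_flat_flat (j : G →ₗ[k] B) (j : G →ₗ[k] B) hj hj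
    simp only [LinearMap.comp_apply]
    rw [← LinearMap.comp_apply (TensorProduct.map _ _) (TensorProduct.map _ _),
      ← TensorProduct.map_comp, hc]
    have h1 := CoalgHomClass.map_comp_comul_apply i y
    have h2 := CoalgHomClass.map_comp_comul_apply j (p (i y))
    rw [hjp] at h2
    exact h1.trans h2.symm

theorem Represents.of_marking {u : B ⊗[k] C →ₗc[k] D} {b : B} {m : Measuring k C D}
    {M : Marking k C D} {j : Vec k M.dim →ₗc[k] B} (hj : Function.Injective j)
    (hu : ∀ y c, u (j y ⊗ₜ[k] c) = M.map (y ⊗ₜ[k] c)) {N : Marking k C D}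
    {i : Vec k N.dim →ₗc[k] B} {x : Vec k N.dim}
    (hN : ∀ y c, u (i y ⊗ₜ[k] c) = N.map (y ⊗ₜ[k] c)) (hx : i x = b) (hm : inc N x = m)
    (hi : ∀ y, ∃ x, j x = i y) : ∃ z, j z = b ∧ inc M z = m := by
  obtain ⟨g, hg⟩ := exists_factor j hj i hi
  refine ⟨g x, (hg x).trans hx, ?_⟩
  rw [← hm]
  refine inc_hom (fun y c => ?_) x
  rw [← hu, hg, hN]

variable [IsCocomm k B]

theorem exists_marking (u : B ⊗[k] C →ₗc[k] D) (V : Submodule k B) [FiniteDimensional k V] :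
    ∃ (M : Marking k C D) (j : Vec k M.dim →ₗc[k] B), Function.Injective j ∧
      (∀ y c, u (j y ⊗ₜ[k] c) = M.map (y ⊗ₜ[k] c)) ∧ ∀ v ∈ V, ∃ x, j x = v := by
  obtain ⟨n, _, _, j, hj, hV⟩ := exists_vec V
  exact ⟨⟨n, u.comp (Coalgebra.TensorProduct.map j (CoalgHom.id k C))⟩, j, hj, fun _ _ => rfl, hV⟩

theorem exists_represents (u : B ⊗[k] C →ₗc[k] D) (b : B) : ∃ m, Represents u b m := by
  obtain ⟨M, j, _, hu, hV⟩ := exists_marking u (k ∙ b)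
  obtain ⟨x, hx⟩ := hV b (Submodule.mem_span_singleton_self b)
  exact ⟨_, M, j, x, hu, hx, rfl⟩

theorem Represents.unique {u : B ⊗[k] C →ₗc[k] D} {b : B} {m m' : Measuring k C D}
    (h : Represents u b m) (h' : Represents u b m') : m = m' := by
  obtain ⟨N, i, x, hN, hx, hm⟩ := h
  obtain ⟨N', i', x', hN', hx', hm'⟩ := h'
  obtain ⟨M, j, hj, hu, hV⟩ := exists_marking u
    (LinearMap.range (i : Vec k N.dim →ₗ[k] B) ⊔ LinearMap.range (i' : Vec k N'.dim →ₗ[k] B))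
  obtain ⟨z, hz, hzm⟩ := Represents.of_marking hj hu hN hx hm
    fun y => hV _ (Submodule.mem_sup_left ⟨y, rfl⟩)
  obtain ⟨z', hz', hzm'⟩ := Represents.of_marking hj hu hN' hx' hm'
    fun y => hV _ (Submodule.mem_sup_right ⟨y, rfl⟩)
  rw [← hzm, ← hzm', hj (hz.trans hz'.symm)]

/-- The function underlying `lift`. -/
def liftFun (u : B ⊗[k] C →ₗc[k] D) (b : B) : Measuring k C D :=
  (exists_represents u b).choose

theorem liftFun_eq {u : B ⊗[k] C →ₗc[k] D} {M : Marking k C D} {j : Vec k M.dim →ₗc[k] B}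
    (hu : ∀ y c, u (j y ⊗ₜ[k] c) = M.map (y ⊗ₜ[k] c)) (x : Vec k M.dim) :
    liftFun u (j x) = inc M x :=
  (exists_represents u (j x)).choose_spec.unique ⟨M, j, x, hu, rfl, rfl⟩

/-- The universal property of the measuring coalgebra: the coalgebra map `B → D^C` that corresponds
to a coalgebra map `B ⊗ C → D`. -/
def lift (u : B ⊗[k] C →ₗc[k] D) : B →ₗc[k] Measuring k C D where
  toFun := liftFun u
  map_add' b b' := by
    obtain ⟨M, j, hj, hu, hV⟩ := exists_marking u ((k ∙ b) ⊔ (k ∙ b'))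
    obtain ⟨x, rfl⟩ := hV b (Submodule.mem_sup_left (Submodule.mem_span_singleton_self b))
    obtain ⟨x', rfl⟩ := hV b' (Submodule.mem_sup_right (Submodule.mem_span_singleton_self b'))
    rw [← map_add, liftFun_eq hu, liftFun_eq hu, liftFun_eq hu, map_add]
  map_smul' r b := by
    obtain ⟨M, j, hj, hu, hV⟩ := exists_marking u (k ∙ b)
    obtain ⟨x, rfl⟩ := hV b (Submodule.mem_span_singleton_self b)
    rw [← map_smul, liftFun_eq hu, liftFun_eq hu, map_smul]
    rfl
  counit_comp := by
    ext b
    obtain ⟨M, j, hj, hu, hV⟩ := exists_marking u (k ∙ b)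
    obtain ⟨x, rfl⟩ := hV b (Submodule.mem_span_singleton_self b)
    change counit (R := k) (liftFun u (j x)) = counit (R := k) (j x)
    rw [liftFun_eq hu, counit_inc, CoalgHomClass.counit_comp_apply]
  map_comp_comul := by
    ext b
    obtain ⟨M, j, hj, hu, hV⟩ := exists_marking u (k ∙ b)
    obtain ⟨x, rfl⟩ := hV b (Submodule.mem_span_singleton_self b)
    simp only [LinearMap.comp_apply]
    rw [← CoalgHomClass.map_comp_comul_apply j, ← LinearMap.comp_apply (TensorProduct.map _ _),
      ← TensorProduct.map_comp]
    refine Eq.trans ?_ (congrArg (comul (R := k)) (liftFun_eq hu x).symm)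
    rw [comul_inc]
    congr 2 <;> exact LinearMap.ext (liftFun_eq hu)

theorem eval_lift (u : B ⊗[k] C →ₗc[k] D) (b : B) (c : C) :
    eval k C D (lift u b ⊗ₜ[k] c) = u (b ⊗ₜ[k] c) := by
  obtain ⟨M, j, hj, hu, hV⟩ := exists_marking u (k ∙ b)
  obtain ⟨x, rfl⟩ := hV b (Submodule.mem_span_singleton_self b)
  change eval k C D (liftFun u (j x) ⊗ₜ[k] c) = _
  rw [liftFun_eq hu, eval_inc, hu]

theorem lift_inc (M : Marking k C D) (x : Vec k M.dim) : lift (eval k C D) (inc M x) = inc M x :=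
  liftFun_eq (j := incHom M) (fun y c => eval_inc M y c) x

theorem lift_eval (m : Measuring k C D) : lift (eval k C D) m = m := by
  have : ((lift (eval k C D) : Measuring k C D →ₗc[k] _) : Measuring k C D →ₗ[k] _) =
      LinearMap.id := linear_ext lift_inc
  exact LinearMap.congr_fun this m

theorem lift_comp {B' : Type*} [AddCommGroup B'] [Module k B'] [Coalgebra k B'] [IsCocomm k B']
    {u : B ⊗[k] C →ₗc[k] D} {u' : B' ⊗[k] C →ₗc[k] D} (f : B →ₗc[k] B')
    (h : ∀ b c, u' (f b ⊗ₜ[k] c) = u (b ⊗ₜ[k] c)) (b : B) : lift u' (f b) = lift u b := by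
  obtain ⟨M, j, hj, hu, hV⟩ := exists_marking u (k ∙ b)
  obtain ⟨x, rfl⟩ := hV b (Submodule.mem_span_singleton_self b)
  change liftFun u' ((f.comp j) x) = liftFun u (j x)
  rw [liftFun_eq hu, liftFun_eq]
  intro y c
  rw [← hu, ← h]
  rfl

/-- Uniqueness in the universal property of the measuring coalgebra. -/
theorem hom_ext {f g : B →ₗc[k] Measuring k C D}
    (h : ∀ b c, eval k C D (f b ⊗ₜ[k] c) = eval k C D (g b ⊗ₜ[k] c)) : f = g := by
  ext b
  rw [← lift_eval (f b), ← lift_eval (g b),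
    lift_comp (u := (eval k C D).comp (Coalgebra.TensorProduct.map f (CoalgHom.id k C))) f
      (fun _ _ => rfl),
    lift_comp (u := (eval k C D).comp (Coalgebra.TensorProduct.map f (CoalgHom.id k C))) g
      (fun b c => (h b c).symm)]

end Lift

end Measuring

end Measuring

section Points

variable {k : Type u} [Field k] {X X' Y Z W : Type*}
  [AddCommMonoid X] [Module k X] [Coalgebra k X] [AddCommMonoid X'] [Module k X'] [Coalgebra k X']
  [AddCommMonoid Y] [Module k Y] [Coalgebra k Y] [AddCommMonoid Z] [Module k Z] [Coalgebra k Z]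
  [AddCommMonoid W] [Module k W] [Coalgebra k W]

/-- The first projection `y ⊗ z ↦ ε(z) y`. -/
def fst : Y ⊗[k] Z →ₗc[k] Y :=
  (Coalgebra.TensorProduct.rid k k Y : Y ⊗[k] k →ₗc[k] Y).comp
    (Coalgebra.TensorProduct.map (CoalgHom.id k Y) (counitCoalgHom k Z))

/-- The second projection `y ⊗ z ↦ ε(y) z`. -/
def snd : Y ⊗[k] Z →ₗc[k] Z :=
  (Coalgebra.TensorProduct.lid k Z : k ⊗[k] Z →ₗc[k] Z).comp
    (Coalgebra.TensorProduct.map (counitCoalgHom k Y) (CoalgHom.id k Z))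

@[simp] theorem fst_tmul (y : Y) (z : Z) : fst (y ⊗ₜ[k] z) = counit (R := k) z • y := rfl

@[simp] theorem snd_tmul (y : Y) (z : Z) : snd (y ⊗ₜ[k] z) = counit (R := k) y • z := rfl

/-- The pairing `x ↦ ∑ f(x₁) ⊗ g(x₂)` of two coalgebra maps on a cocommutative coalgebra. -/
def pair [IsCocomm k X] (f : X →ₗc[k] Y) (g : X →ₗc[k] Z) : X →ₗc[k] Y ⊗[k] Z :=
  (Coalgebra.TensorProduct.map f g).comp (comulCoalgHom k X)

theorem pair_apply [IsCocomm k X] (f : X →ₗc[k] Y) (g : X →ₗc[k] Z) (x : X) :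
    pair f g x = TensorProduct.map (f : X →ₗ[k] Y) (g : X →ₗ[k] Z) (comul (R := k) x) := rfl

theorem fst_pair [IsCocomm k X] (f : X →ₗc[k] Y) (g : X →ₗc[k] Z) : fst.comp (pair f g) = f := by
  ext x
  have e : ∀ z : X ⊗[k] X, fst (TensorProduct.map (f : X →ₗ[k] Y) (g : X →ₗ[k] Z) z) =
      f (TensorProduct.rid k X (counit.lTensor X z)) := by
    intro z
    induction z with
    | zero => simp
    | add z w hz hw => simp only [map_add, hz, hw]
    | tmul a b => simp
  simp [pair_apply, e]

theorem snd_pair [IsCocomm k X] (f : X →ₗc[k] Y) (g : X →ₗc[k] Z) : snd.comp (pair f g) = g := by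
  ext x
  have e : ∀ z : X ⊗[k] X, snd (TensorProduct.map (f : X →ₗ[k] Y) (g : X →ₗ[k] Z) z) =
      g (TensorProduct.lid k X (counit.rTensor X z)) := by
    intro z
    induction z with
    | zero => simp
    | add z w hz hw => simp only [map_add, hz, hw]
    | tmul a b => simp
  simp [pair_apply, e]

theorem map_fst_snd_comul (t : Y ⊗[k] Z) :
    TensorProduct.map (fst : Y ⊗[k] Z →ₗc[k] Y).toLinearMap (snd : Y ⊗[k] Z →ₗc[k] Z).toLinearMap
      (comul (R := k) t) = t := by
  induction t with
  | zero => simp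
  | add z w hz hw => simp only [map_add, hz, hw]
  | tmul y z =>
    have e : ∀ (s : Y ⊗[k] Y) (t : Z ⊗[k] Z),
        TensorProduct.map (fst : Y ⊗[k] Z →ₗc[k] Y).toLinearMap
          (snd : Y ⊗[k] Z →ₗc[k] Z).toLinearMap
          (TensorProduct.AlgebraTensorModule.tensorTensorTensorComm k k k k Y Y Z Z (s ⊗ₜ t)) =
        (TensorProduct.rid k Y (counit.lTensor Y s)) ⊗ₜ[k]
          (TensorProduct.lid k Z (counit.rTensor Z t)) := by
      intro s t
      induction s with
      | zero => simp
      | add z w hz hw => simp only [map_add, hz, hw, TensorProduct.add_tmul]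
      | tmul a b =>
        induction t with
        | zero => simp
        | add z w hz hw => simp only [map_add, hz, hw, TensorProduct.tmul_add]
        | tmul c d =>
          simp [TensorProduct.smul_tmul, smul_smul, TensorProduct.tmul_smul, mul_comm]
    rw [TensorProduct.comul_tmul, e]
    simp

theorem pair_ext {f g : X →ₗc[k] Y ⊗[k] Z} (h₁ : fst.comp f = fst.comp g)
    (h₂ : snd.comp f = snd.comp g) : f = g := by
  have key : ∀ f : X →ₗc[k] Y ⊗[k] Z, ∀ x, f x =
      TensorProduct.map (fst.comp f).toLinearMap (snd.comp f).toLinearMap (comul (R := k) x) := by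
    intro f x
    conv_lhs => rw [← map_fst_snd_comul (f x), ← CoalgHomClass.map_comp_comul_apply]
    rw [← LinearMap.comp_apply, ← TensorProduct.map_comp]
    rfl
  ext x
  rw [key f, key g, h₁, h₂]

theorem pair_comp [IsCocomm k X] [IsCocomm k X'] (f : X →ₗc[k] Y) (g : X →ₗc[k] Z)
    (h : X' →ₗc[k] X) : (pair f g).comp h = pair (f.comp h) (g.comp h) := by
  apply pair_ext
  · rw [fst_pair, ← CoalgHom.comp_assoc, fst_pair]
  · rw [snd_pair, ← CoalgHom.comp_assoc, snd_pair]

theorem pair_fst_snd [IsCocomm k Y] [IsCocomm k Z] :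
    pair (fst : Y ⊗[k] Z →ₗc[k] Y) snd = CoalgHom.id k _ := by
  apply pair_ext
  · rw [fst_pair, CoalgHom.comp_id]
  · rw [snd_pair, CoalgHom.comp_id]

theorem map_pair [IsCocomm k X] (f : X →ₗc[k] Y) (g : X →ₗc[k] Z) (p : Y →ₗc[k] W)
    (q : Z →ₗc[k] X') :
    (Coalgebra.TensorProduct.map p q).comp (pair f g) = pair (p.comp f) (q.comp g) := by
  ext x
  change TensorProduct.map p.toLinearMap q.toLinearMap (TensorProduct.map f.toLinearMap
    g.toLinearMap (comul (R := k) x)) = _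
  rw [← LinearMap.comp_apply, ← TensorProduct.map_comp]
  rfl

/-- Coalgebra maps to the base field are all equal to the counit. -/
theorem counit_comp_eq (f : X →ₗc[k] X') :
    (counitCoalgHom k X').comp f = counitCoalgHom k X := Subsingleton.elim _ _

end Points

section ConvolutionGroup

open WithConv

variable {k : Type u} [Field k] {X X' : Type*}
  [AddCommMonoid X] [Module k X] [Coalgebra k X] [IsCocomm k X]
  [AddCommMonoid X'] [Module k X'] [Coalgebra k X'] [IsCocomm k X']
  {G : Type*} [Ring G] [HopfAlgebra k G] [IsCocomm k G]

theorem comul_antipode (x : G) : comul (R := k) (HopfAlgebra.antipode k x) =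
    TensorProduct.map (HopfAlgebra.antipode k) (HopfAlgebra.antipode k) (comul (R := k) x) := by
  have h1 := LinearMap.comul_right_inv (R := k) (C := G)
  have h2 : toConv (TensorProduct.map (HopfAlgebra.antipode k) (HopfAlgebra.antipode k) ∘ₗ
      comul (R := k) (A := G)) * toConv (comul (R := k) (A := G)) = 1 := by
    have h3 := LinearMap.convMul_comp_coalgHom_distrib
      (toConv (TensorProduct.map (HopfAlgebra.antipode k) (HopfAlgebra.antipode k)))
      (toConv (LinearMap.id : G ⊗[k] G →ₗ[k] G ⊗[k] G)) (comulCoalgHom k G)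
    have h4 := TensorProduct.map_convMul_map (R := k)
      (f := toConv (HopfAlgebra.antipode k (A := G))) (h := toConv LinearMap.id)
      (g := toConv (HopfAlgebra.antipode k (A := G))) (k := toConv LinearMap.id)
    rw [LinearMap.antipode_mul_id] at h4
    simp only [TensorProduct.map_id] at h4
    rw [h4] at h3
    apply WithConv.ofConv_injective
    refine Eq.trans h3.symm ?_
    ext x
    change TensorProduct.map (Algebra.linearMap k G ∘ₗ counit) (Algebra.linearMap k G ∘ₗ counit)
      (comul (R := k) x) = algebraMap k (G ⊗[k] G) (counit (R := k) x)
    have e : ∀ z : G ⊗[k] G, TensorProduct.map (Algebra.linearMap k G ∘ₗ counit)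
        (Algebra.linearMap k G ∘ₗ counit) z = algebraMap k (G ⊗[k] G) (counit (R := k)
          (TensorProduct.rid k G (counit.lTensor G z))) := by
      intro z
      induction z with
      | zero => simp
      | add z w hz hw => simp only [map_add, hz, hw]
      | tmul a b =>
        simp [Algebra.TensorProduct.one_def, Algebra.algebraMap_eq_smul_one, smul_smul,
          TensorProduct.smul_tmul, mul_comm]
    rw [e]; simp
  have := left_inv_eq_right_inv h2 h1
  exact (LinearMap.congr_fun (WithConv.toConv_injective this) x).symm

variable (k G) in
/-- The antipode of a cocommutative Hopf algebra as a coalgebra map. -/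
def antipodeHom : G →ₗc[k] G where
  toLinearMap := HopfAlgebra.antipode k
  counit_comp := by ext; simp
  map_comp_comul := by ext x; exact (comul_antipode x).symm

variable (k G) in
/-- The unit of a Hopf algebra as a coalgebra map. -/
def unitHom : k →ₗc[k] G where
  toLinearMap := Algebra.linearMap k G
  counit_comp := by ext; simp
  map_comp_comul := by ext; simp [Algebra.TensorProduct.one_def]

variable (k X G) in
/-- The coalgebra maps from a cocommutative coalgebra to a Hopf algebra; they form a group under
convolution. -/
@[ext] structure Pts : Type _ where
  hom : X →ₗc[k] G

namespace Pts

/-- Precomposition with a coalgebra map. -/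
def comp (f : Pts k X G) (h : X' →ₗc[k] X) : Pts k X' G := ⟨f.hom.comp h⟩

/-- The underlying linear map, in the convolution algebra. -/
def toLin (f : Pts k X G) : WithConv (X →ₗ[k] G) := toConv f.hom.toLinearMap

theorem toLin_injective : Function.Injective (toLin : Pts k X G → _) := fun _ _ h =>
  Pts.ext (CoalgHom.coe_linearMap_injective (WithConv.toConv_injective h))

instance : Mul (Pts k X G) := ⟨fun f g => ⟨(Bialgebra.mulCoalgHom k G).comp (pair f.hom g.hom)⟩⟩
instance : One (Pts k X G) := ⟨⟨(unitHom k G).comp (counitCoalgHom k X)⟩⟩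
instance : Inv (Pts k X G) := ⟨fun f => ⟨(antipodeHom k G).comp f.hom⟩⟩

theorem mul_hom (f g : Pts k X G) :
    (f * g).hom = (Bialgebra.mulCoalgHom k G).comp (pair f.hom g.hom) := rfl
theorem one_hom : (1 : Pts k X G).hom = (unitHom k G).comp (counitCoalgHom k X) := rfl
theorem inv_hom (f : Pts k X G) : (f⁻¹).hom = (antipodeHom k G).comp f.hom := rfl
theorem comp_hom (f : Pts k X G) (h : X' →ₗc[k] X) : (f.comp h).hom = f.hom.comp h := rfl

theorem toLin_mul (f g : Pts k X G) : (f * g).toLin = f.toLin * g.toLin := rfl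
theorem toLin_one : (1 : Pts k X G).toLin = 1 := rfl

instance : Group (Pts k X G) where
  mul_assoc f g h := toLin_injective (by simp only [toLin_mul, mul_assoc])
  one_mul f := toLin_injective (by simp only [toLin_mul, toLin_one, one_mul])
  mul_one f := toLin_injective (by simp only [toLin_mul, toLin_one, mul_one])
  inv_mul_cancel f := by
    apply toLin_injective
    rw [toLin_mul, toLin_one]
    have h := LinearMap.convMul_comp_coalgHom_distrib (toConv (HopfAlgebra.antipode k (A := G)))
      (toConv LinearMap.id) f.hom
    rw [LinearMap.antipode_mul_id] at h
    apply WithConv.ofConv_injective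
    refine Eq.trans h.symm ?_
    ext x
    exact congrArg (algebraMap k G) (LinearMap.congr_fun (CoalgHom.counit_comp f.hom) x)

theorem mul_comp (f g : Pts k X G) (h : X' →ₗc[k] X) : (f * g).comp h = f.comp h * g.comp h := by
  ext1
  rw [comp_hom, mul_hom, mul_hom, CoalgHom.comp_assoc, pair_comp, comp_hom, comp_hom]

theorem one_comp (h : X' →ₗc[k] X) : (1 : Pts k X G).comp h = 1 := by
  ext1
  rw [comp_hom, one_hom, one_hom, CoalgHom.comp_assoc, counit_comp_eq]

theorem inv_comp (f : Pts k X G) (h : X' →ₗc[k] X) : (f⁻¹).comp h = (f.comp h)⁻¹ := by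
  ext1
  rw [comp_hom, inv_hom, inv_hom, CoalgHom.comp_assoc, comp_hom]

theorem comp_comp {X'' : Type*} [AddCommMonoid X''] [Module k X''] [Coalgebra k X'']
    [IsCocomm k X''] (f : Pts k X G) (h : X' →ₗc[k] X) (h' : X'' →ₗc[k] X') :
    (f.comp h).comp h' = f.comp (h.comp h') :=
  Pts.ext (CoalgHom.comp_assoc _ _ _)

theorem comp_id (f : Pts k X G) : f.comp (CoalgHom.id k X) = f := by
  ext1
  rw [comp_hom, CoalgHom.comp_id]

end Pts

end ConvolutionGroup

section GroupObject

variable (k : Type u) [Field k] (T : Type u) [iT : AddCommGroup T] [Module k T] [Coalgebra k T]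
  [IsCocomm k T]

/-- A group structure on the functor of points `X ↦ Coalg(X, T)` of a cocommutative coalgebra. -/
structure CoalgGroup where
  mul : T ⊗[k] T →ₗc[k] T
  one : k →ₗc[k] T
  inv : T →ₗc[k] T
  assoc : ∀ {X : Type u} [AddCommGroup X] [Module k X] [Coalgebra k X] [IsCocomm k X]
    (f g h : X →ₗc[k] T), mul.comp (pair (mul.comp (pair f g)) h) =
      mul.comp (pair f (mul.comp (pair g h)))
  one_mul : ∀ {X : Type u} [AddCommGroup X] [Module k X] [Coalgebra k X] [IsCocomm k X]
    (f : X →ₗc[k] T), mul.comp (pair (one.comp (counitCoalgHom k X)) f) = f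
  mul_one : ∀ {X : Type u} [AddCommGroup X] [Module k X] [Coalgebra k X] [IsCocomm k X]
    (f : X →ₗc[k] T), mul.comp (pair f (one.comp (counitCoalgHom k X))) = f
  inv_mul : ∀ {X : Type u} [AddCommGroup X] [Module k X] [Coalgebra k X] [IsCocomm k X]
    (f : X →ₗc[k] T), mul.comp (pair (inv.comp f) f) = one.comp (counitCoalgHom k X)
  mul_inv : ∀ {X : Type u} [AddCommGroup X] [Module k X] [Coalgebra k X] [IsCocomm k X]
    (f : X →ₗc[k] T), mul.comp (pair f (inv.comp f)) = one.comp (counitCoalgHom k X)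

namespace CoalgGroup

variable {k T} (G : CoalgGroup k T)

theorem mul_assoc_apply (a b c : T) :
    G.mul (G.mul (a ⊗ₜ[k] b) ⊗ₜ[k] c) = G.mul (a ⊗ₜ[k] G.mul (b ⊗ₜ[k] c)) := by
  let p₁ : (T ⊗[k] T) ⊗[k] T →ₗc[k] T := fst.comp fst
  let p₂ : (T ⊗[k] T) ⊗[k] T →ₗc[k] T := snd.comp fst
  let p₃ : (T ⊗[k] T) ⊗[k] T →ₗc[k] T := snd
  have h := G.assoc p₁ p₂ p₃
  have e1 : pair (G.mul.comp (pair p₁ p₂)) p₃ =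
      Coalgebra.TensorProduct.map G.mul (CoalgHom.id k T) := by
    rw [← pair_comp, pair_fst_snd, CoalgHom.id_comp]
    apply pair_ext
    · rw [fst_pair]
      apply CoalgHom.coe_linearMap_injective
      ext a b c; simp
    · rw [snd_pair]
      apply CoalgHom.coe_linearMap_injective
      ext a b c; simp [p₃]
  have e2 : pair p₁ (G.mul.comp (pair p₂ p₃)) =
      (Coalgebra.TensorProduct.map (CoalgHom.id k T) G.mul).comp
        (Coalgebra.TensorProduct.assoc k k T T T : (T ⊗[k] T) ⊗[k] T →ₗc[k] _) := by
    have e3 : pair p₂ p₃ = (snd : T ⊗[k] (T ⊗[k] T) →ₗc[k] _).comp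
        (Coalgebra.TensorProduct.assoc k k T T T : (T ⊗[k] T) ⊗[k] T →ₗc[k] _) := by
      apply pair_ext
      · rw [fst_pair]
        apply CoalgHom.coe_linearMap_injective
        ext a b c; simp [p₂, smul_smul, mul_comm]
      · rw [snd_pair]
        apply CoalgHom.coe_linearMap_injective
        ext a b c; simp [p₃, smul_smul, mul_comm]
    rw [e3]
    apply pair_ext
    · rw [fst_pair]
      apply CoalgHom.coe_linearMap_injective
      ext a b c; simp [p₁, smul_smul, mul_comm]
    · rw [snd_pair]
      apply CoalgHom.coe_linearMap_injective
      ext a b c; simp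
  rw [e1, e2] at h
  exact CoalgHom.congr_fun h ((a ⊗ₜ b) ⊗ₜ c)

theorem one_mul_apply (a : T) : G.mul (G.one 1 ⊗ₜ[k] a) = a := by
  have h := CoalgHom.congr_fun (G.one_mul (CoalgHom.id k T)) a
  have e : pair (G.one.comp (counitCoalgHom k T)) (CoalgHom.id k T) a = G.one 1 ⊗ₜ[k] a := by
    have := congrArg (TensorProduct.map G.one.toLinearMap (LinearMap.id : T →ₗ[k] T))
      (rTensor_counit_comul (R := k) a)
    rw [LinearMap.rTensor, ← LinearMap.comp_apply, ← TensorProduct.map_comp] at this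
    exact this
  rw [CoalgHom.comp_apply, e] at h
  exact h

theorem mul_one_apply (a : T) : G.mul (a ⊗ₜ[k] G.one 1) = a := by
  have h := CoalgHom.congr_fun (G.mul_one (CoalgHom.id k T)) a
  have e : pair (CoalgHom.id k T) (G.one.comp (counitCoalgHom k T)) a = a ⊗ₜ[k] G.one 1 := by
    have := congrArg (TensorProduct.map (LinearMap.id : T →ₗ[k] T) G.one.toLinearMap)
      (lTensor_counit_comul (R := k) a)
    rw [LinearMap.lTensor, ← LinearMap.comp_apply, ← TensorProduct.map_comp] at this
    exact this
  rw [CoalgHom.comp_apply, e] at h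
  exact h

/-- The ring structure of a group object. -/
abbrev ring : Ring T :=
  { iT with
    mul := fun a b => G.mul (a ⊗ₜ[k] b)
    one := G.one 1
    mul_assoc := G.mul_assoc_apply
    one_mul := G.one_mul_apply
    mul_one := G.mul_one_apply
    zero_mul := fun a => by change G.mul (0 ⊗ₜ[k] a) = 0; simp
    mul_zero := fun a => by change G.mul (a ⊗ₜ[k] 0) = 0; simp
    left_distrib := fun a b c => by
      change G.mul (a ⊗ₜ[k] (b + c)) = G.mul (a ⊗ₜ[k] b) + G.mul (a ⊗ₜ[k] c)
      rw [TensorProduct.tmul_add, map_add]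
    right_distrib := fun a b c => by
      change G.mul ((a + b) ⊗ₜ[k] c) = G.mul (a ⊗ₜ[k] c) + G.mul (b ⊗ₜ[k] c)
      rw [TensorProduct.add_tmul, map_add] }

/-- The algebra structure of a group object. -/
abbrev algebra : @Algebra k T _ G.ring.toSemiring :=
  letI := G.ring
  Algebra.ofModule
    (fun r a b => by
      change G.mul ((r • a) ⊗ₜ[k] b) = r • G.mul (a ⊗ₜ[k] b)
      rw [← TensorProduct.smul_tmul', map_smul])
    (fun r a b => by
      change G.mul (a ⊗ₜ[k] (r • b)) = r • G.mul (a ⊗ₜ[k] b)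
      rw [TensorProduct.tmul_smul, map_smul])

/-- The bialgebra structure of a group object. -/
abbrev bialgebra : @Bialgebra k T _ G.ring.toSemiring :=
  letI := G.ring
  letI := G.algebra
  Bialgebra.mk' k T
    (by
      change counit (R := k) (G.one 1) = 1
      rw [CoalgHomClass.counit_comp_apply]; rfl)
    (by
      intro a b
      change counit (R := k) (G.mul (a ⊗ₜ[k] b)) = _
      rw [CoalgHomClass.counit_comp_apply, TensorProduct.counit_tmul, smul_eq_mul, mul_comm])
    (by
      change comul (R := k) (G.one 1) = G.one 1 ⊗ₜ[k] G.one 1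
      rw [← CoalgHomClass.map_comp_comul_apply]
      simp)
    (by
      intro a b
      change comul (R := k) (G.mul (a ⊗ₜ[k] b)) = _
      rw [← CoalgHomClass.map_comp_comul_apply, TensorProduct.comul_tmul]
      generalize comul (R := k) a = s
      generalize comul (R := k) b = t
      induction s with
      | zero => rw [TensorProduct.zero_tmul, LinearEquiv.map_zero, LinearMap.map_zero, zero_mul]
      | add z w hz hw =>
        rw [TensorProduct.add_tmul, LinearEquiv.map_add, LinearMap.map_add, hz, hw, add_mul]
      | tmul a b =>
        induction t with
        | zero => rw [TensorProduct.tmul_zero, LinearEquiv.map_zero, LinearMap.map_zero, mul_zero]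
        | add z w hz hw =>
          rw [TensorProduct.tmul_add, LinearEquiv.map_add, LinearMap.map_add, hz, hw, mul_add]
        | tmul c d => exact (Algebra.TensorProduct.tmul_mul_tmul a c b d).symm)

/-- The Hopf algebra structure of a group object. -/
abbrev hopfAlgebra : @HopfAlgebra k T _ G.ring.toSemiring :=
  letI := G.ring
  letI := G.bialgebra
  { G.bialgebra with
    antipode := G.inv.toLinearMap
    mul_antipode_rTensor_comul := by
      ext a
      have h := CoalgHom.congr_fun (G.inv_mul (CoalgHom.id k T)) a
      have e : ∀ z : T ⊗[k] T, LinearMap.mul' k T (G.inv.toLinearMap.rTensor T z) =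
          G.mul (TensorProduct.map G.inv.toLinearMap LinearMap.id z) := by
        intro z
        induction z with
        | zero => simp only [map_zero]
        | add z w hz hw => simp only [hz, hw, map_add]
        | tmul a b => rfl
      refine (e _).trans (h.trans ?_)
      change G.one (counit (R := k) a) = counit (R := k) a • G.one 1
      rw [← map_smul, smul_eq_mul, _root_.mul_one]
    mul_antipode_lTensor_comul := by
      ext a
      have h := CoalgHom.congr_fun (G.mul_inv (CoalgHom.id k T)) a
      have e : ∀ z : T ⊗[k] T, LinearMap.mul' k T (G.inv.toLinearMap.lTensor T z) =
          G.mul (TensorProduct.map LinearMap.id G.inv.toLinearMap z) := by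
        intro z
        induction z with
        | zero => simp only [map_zero]
        | add z w hz hw => simp only [hz, hw, map_add]
        | tmul a b => rfl
      refine (e _).trans (h.trans ?_)
      change G.one (counit (R := k) a) = counit (R := k) a • G.one 1
      rw [← map_smul, smul_eq_mul, _root_.mul_one] }

end CoalgGroup

end GroupObject

section MeasuringHopf

namespace Measuring

variable {k : Type u} [Field k] {C : Type u} [AddCommGroup C] [Module k C] [Coalgebra k C]
  [IsCocomm k C] {D : Type u} [Ring D] [HopfAlgebra k D] [IsCocomm k D]
  {X X' : Type*} [AddCommGroup X] [Module k X] [Coalgebra k X] [IsCocomm k X]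
  [AddCommGroup X'] [Module k X'] [Coalgebra k X'] [IsCocomm k X']

/-- The bijection `Coalg(X, D^C) → Coalg(X ⊗ C, D)`. -/
def ev (f : X →ₗc[k] Measuring k C D) : Pts k (X ⊗[k] C) D :=
  ⟨(eval k C D).comp (Coalgebra.TensorProduct.map f (CoalgHom.id k C))⟩

theorem ev_injective {f g : X →ₗc[k] Measuring k C D} (h : ev f = ev g) : f = g :=
  hom_ext fun b c => CoalgHom.congr_fun (congrArg Pts.hom h) (b ⊗ₜ[k] c)

theorem ev_lift (u : Pts k (X ⊗[k] C) D) : ev (lift u.hom) = u := by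
  apply Pts.ext
  apply CoalgHom.coe_linearMap_injective
  apply TensorProduct.ext'
  intro b c
  exact eval_lift u.hom b c

theorem ev_comp (f : X →ₗc[k] Measuring k C D) (h : X' →ₗc[k] X) :
    ev (f.comp h) = (ev f).comp (Coalgebra.TensorProduct.map h (CoalgHom.id k C)) := by
  apply Pts.ext
  apply CoalgHom.coe_linearMap_injective
  apply TensorProduct.ext'
  intro b c
  rfl

variable (k C D) in
/-- Multiplication of `D^C`: it represents `(f, g) ↦ (ξ ⊗ c ↦ ∑ f(ξ₁ ⊗ c₁) g(ξ₂ ⊗ c₂))`. -/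
def mulHom : Measuring k C D ⊗[k] Measuring k C D →ₗc[k] Measuring k C D :=
  lift (ev fst * ev snd : Pts k ((Measuring k C D ⊗[k] Measuring k C D) ⊗[k] C) D).hom

variable (k C D) in
/-- The unit of `D^C`: it represents `ξ ⊗ c ↦ ε(ξ) ε(c) 1`. -/
def oneHom : k →ₗc[k] Measuring k C D := lift (1 : Pts k (k ⊗[k] C) D).hom

variable (k C D) in
/-- The antipode of `D^C`: it represents `f ↦ (ξ ⊗ c ↦ S(f(ξ ⊗ c)))`. -/
def invHom : Measuring k C D →ₗc[k] Measuring k C D :=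
  lift ((ev (CoalgHom.id k _))⁻¹ : Pts k (Measuring k C D ⊗[k] C) D).hom

theorem ev_mulHom (f g : X →ₗc[k] Measuring k C D) :
    ev ((mulHom k C D).comp (pair f g)) = ev f * ev g := by
  rw [ev_comp, mulHom, ev_lift, Pts.mul_comp, ← ev_comp, ← ev_comp, fst_pair, snd_pair]

theorem ev_oneHom (h : X →ₗc[k] k) : ev ((oneHom k C D).comp h) = 1 := by
  rw [ev_comp, oneHom, ev_lift, Pts.one_comp]

theorem ev_invHom (f : X →ₗc[k] Measuring k C D) : ev ((invHom k C D).comp f) = (ev f)⁻¹ := by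
  rw [ev_comp, invHom, ev_lift, Pts.inv_comp, ← ev_comp, CoalgHom.id_comp]

variable (k C D) in
/-- The group structure on the points of `D^C`. -/
def coalgGroup : CoalgGroup k (Measuring k C D) where
  mul := mulHom k C D
  one := oneHom k C D
  inv := invHom k C D
  assoc f g h := ev_injective (by simp only [ev_mulHom, mul_assoc])
  one_mul f := ev_injective (by simp only [ev_mulHom, ev_oneHom, one_mul])
  mul_one f := ev_injective (by simp only [ev_mulHom, ev_oneHom, mul_one])
  inv_mul f := ev_injective (by simp only [ev_mulHom, ev_oneHom, ev_invHom, inv_mul_cancel])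
  mul_inv f := ev_injective (by simp only [ev_mulHom, ev_oneHom, ev_invHom, mul_inv_cancel])

instance : Ring (Measuring k C D) := (coalgGroup k C D).ring

/-- The Hopf algebra structure of `D^C`. -/
instance : HopfAlgebra k (Measuring k C D) := (coalgGroup k C D).hopfAlgebra

theorem mulCoalgHom_eq : Bialgebra.mulCoalgHom k (Measuring k C D) = mulHom k C D := by
  apply CoalgHom.coe_linearMap_injective
  apply TensorProduct.ext'
  intro a b
  rfl

theorem unitHom_eq : unitHom k (Measuring k C D) = oneHom k C D := by
  apply CoalgHom.coe_linearMap_injective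
  ext
  change (1 : k) • oneHom k C D 1 = oneHom k C D 1
  rw [one_smul]

theorem ev_mul (f g : Pts k X (Measuring k C D)) : ev (f * g).hom = ev f.hom * ev g.hom := by
  rw [Pts.mul_hom, mulCoalgHom_eq, ev_mulHom]

theorem ev_one : ev (1 : Pts k X (Measuring k C D)).hom = 1 := by
  rw [Pts.one_hom, unitHom_eq, ev_oneHom]

theorem ev_pts_injective {f g : Pts k X (Measuring k C D)} (h : ev f.hom = ev g.hom) : f = g :=
  Pts.ext (ev_injective h)

end Measuring

end MeasuringHopf

section WreathProduct

variable {k : Type u} [Field k] {A Q : Type u} [Ring A] [HopfAlgebra k A] [IsCocomm k A]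
  [Ring Q] [HopfAlgebra k Q] [IsCocomm k Q]
  {X X' : Type*} [AddCommGroup X] [Module k X] [Coalgebra k X] [IsCocomm k X]
  [AddCommGroup X'] [Module k X'] [Coalgebra k X'] [IsCocomm k X']

namespace Measuring

/-- The second projection of `X ⊗ Q`, as a point of `Q`. -/
def sndPts : Pts k (X ⊗[k] Q) Q := ⟨snd⟩

/-- For a point `q` of `Q`, the map `x ⊗ c ↦ ∑ x₁ ⊗ c q(x₂)`. -/
def shift (q : Pts k X Q) : X ⊗[k] Q →ₗc[k] X ⊗[k] Q :=
  pair fst (sndPts * q.comp fst : Pts k (X ⊗[k] Q) Q).hom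

variable (k A Q) in
/-- The action `Q ⊗ A^Q → A^Q`, `(q ★ f)@c = f@(cq)`, see `eval_act`. -/
def act : Q ⊗[k] Measuring k Q A →ₗc[k] Measuring k Q A :=
  lift ((ev (snd : Q ⊗[k] Measuring k Q A →ₗc[k] Measuring k Q A)).comp (shift ⟨fst⟩)).hom

theorem fst_shift (q : Pts k X Q) : fst.comp (shift q) = fst := fst_pair _ _

theorem snd_shift (q : Pts k X Q) : (sndPts : Pts k (X ⊗[k] Q) Q).comp (shift q) =
    sndPts * q.comp fst :=
  Pts.ext (snd_pair _ _)

theorem shift_one : shift (1 : Pts k X Q) = CoalgHom.id k _ := by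
  rw [shift, Pts.one_comp, mul_one]
  exact pair_fst_snd

theorem shift_ext {f g : X' →ₗc[k] X ⊗[k] Q} (h₁ : fst.comp f = fst.comp g)
    (h₂ : sndPts.comp f = sndPts.comp g) : f = g :=
  pair_ext h₁ (congrArg Pts.hom h₂)

theorem shift_mul (q r : Pts k X Q) : shift (q * r) = (shift r).comp (shift q) := by
  apply shift_ext
  · rw [← CoalgHom.comp_assoc, fst_shift, fst_shift, fst_shift]
  · rw [← Pts.comp_comp, snd_shift, snd_shift, Pts.mul_comp, Pts.mul_comp, snd_shift, Pts.comp_comp,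
      fst_shift, mul_assoc]

theorem shift_comp (q : Pts k X Q) (h : X' →ₗc[k] X) :
    (shift q).comp (Coalgebra.TensorProduct.map h (CoalgHom.id k Q)) =
      (Coalgebra.TensorProduct.map h (CoalgHom.id k Q)).comp (shift (q.comp h)) := by
  have e1 : (fst : X ⊗[k] Q →ₗc[k] X).comp (Coalgebra.TensorProduct.map h (CoalgHom.id k Q)) =
      h.comp fst := by
    apply CoalgHom.coe_linearMap_injective
    ext x c; simp
  have e2 : (sndPts : Pts k (X ⊗[k] Q) Q).comp
      (Coalgebra.TensorProduct.map h (CoalgHom.id k Q)) = sndPts := by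
    apply Pts.ext
    apply CoalgHom.coe_linearMap_injective
    apply TensorProduct.ext'
    intro x c
    exact congrArg (· • c) (CoalgHomClass.counit_comp_apply h x)
  apply shift_ext
  · rw [← CoalgHom.comp_assoc, fst_shift, e1, ← CoalgHom.comp_assoc, e1, CoalgHom.comp_assoc,
      fst_shift]
  · rw [← Pts.comp_comp, ← Pts.comp_comp, e2, snd_shift, snd_shift, Pts.mul_comp, e2, Pts.comp_comp, e1,
      Pts.comp_comp]

/-- The action on points. -/
def actPts (q : Pts k X Q) (f : Pts k X (Measuring k Q A)) : Pts k X (Measuring k Q A) :=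
  ⟨(act k A Q).comp (pair q.hom f.hom)⟩

theorem ev_actPts (q : Pts k X Q) (f : Pts k X (Measuring k Q A)) :
    ev (actPts q f).hom = (ev f.hom).comp (shift q) := by
  have e : Pts.comp (⟨fst⟩ : Pts k (Q ⊗[k] Measuring k Q A) Q) (pair q.hom f.hom) = q :=
    Pts.ext (fst_pair _ _)
  rw [actPts, ev_comp, act, ev_lift, Pts.comp_comp, shift_comp, e, ← Pts.comp_comp, ← ev_comp, snd_pair]

theorem actPts_mul (q : Pts k X Q) (f g : Pts k X (Measuring k Q A)) :
    actPts q (f * g) = actPts q f * actPts q g :=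
  ev_pts_injective (by rw [ev_actPts, ev_mul, ev_mul, Pts.mul_comp, ev_actPts, ev_actPts])

theorem actPts_one (q : Pts k X Q) : actPts q (1 : Pts k X (Measuring k Q A)) = 1 :=
  ev_pts_injective (by rw [ev_actPts, ev_one, Pts.one_comp])

theorem one_actPts (f : Pts k X (Measuring k Q A)) : actPts 1 f = f :=
  ev_pts_injective (by rw [ev_actPts, shift_one, Pts.comp_id])

theorem mul_actPts (q r : Pts k X Q) (f : Pts k X (Measuring k Q A)) :
    actPts (q * r) f = actPts q (actPts r f) :=
  ev_pts_injective (by rw [ev_actPts, ev_actPts, ev_actPts, shift_mul, Pts.comp_comp])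

theorem actPts_comp (q : Pts k X Q) (f : Pts k X (Measuring k Q A)) (h : X' →ₗc[k] X) :
    (actPts q f).comp h = actPts (q.comp h) (f.comp h) := by
  apply Pts.ext
  rw [Pts.comp_hom, actPts, actPts, CoalgHom.comp_assoc, pair_comp, Pts.comp_hom, Pts.comp_hom]

end Measuring

open Measuring

variable (k A Q) in
/-- The wreath product `A ≀ Q = A^Q # Q`, which is `A^Q ⊗ Q` as a coalgebra. -/
def Wreath : Type u := Measuring k Q A ⊗[k] Q

namespace Wreath

instance : AddCommGroup (Wreath k A Q) := inferInstanceAs (AddCommGroup (Measuring k Q A ⊗[k] Q))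
instance : Module k (Wreath k A Q) := inferInstanceAs (Module k (Measuring k Q A ⊗[k] Q))
instance : Coalgebra k (Wreath k A Q) := inferInstanceAs (Coalgebra k (Measuring k Q A ⊗[k] Q))
instance : IsCocomm k (Wreath k A Q) := inferInstanceAs (IsCocomm k (Measuring k Q A ⊗[k] Q))

/-- The elementary tensor `f # q`. -/
def mk (f : Measuring k Q A) (q : Q) : Wreath k A Q := f ⊗ₜ[k] q

variable (k A Q) in
/-- The projection `A ≀ Q → A^Q`, `f # q ↦ ε(q) f` (a coalgebra map). -/
def left : Wreath k A Q →ₗc[k] Measuring k Q A :=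
  (fst : Measuring k Q A ⊗[k] Q →ₗc[k] Measuring k Q A)

variable (k A Q) in
/-- The natural map `τ : A ≀ Q → Q`, `f # q ↦ ε(f) q`. -/
def right : Wreath k A Q →ₗc[k] Q := (snd : Measuring k Q A ⊗[k] Q →ₗc[k] Q)

theorem left_mk (f : Measuring k Q A) (q : Q) : left k A Q (mk f q) = counit (R := k) q • f := rfl

theorem right_mk (f : Measuring k Q A) (q : Q) : right k A Q (mk f q) = counit (R := k) f • q := rfl

/-- The point of `A ≀ Q` with given components. -/
def point (f : Pts k X (Measuring k Q A)) (q : Pts k X Q) : X →ₗc[k] Wreath k A Q :=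
  (pair f.hom q.hom : X →ₗc[k] Measuring k Q A ⊗[k] Q)

/-- The first component of a point of `A ≀ Q`. -/
def fstPt (w : X →ₗc[k] Wreath k A Q) : Pts k X (Measuring k Q A) := ⟨(left k A Q).comp w⟩

/-- The second component of a point of `A ≀ Q`. -/
def sndPt (w : X →ₗc[k] Wreath k A Q) : Pts k X Q := ⟨(right k A Q).comp w⟩

theorem fstPt_point (f : Pts k X (Measuring k Q A)) (q : Pts k X Q) : fstPt (point f q) = f :=
  Pts.ext (fst_pair _ _)

theorem sndPt_point (f : Pts k X (Measuring k Q A)) (q : Pts k X Q) : sndPt (point f q) = q :=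
  Pts.ext (snd_pair _ _)

theorem ext_pt {v w : X →ₗc[k] Wreath k A Q} (h₁ : fstPt v = fstPt w) (h₂ : sndPt v = sndPt w) :
    v = w := pair_ext (congrArg Pts.hom h₁) (congrArg Pts.hom h₂)

theorem fstPt_comp (w : X →ₗc[k] Wreath k A Q) (h : X' →ₗc[k] X) :
    fstPt (w.comp h) = (fstPt w).comp h := Pts.ext (CoalgHom.comp_assoc _ _ _).symm

theorem sndPt_comp (w : X →ₗc[k] Wreath k A Q) (h : X' →ₗc[k] X) :
    sndPt (w.comp h) = (sndPt w).comp h := Pts.ext (CoalgHom.comp_assoc _ _ _).symm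

variable (k A Q) in
/-- The multiplication `(h # q)(k # r) = ∑ h (q₁ ★ k) # q₂ r` of the smash product. -/
def mulHom : Wreath k A Q ⊗[k] Wreath k A Q →ₗc[k] Wreath k A Q :=
  point (fstPt fst * actPts (sndPt fst) (fstPt snd)) (sndPt fst * sndPt snd)

variable (k A Q) in
/-- The unit `1 # 1`. -/
def oneHom : k →ₗc[k] Wreath k A Q := point 1 1

variable (k A Q) in
/-- The antipode `S(h # q) = ∑ (S(q₁) ★ S(h)) # S(q₂)`. -/
def invHom : Wreath k A Q →ₗc[k] Wreath k A Q :=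
  point (actPts (sndPt (CoalgHom.id k _))⁻¹ (fstPt (CoalgHom.id k _))⁻¹)
    (sndPt (CoalgHom.id k _))⁻¹

theorem fstPt_mulHom (v w : X →ₗc[k] Wreath k A Q) :
    fstPt ((mulHom k A Q).comp (pair v w)) = fstPt v * actPts (sndPt v) (fstPt w) := by
  rw [fstPt_comp, mulHom, fstPt_point, Pts.mul_comp, actPts_comp, ← fstPt_comp, ← fstPt_comp,
    ← sndPt_comp, fst_pair, snd_pair]

theorem sndPt_mulHom (v w : X →ₗc[k] Wreath k A Q) :
    sndPt ((mulHom k A Q).comp (pair v w)) = sndPt v * sndPt w := by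
  rw [sndPt_comp, mulHom, sndPt_point, Pts.mul_comp, ← sndPt_comp, ← sndPt_comp, fst_pair,
    snd_pair]

theorem fstPt_oneHom (h : X →ₗc[k] k) : fstPt ((oneHom k A Q).comp h) = 1 := by
  rw [fstPt_comp, oneHom, fstPt_point, Pts.one_comp]

theorem sndPt_oneHom (h : X →ₗc[k] k) : sndPt ((oneHom k A Q).comp h) = 1 := by
  rw [sndPt_comp, oneHom, sndPt_point, Pts.one_comp]

theorem fstPt_invHom (w : X →ₗc[k] Wreath k A Q) :
    fstPt ((invHom k A Q).comp w) = actPts (sndPt w)⁻¹ (fstPt w)⁻¹ := by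
  rw [fstPt_comp, invHom, fstPt_point, actPts_comp, Pts.inv_comp, Pts.inv_comp, ← fstPt_comp,
    ← sndPt_comp, CoalgHom.id_comp]

theorem sndPt_invHom (w : X →ₗc[k] Wreath k A Q) :
    sndPt ((invHom k A Q).comp w) = (sndPt w)⁻¹ := by
  rw [sndPt_comp, invHom, sndPt_point, Pts.inv_comp, ← sndPt_comp, CoalgHom.id_comp]

variable (k A Q) in
/-- The group structure on the points of `A ≀ Q`. -/
def coalgGroup : CoalgGroup k (Wreath k A Q) where
  mul := mulHom k A Q
  one := oneHom k A Q
  inv := invHom k A Q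
  assoc f g h := ext_pt
    (by simp only [fstPt_mulHom, sndPt_mulHom, actPts_mul, mul_actPts, mul_assoc])
    (by simp only [sndPt_mulHom, mul_assoc])
  one_mul f := ext_pt
    (by simp only [fstPt_mulHom, fstPt_oneHom, sndPt_oneHom, one_actPts, one_mul])
    (by simp only [sndPt_mulHom, sndPt_oneHom, one_mul])
  mul_one f := ext_pt
    (by simp only [fstPt_mulHom, fstPt_oneHom, actPts_one, mul_one])
    (by simp only [sndPt_mulHom, sndPt_oneHom, mul_one])
  inv_mul f := ext_pt
    (by rw [fstPt_mulHom, fstPt_invHom, sndPt_invHom, ← actPts_mul, inv_mul_cancel, actPts_one,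
      fstPt_oneHom])
    (by simp only [sndPt_mulHom, sndPt_invHom, sndPt_oneHom, inv_mul_cancel])
  mul_inv f := ext_pt
    (by rw [fstPt_mulHom, fstPt_invHom, ← mul_actPts, mul_inv_cancel, one_actPts, mul_inv_cancel,
      fstPt_oneHom])
    (by simp only [sndPt_mulHom, sndPt_invHom, sndPt_oneHom, mul_inv_cancel])

instance : Ring (Wreath k A Q) := (coalgGroup k A Q).ring

/-- The Hopf algebra structure of the smash product `A^Q # Q`. -/
instance : HopfAlgebra k (Wreath k A Q) := (coalgGroup k A Q).hopfAlgebra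

end Wreath

end WreathProduct

section Formulas

section Generic

variable {k : Type u} [Field k] {Y Z C : Type*}
  [AddCommMonoid Y] [Module k Y] [Coalgebra k Y] [IsCocomm k Y]
  [AddCommMonoid Z] [Module k Z] [Coalgebra k Z] [IsCocomm k Z]
  [AddCommMonoid C] [Module k C] [Coalgebra k C] [IsCocomm k C]

theorem pair_snd_fst (t : Y ⊗[k] Z) :
    pair (snd : Y ⊗[k] Z →ₗc[k] Z) fst t = TensorProduct.comm k Y Z t := by
  have h := congrArg (TensorProduct.comm k Y Z) (map_fst_snd_comul t)
  rw [← TensorProduct.map_comm, comm_comul] at h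
  exact h

theorem pair_map_fst_map_snd (y : Y) (z : Z) (c : C) :
    pair (Coalgebra.TensorProduct.map (fst : Y ⊗[k] Z →ₗc[k] Y) (CoalgHom.id k C))
      (Coalgebra.TensorProduct.map (snd : Y ⊗[k] Z →ₗc[k] Z) (CoalgHom.id k C))
      ((y ⊗ₜ[k] z) ⊗ₜ[k] c) =
    TensorProduct.map (TensorProduct.mk k Y C y) (TensorProduct.mk k Z C z)
      (comul (R := k) c) := by
  have e : ∀ (t : (Y ⊗[k] Z) ⊗[k] (Y ⊗[k] Z)) (w : C ⊗[k] C),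
      TensorProduct.map
        (Coalgebra.TensorProduct.map (fst : Y ⊗[k] Z →ₗc[k] Y) (CoalgHom.id k C)).toLinearMap
        (Coalgebra.TensorProduct.map (snd : Y ⊗[k] Z →ₗc[k] Z) (CoalgHom.id k C)).toLinearMap
        (TensorProduct.AlgebraTensorModule.tensorTensorTensorComm k k k k _ _ C C (t ⊗ₜ w)) =
      TensorProduct.AlgebraTensorModule.tensorTensorTensorComm k k k k Y Z C C
        (TensorProduct.map (fst : Y ⊗[k] Z →ₗc[k] Y).toLinearMap
          (snd : Y ⊗[k] Z →ₗc[k] Z).toLinearMap t ⊗ₜ w) := by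
    intro t w
    induction t with
    | zero => simp
    | add z w hz hw => simp only [map_add, hz, hw, TensorProduct.add_tmul]
    | tmul a b =>
      induction w with
      | zero => simp
      | add z w hz hw => simp only [map_add, hz, hw, TensorProduct.tmul_add]
      | tmul c d => rfl
  rw [pair_apply, TensorProduct.comul_tmul]
  refine (e _ _).trans ?_
  rw [map_fst_snd_comul]
  generalize comul (R := k) c = w
  induction w with
  | zero => simp
  | add z w hz hw => simp only [map_add, hz, hw, TensorProduct.tmul_add]
  | tmul c d => rfl

theorem pair_assoc_fst :
    pair ((fst : Y ⊗[k] Z →ₗc[k] Y).comp fst)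
      (pair ((snd : Y ⊗[k] Z →ₗc[k] Z).comp fst) ((fst : Y ⊗[k] Z →ₗc[k] Y).comp snd)) =
    (Coalgebra.TensorProduct.assoc k k Y Z Y : (Y ⊗[k] Z) ⊗[k] Y →ₗc[k] Y ⊗[k] (Z ⊗[k] Y)).comp
      (Coalgebra.TensorProduct.map (CoalgHom.id k (Y ⊗[k] Z)) (fst : Y ⊗[k] Z →ₗc[k] Y)) := by
  apply pair_ext
  · rw [fst_pair]
    apply CoalgHom.coe_linearMap_injective
    apply TensorProduct.ext_fourfold'
    intro h q l r
    simp [smul_smul, TensorProduct.tmul_smul]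
    try (congr 1; ring)
  · rw [snd_pair]
    apply pair_ext
    · rw [fst_pair]
      apply CoalgHom.coe_linearMap_injective
      apply TensorProduct.ext_fourfold'
      intro h q l r
      simp [smul_smul, TensorProduct.tmul_smul]
      try (congr 1; ring)
    · rw [snd_pair]
      apply CoalgHom.coe_linearMap_injective
      apply TensorProduct.ext_fourfold'
      intro h q l r
      simp [smul_smul, TensorProduct.tmul_smul]
      try (congr 1; ring)

theorem pair_snd_snd : pair ((snd : Y ⊗[k] Z →ₗc[k] Z).comp fst)
      ((snd : Y ⊗[k] Z →ₗc[k] Z).comp snd) =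
    Coalgebra.TensorProduct.map (snd : Y ⊗[k] Z →ₗc[k] Z) (snd : Y ⊗[k] Z →ₗc[k] Z) := by
  apply pair_ext
  · rw [fst_pair]
    apply CoalgHom.coe_linearMap_injective
    apply TensorProduct.ext_fourfold'
    intro h q l r
    simp [smul_smul]
    try (congr 1; ring)
  · rw [snd_pair]
    apply CoalgHom.coe_linearMap_injective
    apply TensorProduct.ext_fourfold'
    intro h q l r
    simp [smul_smul]
    try (congr 1; ring)

theorem pair_comp_right {X W : Type*} [AddCommMonoid X] [Module k X] [Coalgebra k X]
    [IsCocomm k X] [AddCommMonoid W] [Module k W] [Coalgebra k W] (a : Z →ₗc[k] W)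
    (f : X →ₗc[k] Y) (g : X →ₗc[k] Z) :
    pair f (a.comp g) = (Coalgebra.TensorProduct.map (CoalgHom.id k Y) a).comp (pair f g) := by
  rw [map_pair, CoalgHom.id_comp]

theorem smash_formula (a : Z ⊗[k] Y →ₗc[k] Y) (m : Y ⊗[k] Y →ₗc[k] Y) (n : Z ⊗[k] Z →ₗc[k] Z)
    (h l : Y) (q r : Z) :
    pair (m.comp (pair ((fst : Y ⊗[k] Z →ₗc[k] Y).comp fst)
        (a.comp (pair ((snd : Y ⊗[k] Z →ₗc[k] Z).comp fst) ((fst : Y ⊗[k] Z →ₗc[k] Y).comp snd)))))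
      (n.comp (pair ((snd : Y ⊗[k] Z →ₗc[k] Z).comp fst) ((snd : Y ⊗[k] Z →ₗc[k] Z).comp snd)))
      ((h ⊗ₜ[k] q) ⊗ₜ[k] (l ⊗ₜ[k] r)) =
    TensorProduct.map
      ((m : Y ⊗[k] Y →ₗ[k] Y) ∘ₗ TensorProduct.mk k Y Y h ∘ₗ (a : Z ⊗[k] Y →ₗ[k] Y) ∘ₗ
        (TensorProduct.mk k Z Y).flip l)
      ((n : Z ⊗[k] Z →ₗ[k] Z) ∘ₗ (TensorProduct.mk k Z Z).flip r) (comul (R := k) q) := by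
  rw [pair_comp_right a, pair_assoc_fst, pair_snd_snd, pair_apply]
  generalize hF : (m.comp ((Coalgebra.TensorProduct.map (CoalgHom.id k Y) a).comp
    ((Coalgebra.TensorProduct.assoc k k Y Z Y : (Y ⊗[k] Z) ⊗[k] Y →ₗc[k] Y ⊗[k] (Z ⊗[k] Y)).comp
      (Coalgebra.TensorProduct.map (CoalgHom.id k (Y ⊗[k] Z))
        (fst : Y ⊗[k] Z →ₗc[k] Y))))) = F
  generalize hG : n.comp (Coalgebra.TensorProduct.map (snd : Y ⊗[k] Z →ₗc[k] Z)
    (snd : Y ⊗[k] Z →ₗc[k] Z)) = G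
  have f1 : ∀ h q l r, F ((h ⊗ₜ q) ⊗ₜ (l ⊗ₜ r)) = counit (R := k) r • m (h ⊗ₜ a (q ⊗ₜ l)) := by
    intro h q l r
    rw [← hF]
    change m (h ⊗ₜ a (q ⊗ₜ (counit (R := k) r • l))) = _
    rw [TensorProduct.tmul_smul, map_smul, TensorProduct.tmul_smul, map_smul]
  have g1 : ∀ h q l r, G ((h ⊗ₜ q) ⊗ₜ (l ⊗ₜ r)) =
      (counit (R := k) h * counit (R := k) l) • n (q ⊗ₜ r) := by
    intro h q l r
    rw [← hG]
    change n ((counit (R := k) h • q) ⊗ₜ (counit (R := k) l • r)) = _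
    rw [TensorProduct.tmul_smul, ← TensorProduct.smul_tmul', map_smul, map_smul, smul_smul,
      mul_comm]
  have e : ∀ (H L : Y ⊗[k] Y) (K R : Z ⊗[k] Z),
      TensorProduct.map F.toLinearMap G.toLinearMap
        (TensorProduct.AlgebraTensorModule.tensorTensorTensorComm k k k k _ _ _ _
          (TensorProduct.AlgebraTensorModule.tensorTensorTensorComm k k k k _ _ _ _ (H ⊗ₜ K) ⊗ₜ
            TensorProduct.AlgebraTensorModule.tensorTensorTensorComm k k k k _ _ _ _ (L ⊗ₜ R))) =
      TensorProduct.map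
        ((m : Y ⊗[k] Y →ₗ[k] Y) ∘ₗ
          TensorProduct.mk k Y Y (TensorProduct.rid k Y (counit.lTensor Y H)) ∘ₗ
          (a : Z ⊗[k] Y →ₗ[k] Y) ∘ₗ
          (TensorProduct.mk k Z Y).flip (TensorProduct.rid k Y (counit.lTensor Y L)))
        ((n : Z ⊗[k] Z →ₗ[k] Z) ∘ₗ
          (TensorProduct.mk k Z Z).flip (TensorProduct.lid k Z (counit.rTensor Z R))) K := by
    intro H L K R
    induction K with
    | zero => simp
    | add z w hz hw => simp only [map_add, hz, hw, TensorProduct.add_tmul, TensorProduct.tmul_add]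
    | tmul q₁ q₂ =>
      induction H with
      | zero => simp
      | add z w hz hw =>
        simp only [map_add, hz, hw, TensorProduct.add_tmul, TensorProduct.map_tmul,
          LinearMap.comp_apply, LinearMap.add_apply]
      | tmul h₁ h₂ =>
        induction L with
        | zero => simp
        | add z w hz hw =>
          simp only [map_add, hz, hw, TensorProduct.add_tmul, TensorProduct.tmul_add,
            TensorProduct.map_tmul, LinearMap.comp_apply, LinearMap.add_apply]
        | tmul l₁ l₂ =>
          induction R with
          | zero => simp
          | add z w hz hw =>
            simp only [map_add, hz, hw, TensorProduct.tmul_add, TensorProduct.map_tmul,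
              LinearMap.comp_apply, LinearMap.add_apply]
          | tmul r₁ r₂ =>
            change F ((h₁ ⊗ₜ q₁) ⊗ₜ (l₁ ⊗ₜ r₁)) ⊗ₜ[k] G ((h₂ ⊗ₜ q₂) ⊗ₜ (l₂ ⊗ₜ r₂)) =
              m ((counit (R := k) h₂ • h₁) ⊗ₜ a (q₁ ⊗ₜ (counit (R := k) l₂ • l₁))) ⊗ₜ[k]
                n (q₂ ⊗ₜ (counit (R := k) r₁ • r₂))
            rw [f1, g1]
            simp only [TensorProduct.tmul_smul, ← TensorProduct.smul_tmul', map_smul, smul_smul]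
            congr 1
            ring
  rw [TensorProduct.comul_tmul, TensorProduct.comul_tmul, TensorProduct.comul_tmul]
  refine (e _ _ _ _).trans ?_
  simp

end Generic

section Shift

variable {k : Type u} [Field k] {M Q : Type u} [AddCommGroup M] [Module k M] [Coalgebra k M]
  [IsCocomm k M] [Ring Q] [HopfAlgebra k Q] [IsCocomm k Q]

theorem shift_fst_tmul (q : Q) (f : M) (c : Q) :
    Coalgebra.TensorProduct.map (snd : Q ⊗[k] M →ₗc[k] M) (CoalgHom.id k Q)
      (Measuring.shift ⟨fst⟩ ((q ⊗ₜ[k] f) ⊗ₜ[k] c)) = f ⊗ₜ[k] (c * q) := by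
  let θ : (Q ⊗[k] M) ⊗[k] Q →ₗc[k] M ⊗[k] Q :=
    (pair snd fst).comp ((Coalgebra.TensorProduct.map (Bialgebra.mulCoalgHom k Q)
      (CoalgHom.id k M)).comp
        (((Coalgebra.TensorProduct.assoc k k Q Q M).symm :
          Q ⊗[k] (Q ⊗[k] M) →ₗc[k] (Q ⊗[k] Q) ⊗[k] M).comp (pair snd fst)))
  have hθ : ∀ q f c, θ ((q ⊗ₜ f) ⊗ₜ c) = f ⊗ₜ (c * q) := by
    intro q f c
    simp only [θ, CoalgHom.comp_apply, pair_snd_fst, TensorProduct.comm_tmul]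
    rfl
  have h : (Coalgebra.TensorProduct.map (snd : Q ⊗[k] M →ₗc[k] _)
      (CoalgHom.id k Q)).comp (Measuring.shift ⟨fst⟩) = θ := by
    rw [Measuring.shift, map_pair]
    apply pair_ext
    · rw [fst_pair]
      apply CoalgHom.coe_linearMap_injective
      apply TensorProduct.ext_threefold
      intro q f c
      change snd (fst ((q ⊗ₜ[k] f) ⊗ₜ[k] c)) = fst (θ ((q ⊗ₜ f) ⊗ₜ c))
      simp [hθ, smul_smul]
    · rw [snd_pair, CoalgHom.id_comp, Pts.mul_hom]
      have e : pair (Measuring.sndPts : Pts k ((Q ⊗[k] M) ⊗[k] Q) Q).hom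
          (Pts.comp ⟨fst⟩ fst : Pts k ((Q ⊗[k] M) ⊗[k] Q) Q).hom =
          (Coalgebra.TensorProduct.map (CoalgHom.id k Q) fst).comp (pair snd fst) := by
        rw [map_pair, CoalgHom.id_comp]; rfl
      rw [e]
      apply CoalgHom.coe_linearMap_injective
      apply TensorProduct.ext_threefold
      intro q f c
      change Bialgebra.mulCoalgHom k Q (Coalgebra.TensorProduct.map (CoalgHom.id k Q) fst
        (pair snd fst ((q ⊗ₜ[k] f) ⊗ₜ[k] c))) = snd (θ ((q ⊗ₜ f) ⊗ₜ c))
      rw [hθ, pair_snd_fst, TensorProduct.comm_tmul]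
      change c * (counit (R := k) f • q) = counit (R := k) f • (c * q)
      rw [mul_smul_comm]
  rw [← hθ, ← h]
  rfl

end Shift

variable {k : Type u} [Field k]
  {C D : Type u} [AddCommGroup C] [Module k C] [Coalgebra k C] [IsCocomm k C]
  [Ring D] [HopfAlgebra k D] [IsCocomm k D]
  {A Q : Type u} [Ring A] [HopfAlgebra k A] [IsCocomm k A]
  [Ring Q] [HopfAlgebra k Q] [IsCocomm k Q]

namespace Measuring

/-- `(fg)@c = ∑ (f@c₁)(g@c₂)`. -/
theorem eval_mul (f g : Measuring k C D) (c : C) : eval k C D ((f * g) ⊗ₜ[k] c) =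
    LinearMap.mul' k D (TensorProduct.map (evalLin f) (evalLin g) (comul (R := k) c)) := by
  change eval k C D (mulHom k C D (f ⊗ₜ[k] g) ⊗ₜ[k] c) = _
  have e : pair (ev (fst : Measuring k C D ⊗[k] Measuring k C D →ₗc[k] _)).hom
      (ev (snd : Measuring k C D ⊗[k] Measuring k C D →ₗc[k] _)).hom =
      (Coalgebra.TensorProduct.map (eval k C D) (eval k C D)).comp
        (pair (Coalgebra.TensorProduct.map fst (CoalgHom.id k C))
          (Coalgebra.TensorProduct.map snd (CoalgHom.id k C))) := by
    rw [map_pair]; rfl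
  rw [mulHom, eval_lift, Pts.mul_hom, e, CoalgHom.comp_apply, CoalgHom.comp_apply,
    pair_map_fst_map_snd, Bialgebra.coe_mulCoalgHom]
  change LinearMap.mul' k D (TensorProduct.map (eval k C D).toLinearMap (eval k C D).toLinearMap _)
    = _
  rw [← LinearMap.comp_apply (TensorProduct.map _ _) (TensorProduct.map _ _),
    ← TensorProduct.map_comp]
  rfl

theorem eval_one (c : C) : eval k C D ((1 : Measuring k C D) ⊗ₜ[k] c) =
    counit (R := k) c • (1 : D) := by
  change eval k C D (oneHom k C D 1 ⊗ₜ[k] c) = _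
  rw [oneHom, eval_lift, Pts.one_hom, CoalgHom.comp_apply]
  change algebraMap k D (counit (R := k) ((1 : k) ⊗ₜ[k] c)) = _
  simp [Algebra.algebraMap_eq_smul_one]

/-- `(q ★ f)@c = f@(cq)`. -/
theorem eval_act (q : Q) (f : Measuring k Q A) (c : Q) :
    eval k Q A (act k A Q (q ⊗ₜ[k] f) ⊗ₜ[k] c) = eval k Q A (f ⊗ₜ[k] (c * q)) := by
  rw [act, eval_lift, ← shift_fst_tmul]
  rfl

variable (k A Q) in
/-- Evaluation at `1`, a homomorphism of Hopf algebras `A^Q → A`, `f ↦ f@1`. -/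
def evalOne : Measuring k Q A →ₐc[k] A where
  toFun f := eval k Q A (f ⊗ₜ[k] 1)
  map_add' f g := by rw [TensorProduct.add_tmul, map_add]
  map_smul' r f := by rw [← TensorProduct.smul_tmul', map_smul]; rfl
  map_one' := by rw [eval_one, Bialgebra.counit_one, one_smul]
  map_mul' f g := by rw [eval_mul, Bialgebra.comul_one]; rfl
  counit_comp := by
    ext f
    change counit (R := k) (eval k Q A (f ⊗ₜ[k] 1)) = _
    rw [CoalgHomClass.counit_comp_apply]
    rw [TensorProduct.counit_tmul, Bialgebra.counit_one, one_smul]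
  map_comp_comul := by
    ext f
    have h := CoalgHomClass.map_comp_comul_apply (eval k Q A) (f ⊗ₜ[k] (1 : Q))
    refine Eq.trans ?_ h
    rw [TensorProduct.comul_tmul, Bialgebra.comul_one]
    simp only [LinearMap.comp_apply]
    generalize comul (R := k) f = z
    induction z with
    | zero => rw [TensorProduct.zero_tmul, LinearMap.map_zero, LinearEquiv.map_zero, LinearMap.map_zero]
    | add z w hz hw =>
      rw [TensorProduct.add_tmul, LinearMap.map_add, LinearEquiv.map_add, LinearMap.map_add, hz, hw]
    | tmul a b => rfl

theorem evalOne_apply (f : Measuring k Q A) : evalOne k A Q f = eval k Q A (f ⊗ₜ[k] 1) := rfl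

end Measuring

namespace Wreath

open Measuring

/-- `(h # q)(l # r) = ∑ h (q₁ ★ l) # q₂ r`. -/
theorem mk_mul_mk (h l : Measuring k Q A) (q r : Q) {ι : Type*} (𝓡 : Coalgebra.Repr k q ι) :
    mk h q * mk l r =
      ∑ i ∈ 𝓡.index, mk (h * act k A Q (𝓡.left i ⊗ₜ[k] l)) (𝓡.right i * r) := by
  refine (smash_formula (act k A Q) (Bialgebra.mulCoalgHom k (Measuring k Q A))
    (Bialgebra.mulCoalgHom k Q) h l q r).trans ?_
  rw [← 𝓡.eq, map_sum]
  rfl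

end Wreath

end Formulas

section Extensions

variable (k : Type u) [Field k]

namespace Wreath

variable {k} {A Q : Type u} [Ring A] [HopfAlgebra k A] [IsCocomm k A]
  [Ring Q] [HopfAlgebra k Q] [IsCocomm k Q]

theorem one_eq : (1 : Wreath k A Q) = mk 1 1 := by
  change pair (1 : Pts k k (Measuring k Q A)).hom (1 : Pts k k Q).hom (1 : k) = _
  rw [pair_apply, CommSemiring.comul_apply, TensorProduct.map_tmul]
  change (1 : Pts k k (Measuring k Q A)).hom 1 ⊗ₜ[k] (1 : Pts k k Q).hom 1 = _
  rw [Pts.one_hom, Pts.one_hom, CoalgHom.comp_apply, CoalgHom.comp_apply]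
  change algebraMap k _ (counit (R := k) (1 : k)) ⊗ₜ[k] algebraMap k Q (counit (R := k) (1 : k)) = _
  simp [mk]

end Wreath

/-- The Hopf kernel `{e | ∑ e₁ ⊗ π(e₂) = e ⊗ 1}` of `π : E → Q`. -/
def hker {E Q : Type*} [Ring E] [HopfAlgebra k E] [Ring Q] [HopfAlgebra k Q] (π : E →ₐc[k] Q) :
    Set E :=
  {e | (π : E →ₗ[k] Q).lTensor E (comul (R := k) e) = e ⊗ₜ[k] 1}

/-- A cleavage of `π : E → Q`: a coalgebra map `γ : Q → E` which is a map of `Q`-comodules and is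
invertible for the convolution product. -/
structure IsCleavage {E Q : Type*} [Ring E] [HopfAlgebra k E] [Ring Q] [HopfAlgebra k Q]
    (π : E →ₐc[k] Q) (γ : Q →ₗc[k] E) : Prop where
  comodule : ∀ q, (π : E →ₗ[k] Q).lTensor E (comul (R := k) (γ q)) =
    (γ : Q →ₗ[k] E).rTensor Q (comul (R := k) q)
  invertible : IsUnit (WithConv.toConv (γ : Q →ₗ[k] E))

variable (A Q : Type u) [Ring A] [HopfAlgebra k A] [IsCocomm k A]
  [Ring Q] [HopfAlgebra k Q] [IsCocomm k Q]

/-- An extension `A → E → Q` of cocommutative Hopf algebras: `ι` is injective with range the Hopf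
kernel of `π`, and `π` is surjective. -/
structure Extension where
  E : Type u
  [ring : Ring E]
  [hopf : HopfAlgebra k E]
  [cocomm : IsCocomm k E]
  ι : A →ₐc[k] E
  π : E →ₐc[k] Q
  injective : Function.Injective ι
  surjective : Function.Surjective π
  exact : Set.range ι = hker k π

attribute [instance] Extension.ring Extension.hopf Extension.cocomm

/-- A cleft extension: one that admits a cleavage. -/
structure CleftExtension extends Extension k A Q where
  cleft : ∃ γ : Q →ₗc[k] E, IsCleavage k π γ

namespace CleftExtension

variable {k A Q}

/-- Isomorphisms of extensions that are the identity on `A` and on `Q`. -/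
def Equivalent (X Y : CleftExtension k A Q) : Prop :=
  ∃ φ : X.E ≃ₐc[k] Y.E, (∀ a, φ (X.ι a) = Y.ι a) ∧ ∀ e, Y.π (φ e) = X.π e

/-- Isomorphisms of extensions that are allowed to move `A` and `Q`. -/
def Isomorphic (X Y : CleftExtension k A Q) : Prop :=
  ∃ (α : A ≃ₐc[k] A) (φ : X.E ≃ₐc[k] Y.E) (ω : Q ≃ₐc[k] Q),
    (∀ a, φ (X.ι a) = Y.ι (α a)) ∧ ∀ e, Y.π (φ e) = ω (X.π e)

variable (k A Q) in
/-- Cleft extensions up to equivalence. -/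
def setoid : Setoid (CleftExtension k A Q) where
  r := Equivalent
  iseqv := by
    refine ⟨fun X => ⟨BialgEquiv.refl k X.E, fun _ => rfl, fun _ => rfl⟩, ?_, ?_⟩
    · rintro X Y ⟨φ, h₁, h₂⟩
      refine ⟨φ.symm, fun a => ?_, fun e => ?_⟩
      · rw [← h₁]
        exact φ.toEquiv.symm_apply_apply _
      · rw [← h₂]
        exact congrArg Y.π (φ.toEquiv.apply_symm_apply e)
    · rintro X Y Z ⟨φ, h₁, h₂⟩ ⟨ψ, h₃, h₄⟩
      refine ⟨φ.trans ψ, fun a => ?_, fun e => ?_⟩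
      · change ψ (φ (X.ι a)) = _
        rw [h₁, h₃]
      · change Z.π (ψ (φ e)) = _
        rw [h₄, h₂]

end CleftExtension

/-- Hopf subalgebras. -/
structure HopfSubalgebra (H : Type*) [Ring H] [HopfAlgebra k H] extends Subalgebra k H where
  comul_mem : ∀ x ∈ carrier, comul (R := k) x ∈
    LinearMap.range (TensorProduct.map toSubalgebra.toSubmodule.subtype
      toSubalgebra.toSubmodule.subtype)
  antipode_mem : ∀ x ∈ carrier, HopfAlgebra.antipode k x ∈ carrier

/-- Hopf subalgebras `H` of `A ≀ Q` such that `τ` maps `H` onto `Q` and evaluation at `1` restricts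
to a bijection (hence an isomorphism of Hopf algebras) from `H ∩ A^Q` to `A`. -/
structure WreathSubalgebra extends HopfSubalgebra k (Wreath k A Q) where
  onto : ∀ q : Q, ∃ e ∈ carrier, Wreath.right k A Q e = q
  bijOn : Set.BijOn (Measuring.evalOne k A Q) {f | Wreath.mk f 1 ∈ carrier} Set.univ

namespace WreathSubalgebra

variable {k A Q}

/-- Conjugacy: `H' = {∑ x₁ e S(x₂) | e ∈ H} = x H S(x)` for a group-like element `x` of `A ≀ Q`. -/
def IsConj (H H' : WreathSubalgebra k A Q) : Prop :=
  ∃ x : Wreath k A Q, IsGroupLikeElem k x ∧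
    H'.carrier = (fun e => x * e * HopfAlgebra.antipode k x) '' H.carrier

variable (k A Q) in
/-- Conjugacy classes. -/
def setoid : Setoid (WreathSubalgebra k A Q) where
  r := IsConj
  iseqv := by
    refine ⟨fun H => ⟨1, IsGroupLikeElem.one, ?_⟩, ?_, ?_⟩
    · simp
    · rintro H H' ⟨x, hx, h⟩
      refine ⟨HopfAlgebra.antipode k x, hx.antipode, ?_⟩
      rw [h, Set.image_image]
      have e : ∀ e : Wreath k A Q, HopfAlgebra.antipode k x * (x * e * HopfAlgebra.antipode k x) *
          HopfAlgebra.antipode k (HopfAlgebra.antipode k x) = e := by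
        intro e
        have h1 := hx.antipode_mul_cancel
        have h2 := hx.antipode.mul_antipode_cancel
        calc _ = (HopfAlgebra.antipode k x * x) * e * (HopfAlgebra.antipode k x *
          HopfAlgebra.antipode k (HopfAlgebra.antipode k x)) := by simp only [mul_assoc]
          _ = e := by rw [h1, h2, one_mul, mul_one]
      simp [e]
    · rintro H H' H'' ⟨x, hx, h⟩ ⟨y, hy, h'⟩
      refine ⟨y * x, hy.mul hx, ?_⟩
      rw [h', h, Set.image_image]
      congr 1
      funext e
      have : HopfAlgebra.antipode k (y * x) =
          HopfAlgebra.antipode k x * HopfAlgebra.antipode k y := by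
        have h1 := (hy.mul hx).antipode_mul_cancel
        have h2 : y * x * (HopfAlgebra.antipode k x * HopfAlgebra.antipode k y) = 1 := by
          calc _ = y * (x * HopfAlgebra.antipode k x) * HopfAlgebra.antipode k y := by
                simp only [mul_assoc]
            _ = 1 := by rw [hx.mul_antipode_cancel, mul_one, hy.mul_antipode_cancel]
        exact left_inv_eq_right_inv h1 h2
      rw [this]
      simp only [mul_assoc]

end WreathSubalgebra

variable {k A Q}

/-- `X` is realized by `H`: there is an isomorphism of Hopf algebras from `X.E` onto `H` under which
`X.π` becomes the restriction of `τ`, and `X.ι` becomes a section of the evaluation at `1`. -/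
def Realizes (X : CleftExtension k A Q) (H : WreathSubalgebra k A Q) : Prop :=
  ∃ j : X.E →ₐc[k] Wreath k A Q, Function.Injective j ∧ Set.range j = H.carrier ∧
    (∀ e, Wreath.right k A Q (j e) = X.π e) ∧
    ∀ a, ∃ f, j (X.ι a) = Wreath.mk f 1 ∧ Measuring.evalOne k A Q f = a

/-- The automorphism `f # q ↦ (α ∘ f ∘ ω⁻¹) # ω(q)` of `A ≀ Q` that is induced by automorphisms `α`
of `A` and `ω` of `Q`; here `(α ∘ f ∘ ω⁻¹)@c = α(f@(ω⁻¹(c)))`. -/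
def wreathMap (α : A ≃ₐc[k] A) (ω : Q ≃ₐc[k] Q) : Wreath k A Q →ₗc[k] Wreath k A Q :=
  Coalgebra.TensorProduct.map
    (Measuring.lift ((α : A →ₗc[k] A).comp ((Measuring.eval k Q A).comp
      (Coalgebra.TensorProduct.map (CoalgHom.id k (Measuring k Q A)) (ω.symm : Q →ₗc[k] Q)))))
    (ω : Q →ₗc[k] Q)

end Extensions

end HopfWreath

end

set_option linter.unusedSectionVars false

noncomputable section

/-! Cocommutative Hopf algebras are group objects among cocommutative coalgebras: for each
cocommutative coalgebra F the coalgebra maps F → G form a group `Pts k F G`, natural in F. On such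
points A^Q is the group of functions from Q to A (the F-points of A^Q are the points of A over F ⊗
Q), and A ≀ Q is a semidirect product. The classical argument for groups therefore runs on
generalized points, and its conclusions are read off at universal points: identities and projections
of tensor products.

Let γ be a coalgebra section of π with γ(1) = 1. Then π kills γ(c) e γ(cπ(e))⁻¹, which is thus
ι(f_e(c)) for a point f of A^Q over E (`Extension.exists_isCocycle`). The cocycle identity makes e ↦
f_e # π(e) a Hopf map, and ι(f_e@1) γ(π(e)) = e makes it injective; so every cleft extension is
realized.

For a realization j let θ(e) be the value at 1 of the A^Q-component of j(e). This θ is left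
A-linear, and two realizations are conjugate by the function t(c) = θ'(γ(c))⁻¹ θ(γ(c))
(`IsRealization.exists_conj`). Conversely, after correction by a group-like element of H,
conjugating H by x amounts to conjugating by some f # 1 with f@1 = 1, which preserves realizations
(`Realizes.of_isConj`). Extensions realized by the same H are both identified with H, hence are
equivalent. Automorphisms α and ω act on A ≀ Q and transport realizations, which gives the statement
on isomorphisms.

For surjectivity, a member H of 𝒮 is itself an extension of Q by H ∩ A^Q ≅ A. Its cleftness is the
step where coalgebras differ from groups. With ρ = θ for the inclusion of H, the map e ↦ ι(ρ(e))⁻¹ e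
is an idempotent coalgebra map that picks one representative in each A-orbit. Its image R maps onto
Q, and the map R → Q is injective on F-points for all F, that is, a monomorphism. Monomorphisms of
cocommutative coalgebras are injective (`injective_of_mono`): in a finite-dimensional subcoalgebra
this dualizes to the fact that an epimorphism of commutative algebras onto which the target is
finite is surjective. So R ≅ Q, and the inverse is the required section. -/

namespace HopfWreath

/-! ### Duals of finite-dimensional commutative algebras -/

section DualCoalgebra

variable {k T : Type*} [Field k] [CommRing T] [Algebra k T] [FiniteDimensional k T]

variable (k T) in
/-- The linear dual of a finite-dimensional commutative algebra, as a coalgebra. -/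
def DualCoalg : Type _ := T →ₗ[k] k

namespace DualCoalg

instance : AddCommGroup (DualCoalg k T) := inferInstanceAs (AddCommGroup (T →ₗ[k] k))
instance : Module k (DualCoalg k T) := inferInstanceAs (Module k (T →ₗ[k] k))

variable (k T) in
/-- The pairing of `T^* ⊗ T^*` with `T ⊗ T` is perfect. -/
def distrib : DualCoalg k T ⊗[k] DualCoalg k T ≃ₗ[k] Module.Dual k (T ⊗[k] T) :=
  TensorProduct.dualDistribEquiv k T T

theorem distrib_tmul (σ τ : DualCoalg k T) (a b : T) :
    distrib k T (σ ⊗ₜ τ) (a ⊗ₜ b) =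
      (show T →ₗ[k] k from σ) a * (show T →ₗ[k] k from τ) b :=
  TensorProduct.dualDistrib_apply _ _ _ _

theorem distrib_ext {z w : DualCoalg k T ⊗[k] DualCoalg k T}
    (h : ∀ a b, distrib k T z (a ⊗ₜ b) = distrib k T w (a ⊗ₜ b)) : z = w :=
  (distrib k T).injective (TensorProduct.ext' h)

/-- Comultiplication is the transpose of multiplication; finite dimension enters through T^* ⊗ T^* ≅
(T ⊗ T)^*. -/
instance : CoalgebraStruct k (DualCoalg k T) where
  comul := (distrib k T).symm.toLinearMap ∘ₗ (LinearMap.mul' k T).dualMap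
  counit := LinearMap.applyₗ (R := k) (1 : T)

theorem counit_apply (τ : DualCoalg k T) :
    counit (R := k) τ = (show T →ₗ[k] k from τ) 1 := rfl

theorem distrib_comul (τ : DualCoalg k T) (a b : T) :
    distrib k T (comul (R := k) τ) (a ⊗ₜ b) = (show T →ₗ[k] k from τ) (a * b) := by
  change distrib k T ((distrib k T).symm _) _ = _
  rw [LinearEquiv.apply_symm_apply]
  rfl

/-- The pairing of `T^* ⊗ T^* ⊗ T^*` with `T ⊗ T ⊗ T`. -/
def distrib₃ : DualCoalg k T ⊗[k] (DualCoalg k T ⊗[k] DualCoalg k T) ≃ₗ[k]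
    Module.Dual k (T ⊗[k] (T ⊗[k] T)) :=
  (TensorProduct.congr (LinearEquiv.refl k (T →ₗ[k] k)) (distrib k T)).trans
    (TensorProduct.dualDistribEquiv k T (T ⊗[k] T))

theorem distrib₃_tmul (σ : DualCoalg k T) (z : DualCoalg k T ⊗[k] DualCoalg k T) (a b c : T) :
    distrib₃ (σ ⊗ₜ z) (a ⊗ₜ (b ⊗ₜ c)) =
      (show T →ₗ[k] k from σ) a * distrib k T z (b ⊗ₜ c) :=
  TensorProduct.dualDistrib_apply _ _ _ _

/-- Pairing with T ⊗ T ⊗ T and with T turns the coalgebra axioms into associativity and the unit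
laws of T. -/
instance : Coalgebra k (DualCoalg k T) where
  coassoc := by
    ext τ
    apply distrib₃.injective
    apply TensorProduct.ext
    ext a : 1
    apply TensorProduct.ext'
    intro b c
    have e1 : ∀ z : DualCoalg k T ⊗[k] DualCoalg k T,
        distrib₃ (TensorProduct.assoc k _ _ _ (comul.rTensor _ z)) (a ⊗ₜ (b ⊗ₜ c)) =
          distrib k T z ((a * b) ⊗ₜ c) := by
      intro z
      induction z with
      | zero => simp
      | add z w hz hw => simp only [map_add, LinearMap.add_apply, hz, hw]
      | tmul σ τ =>
        rw [distrib_tmul, ← distrib_comul, LinearMap.rTensor_tmul]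
        generalize comul (R := k) σ = y
        induction y with
        | zero => simp
        | add z w hz hw =>
          simp only [map_add, LinearMap.add_apply, hz, hw, TensorProduct.add_tmul, add_mul]
        | tmul σ' τ' =>
          rw [TensorProduct.assoc_tmul, distrib₃_tmul, distrib_tmul, distrib_tmul, mul_assoc]
    have e2 : ∀ z : DualCoalg k T ⊗[k] DualCoalg k T,
        distrib₃ (comul.lTensor _ z) (a ⊗ₜ (b ⊗ₜ c)) = distrib k T z (a ⊗ₜ (b * c)) := by
      intro z
      induction z with
      | zero => simp
      | add z w hz hw => simp only [map_add, LinearMap.add_apply, hz, hw]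
      | tmul σ τ => rw [distrib_tmul, LinearMap.lTensor_tmul, distrib₃_tmul, distrib_comul]
    refine (e1 _).trans (Eq.trans ?_ (e2 _).symm)
    rw [distrib_comul, distrib_comul, mul_assoc]
  rTensor_counit_comp_comul := by
    ext τ
    apply (TensorProduct.lid k _).injective
    refine LinearMap.ext (R := k) (M := T) (M₃ := k) fun a => ?_
    have e : ∀ z : DualCoalg k T ⊗[k] DualCoalg k T,
        (show T →ₗ[k] k from TensorProduct.lid k (DualCoalg k T) (counit.rTensor _ z)) a =
          distrib k T z (1 ⊗ₜ a) := by
      intro z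
      induction z with
      | zero => simp; rfl
      | add z w hz hw => simp only [map_add, LinearMap.add_apply, ← hz, ← hw]; rfl
      | tmul σ τ => rw [distrib_tmul]; rfl
    refine (e _).trans ?_
    rw [distrib_comul, one_mul, TensorProduct.mk_apply, TensorProduct.lid_tmul, one_smul]
  lTensor_counit_comp_comul := by
    ext τ
    apply (TensorProduct.rid k _).injective
    refine LinearMap.ext (R := k) (M := T) (M₃ := k) fun a => ?_
    have e : ∀ z : DualCoalg k T ⊗[k] DualCoalg k T,
        (show T →ₗ[k] k from TensorProduct.rid k (DualCoalg k T) (counit.lTensor _ z)) a =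
          distrib k T z (a ⊗ₜ 1) := by
      intro z
      induction z with
      | zero => simp; rfl
      | add z w hz hw => simp only [map_add, LinearMap.add_apply, ← hz, ← hw]; rfl
      | tmul σ τ => rw [distrib_tmul, mul_comm]; rfl
    refine (e _).trans ?_
    rw [distrib_comul, mul_one, LinearMap.flip_apply, TensorProduct.mk_apply,
      TensorProduct.rid_tmul, one_smul]

instance : IsCocomm k (DualCoalg k T) where
  comm_comp_comul := by
    ext τ
    apply distrib_ext
    intro a b
    have e : ∀ z : DualCoalg k T ⊗[k] DualCoalg k T,
        distrib k T (TensorProduct.comm k _ _ z) (a ⊗ₜ b) = distrib k T z (b ⊗ₜ a) := by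
      intro z
      induction z with
      | zero => simp
      | add z w hz hw => simp only [map_add, LinearMap.add_apply, hz, hw]
      | tmul σ τ => rw [TensorProduct.comm_tmul, distrib_tmul, distrib_tmul, mul_comm]
    refine (e _).trans ?_
    rw [distrib_comul, distrib_comul, mul_comm]

open WithConv in
/-- The transpose of an algebra homomorphism from the dual of a finite-dimensional coalgebra. -/
theorem exists_transpose {V : Type*} [AddCommGroup V] [Module k V] [Coalgebra k V] [IsCocomm k V]
    [FiniteDimensional k V] (φ : WithConv (V →ₗ[k] k) →ₐ[k] T) :
    ∃ x : DualCoalg k T →ₗc[k] V, ∀ (τ : DualCoalg k T) (s : V →ₗ[k] k),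
      s (x τ) = (show T →ₗ[k] k from τ) (φ (toConv s)) := by
  let φ' : (V →ₗ[k] k) →ₗ[k] T := φ.toLinearMap ∘ₗ (WithConv.linearEquiv k (V →ₗ[k] k)).symm
  -- The transpose of φ lands in the bidual of V, which is V by finite dimension.
  let x : DualCoalg k T →ₗ[k] V :=
    (Module.evalEquiv k V).symm.toLinearMap ∘ₗ φ'.dualMap
  have hx : ∀ (τ : DualCoalg k T) (s : V →ₗ[k] k),
      s (x τ) = (show T →ₗ[k] k from τ) (φ (toConv s)) := by
    intro τ s
    exact Module.apply_evalEquiv_symm_apply k V s (φ'.dualMap τ)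
  refine ⟨⟨x, ?_, ?_⟩, hx⟩
  · ext τ
    refine (hx τ counit).trans ?_
    rw [counit_apply, ← map_one φ]
    rfl
  · ext τ
    -- The functionals s ⊗ t separate V ⊗ V; tested on them, compatibility with Δ becomes
    -- multiplicativity of φ.
    have h : ∀ z w : V ⊗[k] V, (∀ s t : V →ₗ[k] k,
        LinearMap.mul' k k (TensorProduct.map s t z) = LinearMap.mul' k k (TensorProduct.map s t w))
        → z = w := by
      intro z w h
      apply tensor_ext_right
      intro χ
      rw [← sub_eq_zero]
      apply (Module.forall_dual_apply_eq_zero_iff k _).1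
      intro s
      have e : ∀ z : V ⊗[k] V, s (TensorProduct.rid k V (χ.lTensor V z)) =
          LinearMap.mul' k k (TensorProduct.map s χ z) := by
        intro z
        induction z with
        | zero => simp
        | add z w hz hw => simp only [map_add, hz, hw]
        | tmul a b => simp [mul_comm]
      rw [map_sub, e, e, h, sub_self]
    apply h
    intro s t
    have e : ∀ z : DualCoalg k T ⊗[k] DualCoalg k T,
        LinearMap.mul' k k (TensorProduct.map s t (TensorProduct.map x x z)) =
          distrib k T z (φ (toConv s) ⊗ₜ φ (toConv t)) := by
      intro z
      induction z with
      | zero => simp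
      | add z w hz hw => simp only [map_add, LinearMap.add_apply, hz, hw]
      | tmul σ τ => rw [distrib_tmul, ← hx, ← hx]; rfl
    refine (e _).trans ?_
    rw [distrib_comul, ← map_mul]
    exact (hx τ (toConv s * toConv t).ofConv).symm

end DualCoalg

end DualCoalgebra

/-! ### Monomorphisms of cocommutative coalgebras -/

/-- A homomorphism to a finite-dimensional algebra that is right cancellable is surjective. -/
theorem surjective_of_algHom_ext {k : Type*} {C B : Type u} [Field k] [CommRing C] [Algebra k C]
    [CommRing B] [Algebra k B] [FiniteDimensional k B] (g : C →ₐ[k] B)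
    (h : ∀ (T : Type u) [CommRing T] [Algebra k T] [FiniteDimensional k T] (f₁ f₂ : B →ₐ[k] T),
      f₁.comp g = f₂.comp g → f₁ = f₂) : Function.Surjective g := by
  let := g.toRingHom.toAlgebra
  have : IsScalarTower k C B := IsScalarTower.of_algebraMap_eq fun r => (g.commutes r).symm
  have : Module.Finite C B := Module.Finite.of_restrictScalars_finite k C B
  have : FiniteDimensional k (B ⊗[C] B) := Module.Finite.trans (R := k) B (B ⊗[C] B)
  -- The two inclusions of B into B ⊗_C B agree on C, so cancellation gives b ⊗ 1 = 1 ⊗ b. As B is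
  -- finite over C, this forces C → B to be onto.
  have hf := h (B ⊗[C] B) Algebra.TensorProduct.includeLeft
    ((Algebra.TensorProduct.includeRight : B →ₐ[C] B ⊗[C] B).restrictScalars k) (by
      ext c
      exact (Algebra.TensorProduct.includeLeft : B →ₐ[C] B ⊗[C] B).commutes c |>.trans
        ((Algebra.TensorProduct.includeRight : B →ₐ[C] B ⊗[C] B).commutes c).symm)
  exact (Algebra.isEpi_iff_surjective_algebraMap_of_finite (R := C) (A := B)).1
    ((Algebra.isEpi_iff_forall_one_tmul_eq C B).2 fun s => (AlgHom.congr_fun hf s).symm)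

open WithConv in
/-- Monomorphisms of cocommutative coalgebras are injective. -/
theorem injective_of_mono {k : Type u} [Field k] {R Q : Type u} [AddCommGroup R] [Module k R]
    [Coalgebra k R] [IsCocomm k R] [AddCommGroup Q] [Module k Q] [Coalgebra k Q] [IsCocomm k Q]
    (f : R →ₗc[k] Q)
    (h : ∀ (F : Type u) [AddCommGroup F] [Module k F] [Coalgebra k F] [IsCocomm k F]
      (x y : F →ₗc[k] R), f.comp x = f.comp y → x = y) : Function.Injective f := by
  rw [injective_iff_map_eq_zero]
  intro r hr
  -- Passing to a finite-dimensional subcoalgebra around r makes the dual algebra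
  -- finite-dimensional.
  obtain ⟨n, _, _, i, hi, hV⟩ := exists_vec (k ∙ r)
  obtain ⟨v, rfl⟩ := hV r (Submodule.mem_span_singleton_self r)
  -- This is the transpose of f ∘ i. Test maps out of its target are transposed back to coalgebra
  -- maps into R, where f can be cancelled.
  let g : WithConv (Q →ₗ[k] k) →ₐ[k] WithConv (Vec k n →ₗ[k] k) :=
    AlgHom.ofLinearMap
      ((WithConv.linearEquiv k _).symm.toLinearMap ∘ₗ
        (LinearMap.lcomp k k (f.comp i).toLinearMap) ∘ₗ (WithConv.linearEquiv k _).toLinearMap)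
      (by
        apply WithConv.ofConv_injective
        ext v
        exact CoalgHomClass.counit_comp_apply (f.comp i) v)
      (fun s t => WithConv.ofConv_injective
        (LinearMap.convMul_comp_coalgHom_distrib s t (f.comp i)))
  have : FiniteDimensional k (WithConv (Vec k n →ₗ[k] k)) :=
    Module.Finite.equiv (WithConv.linearEquiv k (Vec k n →ₗ[k] k)).symm
  have hg : Function.Surjective g := by
    apply surjective_of_algHom_ext
    intro T _ _ _ f₁ f₂ h₁₂
    obtain ⟨x, hx⟩ := DualCoalg.exists_transpose f₁
    obtain ⟨y, hy⟩ := DualCoalg.exists_transpose f₂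
    have hxy : i.comp x = i.comp y := by
      apply h
      ext τ
      rw [← sub_eq_zero]
      apply (Module.forall_dual_apply_eq_zero_iff k _).1
      intro s
      have h₁ := hx τ (s ∘ₗ (f.comp i).toLinearMap)
      have h₂ := hy τ (s ∘ₗ (f.comp i).toLinearMap)
      have h₃ := congrArg (show T →ₗ[k] k from τ) (AlgHom.congr_fun h₁₂ (toConv s))
      rw [map_sub, sub_eq_zero]
      exact h₁.trans (h₃.trans h₂.symm)
    ext s
    rw [← sub_eq_zero]
    apply (Module.forall_dual_apply_eq_zero_iff k _).1
    intro τ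
    rw [map_sub, sub_eq_zero]
    refine (hx τ s.ofConv).symm.trans (Eq.trans ?_ (hy τ s.ofConv))
    exact congrArg s.ofConv (hi (CoalgHom.congr_fun hxy τ))
  -- Surjectivity of g says that every functional on the subcoalgebra factors through f ∘ i, hence
  -- vanishes at v.
  have hv : v = 0 := by
    apply (Module.forall_dual_apply_eq_zero_iff k _).1
    intro s
    obtain ⟨t, ht⟩ := hg (toConv s)
    have := LinearMap.congr_fun (WithConv.toConv_injective ht) v
    refine this.symm.trans ?_
    change t.ofConv (f (i v)) = 0
    rw [hr, map_zero]
  rw [hv, map_zero]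

/-! ### Calculus of generalized points -/

section PointCalculus

variable {k : Type u} [Field k] {X X' Y : Type*}
  [AddCommGroup X] [Module k X] [Coalgebra k X] [IsCocomm k X]
  [AddCommGroup X'] [Module k X'] [Coalgebra k X'] [IsCocomm k X']
  [AddCommGroup Y] [Module k Y] [Coalgebra k Y] [IsCocomm k Y]
  {G G' G'' : Type*} [Ring G] [HopfAlgebra k G] [IsCocomm k G] [Ring G'] [HopfAlgebra k G']
  [IsCocomm k G'] [Ring G''] [HopfAlgebra k G''] [IsCocomm k G'']

/-- By the counit law. This translates triviality of a second component on points into the form z ⊗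
1 used for Hopf kernels, for f # 1 and for evaluation at 1. -/
theorem pair_one_apply (f : X →ₗc[k] Y) (x : X) :
    pair f (1 : Pts k X G).hom x = f x ⊗ₜ[k] (1 : G) := by
  have h := congrArg (TensorProduct.map (f : X →ₗ[k] Y) (Algebra.linearMap k G))
    (lTensor_counit_comul (R := k) x)
  rw [LinearMap.lTensor, ← LinearMap.comp_apply, ← TensorProduct.map_comp] at h
  refine Eq.trans h ?_
  rw [TensorProduct.map_tmul]
  exact congrArg (f x ⊗ₜ[k] ·) (map_one (algebraMap k G))

namespace Pts

/-- Postcomposition with a coalgebra map. -/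
def push (φ : G →ₗc[k] G') (x : Pts k X G) : Pts k X G' := ⟨φ.comp x.hom⟩

omit [IsCocomm k X] [IsCocomm k X'] [IsCocomm k G] [IsCocomm k G'] in
theorem push_comp (φ : G →ₗc[k] G') (x : Pts k X G) (h : X' →ₗc[k] X) :
    (push φ x).comp h = push φ (x.comp h) := Pts.ext (CoalgHom.comp_assoc _ _ _)

/-- The two projections of G ⊗ G are the universal pair of points, and their product is the
multiplication map. -/
theorem mul_apply_tmul (a b : G) :
    ((⟨fst⟩ * ⟨snd⟩ : Pts k (G ⊗[k] G) G)).hom (a ⊗ₜ[k] b) = a * b := by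
  rw [mul_hom, pair_fst_snd]
  rfl

theorem push_mul_apply_tmul (φ ψ : G →ₗc[k] G') (a b : G) :
    (push φ ⟨fst⟩ * push ψ ⟨snd⟩ : Pts k (G ⊗[k] G) G').hom (a ⊗ₜ[k] b) = φ a * ψ b := by
  rw [mul_hom, push, push, ← map_pair, pair_fst_snd]
  rfl

/-- Bialgebra maps are homomorphisms on points. -/
def map (φ : G →ₐc[k] G') : Pts k X G →* Pts k X G' where
  toFun := push φ
  map_one' := by
    ext x
    change φ (algebraMap k G (counit (R := k) x)) = algebraMap k G' (counit (R := k) x)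
    exact (φ : G →ₐ[k] G').commutes _
  map_mul' x y := by
    have key : (φ : G →ₗc[k] G').comp (Bialgebra.mulCoalgHom k G) =
        (Bialgebra.mulCoalgHom k G').comp
          (Coalgebra.TensorProduct.map (φ : G →ₗc[k] G') (φ : G →ₗc[k] G')) := by
      apply CoalgHom.coe_linearMap_injective
      apply TensorProduct.ext'
      intro a b
      exact map_mul φ a b
    apply Pts.ext
    rw [mul_hom, push, push, push, ← map_pair, mul_hom, ← CoalgHom.comp_assoc,
      ← CoalgHom.comp_assoc, key]

theorem map_comp (φ : G →ₐc[k] G') (x : Pts k X G) (h : X' →ₗc[k] X) :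
    (map φ x).comp h = map φ (x.comp h) := push_comp _ _ _

theorem map_injective {φ : G →ₐc[k] G'} (hφ : Function.Injective φ) :
    Function.Injective (map φ : Pts k X G → Pts k X G') := by
  intro x y h
  ext a
  exact hφ (CoalgHom.congr_fun (congrArg hom h) a)

end Pts

/-- A coalgebra map which is multiplicative on the universal pair of points is a bialgebra map. -/
def bialgHomOfPts (φ : G →ₗc[k] G') (h : Pts.push φ (⟨fst⟩ * ⟨snd⟩ : Pts k (G ⊗[k] G) G) =
    Pts.push φ ⟨fst⟩ * Pts.push φ ⟨snd⟩) : G →ₐc[k] G' :=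
  have hmul : ∀ a b, φ (a * b) = φ a * φ b := by
    intro a b
    have := CoalgHom.congr_fun (congrArg Pts.hom h) (a ⊗ₜ[k] b)
    rw [Pts.push_mul_apply_tmul] at this
    rw [← this, ← Pts.mul_apply_tmul (k := k)]
    rfl
  { φ with
    map_one' := by
      -- A group-like element is invertible, and φ(1) is idempotent, so it is 1.
      have h1 : IsGroupLikeElem k (φ 1) := (IsGroupLikeElem.one (R := k) (A := G)).map φ
      have h2 : φ 1 * φ 1 = φ 1 * 1 := by rw [← hmul, mul_one, mul_one]
      exact h1.isUnit.mul_left_cancel h2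
    map_mul' := hmul }

namespace Pts

/-- The constant point at a group-like element. -/
def const (x : G) (hx : IsGroupLikeElem k x) : Pts k X G where
  hom :=
    { toLinearMap := LinearMap.toSpanSingleton k G x ∘ₗ counit
      counit_comp := by ext a; simp [hx.counit_eq_one]
      map_comp_comul := by
        ext a
        have h : ∀ z : X ⊗[k] X, TensorProduct.map
            (LinearMap.toSpanSingleton k G x ∘ₗ counit (A := X))
            (LinearMap.toSpanSingleton k G x ∘ₗ counit (A := X)) z =
            counit (R := k) (TensorProduct.rid k X (counit.lTensor X z)) • (x ⊗ₜ[k] x) := by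
          intro z
          induction z with
          | zero => simp
          | add z w hz hw => simp only [map_add, hz, hw, add_smul]
          | tmul a b => simp [TensorProduct.smul_tmul, smul_smul, mul_comm]
        refine (h _).trans ?_
        simp [hx.comul_eq_tmul_self] }

theorem const_apply (x : G) (hx : IsGroupLikeElem k x) (a : X) :
    (const x hx : Pts k X G).hom a = counit (R := k) a • x := rfl

/-- Turns a convolution identity with a constant point into an identity of elements; with its mirror
image it yields conjugation formulas. -/
theorem const_mul_apply (x : G) (hx : IsGroupLikeElem k x) (p : Pts k X G) (a : X) :
    (const x hx * p).hom a = x * p.hom a := by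
  have h : ∀ z : X ⊗[k] X, LinearMap.mul' k G (TensorProduct.map
      (const x hx : Pts k X G).hom.toLinearMap p.hom.toLinearMap z) =
      x * p.hom (TensorProduct.lid k X (counit.rTensor X z)) := by
    intro z
    induction z with
    | zero => simp
    | add z w hz hw => simp only [map_add, hz, hw, mul_add]
    | tmul a b => simp [const_apply]
  refine (h (comul (R := k) a)).trans ?_
  simp

theorem mul_const_apply (x : G) (hx : IsGroupLikeElem k x) (p : Pts k X G) (a : X) :
    (p * const x hx).hom a = p.hom a * x := by
  have h : ∀ z : X ⊗[k] X, LinearMap.mul' k G (TensorProduct.map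
      p.hom.toLinearMap (const x hx : Pts k X G).hom.toLinearMap z) =
      p.hom (TensorProduct.rid k X (counit.lTensor X z)) * x := by
    intro z
    induction z with
    | zero => simp
    | add z w hz hw => simp only [map_add, hz, hw, add_mul]
    | tmul a b => simp [const_apply]
  refine (h (comul (R := k) a)).trans ?_
  simp

end Pts

/-- Conjugation by a group-like element. -/
def conj (x : G) (hx : IsGroupLikeElem k x) : G →ₐc[k] G where
  toFun a := x * a * HopfAlgebra.antipode k x
  map_add' a b := by rw [mul_add, add_mul]
  map_smul' r a := by simp
  map_one' := by rw [mul_one, hx.mul_antipode_cancel]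
  map_mul' a b := by
    calc x * (a * b) * HopfAlgebra.antipode k x
        = x * a * 1 * b * HopfAlgebra.antipode k x := by simp only [mul_assoc, mul_one]
      _ = _ := by rw [← hx.antipode_mul_cancel]; simp only [mul_assoc]
  counit_comp := by ext a; simp [hx.counit_eq_one]
  map_comp_comul := by
    ext a
    have h : ∀ (f : G →ₗ[k] G) (_ : ∀ a, f a = x * a * HopfAlgebra.antipode k x) (z : G ⊗[k] G),
        TensorProduct.map f f z =
          (x ⊗ₜ x) * z * (HopfAlgebra.antipode k x ⊗ₜ HopfAlgebra.antipode k x) := by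
      intro f hf z
      induction z with
      | zero => simp
      | add z w hz hw => simp only [map_add, hz, hw, mul_add, add_mul]
      | tmul a b => simp [hf]
    refine (h _ (fun _ => rfl) _).trans ?_
    change _ = comul (R := k) (x * a * HopfAlgebra.antipode k x)
    rw [Bialgebra.comul_mul, Bialgebra.comul_mul, hx.comul_eq_tmul_self,
      hx.antipode.comul_eq_tmul_self]

theorem conj_apply (x : G) (hx : IsGroupLikeElem k x) (a : G) :
    conj x hx a = x * a * HopfAlgebra.antipode k x := rfl

theorem conj_injective (x : G) (hx : IsGroupLikeElem k x) : Function.Injective (conj x hx) := by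
  intro a b h
  rw [conj_apply, conj_apply] at h
  exact hx.isUnit.mul_left_cancel (hx.antipode.isUnit.mul_right_cancel h)

end PointCalculus

/-! ### Evaluation of points of A^Q and the components of A ≀ Q -/

section Evaluation

variable {k : Type u} [Field k] {A Q : Type u} [Ring A] [HopfAlgebra k A] [IsCocomm k A]
  [Ring Q] [HopfAlgebra k Q] [IsCocomm k Q]
  {X X' : Type*} [AddCommGroup X] [Module k X] [Coalgebra k X] [IsCocomm k X]
  [AddCommGroup X'] [Module k X'] [Coalgebra k X'] [IsCocomm k X']

namespace Measuring

/-- Evaluation on points, `(f, c) ↦ f@c`. -/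
def evalPts (f : Pts k X (Measuring k Q A)) (c : Pts k X Q) : Pts k X A :=
  ⟨(eval k Q A).comp (pair f.hom c.hom)⟩

/-- Evaluation at c is restriction of the function of f to the graph of c. Restriction along a
coalgebra map is a group homomorphism, so evaluation is multiplicative in f. -/
theorem evalPts_eq (f : Pts k X (Measuring k Q A)) (c : Pts k X Q) :
    evalPts f c = (ev f.hom).comp (pair (CoalgHom.id k X) c.hom) := by
  apply Pts.ext
  rw [Pts.comp_hom, ev, CoalgHom.comp_assoc, map_pair, CoalgHom.id_comp, CoalgHom.comp_id]
  rfl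

theorem evalPts_comp (f : Pts k X (Measuring k Q A)) (c : Pts k X Q) (h : X' →ₗc[k] X) :
    (evalPts f c).comp h = evalPts (f.comp h) (c.comp h) := by
  apply Pts.ext
  rw [Pts.comp_hom, evalPts, CoalgHom.comp_assoc, pair_comp]
  rfl

theorem evalPts_mul (f g : Pts k X (Measuring k Q A)) (c : Pts k X Q) :
    evalPts (f * g) c = evalPts f c * evalPts g c := by
  rw [evalPts_eq, evalPts_eq, evalPts_eq, ev_mul, Pts.mul_comp]

/-- The shift by q carries the graph of c to the graph of cq. -/
theorem evalPts_actPts (q : Pts k X Q) (f : Pts k X (Measuring k Q A)) (c : Pts k X Q) :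
    evalPts (actPts q f) c = evalPts f (c * q) := by
  rw [evalPts_eq, evalPts_eq, ev_actPts, Pts.comp_comp]
  congr 1
  have e : (sndPts : Pts k (X ⊗[k] Q) Q).comp (pair (CoalgHom.id k X) c.hom) = c :=
    Pts.ext (snd_pair _ _)
  apply shift_ext
  · rw [← CoalgHom.comp_assoc, fst_shift, fst_pair, fst_pair]
  · rw [← Pts.comp_comp, snd_shift, Pts.mul_comp, e, Pts.comp_comp, fst_pair, Pts.comp_id]
    exact (Pts.ext (snd_pair _ _)).symm

/-- After base change to X ⊗ Q there is a universal point of Q, and the value there is the whole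
function. -/
theorem ev_eq_evalPts (f : Pts k X (Measuring k Q A)) :
    ev f.hom = evalPts (f.comp fst) sndPts := by
  have e := map_pair (fst : X ⊗[k] Q →ₗc[k] X) snd f.hom (CoalgHom.id k Q)
  rw [pair_fst_snd, CoalgHom.comp_id, CoalgHom.id_comp] at e
  exact Pts.ext (congrArg (eval k Q A).comp e)

/-- Points of `A^Q` that agree at the universal point of `Q` are equal. -/
theorem evalPts_ext {f g : Pts k X (Measuring k Q A)}
    (h : evalPts (f.comp fst) (sndPts : Pts k (X ⊗[k] Q) Q) = evalPts (g.comp fst) sndPts) :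
    f = g :=
  ev_pts_injective (by rw [ev_eq_evalPts, ev_eq_evalPts, h])

/-- The point of `A^Q` given by a family of points of `A`. -/
def liftPts (u : Pts k (X ⊗[k] Q) A) : Pts k X (Measuring k Q A) := ⟨lift u.hom⟩

theorem evalPts_liftPts (u : Pts k (X ⊗[k] Q) A) (c : Pts k X Q) :
    evalPts (liftPts u) c = u.comp (pair (CoalgHom.id k X) c.hom) := by
  rw [evalPts_eq, liftPts, ev_lift]

/-- Naturality of the adjunction: a family defined over X is evaluated at points over any X' → X. -/
theorem evalPts_liftPts_comp (u : Pts k (X ⊗[k] Q) A) (h : X' →ₗc[k] X) (c : Pts k X' Q) :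
    evalPts ((liftPts u).comp h) c = u.comp (pair h c.hom) := by
  have e : (liftPts u).comp h = liftPts (u.comp
      (Coalgebra.TensorProduct.map h (CoalgHom.id k Q))) := by
    apply ev_pts_injective
    rw [Pts.comp_hom, ev_comp, liftPts, liftPts, ev_lift, ev_lift]
  rw [e, evalPts_liftPts, Pts.comp_comp, map_pair, CoalgHom.comp_id, CoalgHom.id_comp]

theorem evalPts_at_one (f : Pts k X (Measuring k Q A)) :
    evalPts f 1 = Pts.map (evalOne k A Q) f := by
  ext x
  exact congrArg (eval k Q A) (pair_one_apply f.hom x)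

end Measuring

namespace Wreath

open Measuring

theorem mulCoalgHom_eq : Bialgebra.mulCoalgHom k (Wreath k A Q) = mulHom k A Q := by
  apply CoalgHom.coe_linearMap_injective
  apply TensorProduct.ext'
  intro a b
  rfl

theorem fstPt_mul (v w : Pts k X (Wreath k A Q)) :
    fstPt (v * w).hom = fstPt v.hom * actPts (sndPt v.hom) (fstPt w.hom) := by
  rw [Pts.mul_hom, mulCoalgHom_eq, fstPt_mulHom]

theorem sndPt_mul (v w : Pts k X (Wreath k A Q)) :
    sndPt (v * w).hom = sndPt v.hom * sndPt w.hom := by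
  rw [Pts.mul_hom, mulCoalgHom_eq, sndPt_mulHom]

theorem pts_ext {v w : Pts k X (Wreath k A Q)} (h₁ : fstPt v.hom = fstPt w.hom)
    (h₂ : sndPt v.hom = sndPt w.hom) : v = w := Pts.ext (ext_pt h₁ h₂)

variable (k A Q) in
/-- The natural map `τ : A ≀ Q → Q` as a bialgebra map. -/
def rightHom : Wreath k A Q →ₐc[k] Q :=
  bialgHomOfPts (right k A Q) (sndPt_mul _ _)

theorem rightHom_apply (w : Wreath k A Q) : rightHom k A Q w = right k A Q w := rfl

theorem point_one_apply (f : Pts k X (Measuring k Q A)) (x : X) :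
    (point f 1 : X →ₗc[k] Wreath k A Q) x = mk (f.hom x) 1 := pair_one_apply f.hom x

variable (k A Q) in
/-- The inclusion `A^Q → A ≀ Q`, `f ↦ f # 1`. -/
def inl : Measuring k Q A →ₐc[k] Wreath k A Q :=
  bialgHomOfPts (point (⟨CoalgHom.id k _⟩ : Pts k (Measuring k Q A) (Measuring k Q A)) 1) <| by
    have h₁ : ∀ f : Pts k (Measuring k Q A ⊗[k] Measuring k Q A) (Measuring k Q A),
        fstPt (Pts.push (point (⟨CoalgHom.id k _⟩ : Pts k (Measuring k Q A) (Measuring k Q A)) 1)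
          f).hom = f := by
      intro f
      rw [Pts.push, fstPt_comp, fstPt_point]
      exact Pts.ext (CoalgHom.id_comp _)
    have h₂ : ∀ f : Pts k (Measuring k Q A ⊗[k] Measuring k Q A) (Measuring k Q A),
        sndPt (Pts.push (point (⟨CoalgHom.id k _⟩ : Pts k (Measuring k Q A) (Measuring k Q A)) 1)
          f).hom = 1 := by
      intro f
      rw [Pts.push, sndPt_comp, sndPt_point, Pts.one_comp]
    apply pts_ext
    · rw [fstPt_mul, h₁, h₁, h₁, h₂, one_actPts]
    · rw [sndPt_mul, h₂, h₂, h₂, one_mul]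

theorem inl_apply (f : Measuring k Q A) : inl k A Q f = mk f 1 :=
  point_one_apply (⟨CoalgHom.id k _⟩ : Pts k (Measuring k Q A) (Measuring k Q A)) f

theorem fstPt_map_inl (f : Pts k X (Measuring k Q A)) :
    fstPt (Pts.map (inl k A Q) f).hom = f := by
  have : fstPt ((point (⟨CoalgHom.id k _⟩ : Pts k (Measuring k Q A) (Measuring k Q A)) 1 :
    _ →ₗc[k] Wreath k A Q).comp f.hom) = f := by
    rw [fstPt_comp, fstPt_point]
    exact Pts.ext (CoalgHom.id_comp _)
  exact this

theorem sndPt_map_inl (f : Pts k X (Measuring k Q A)) :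
    sndPt (Pts.map (inl k A Q) f).hom = 1 := by
  have : sndPt ((point (⟨CoalgHom.id k _⟩ : Pts k (Measuring k Q A) (Measuring k Q A)) 1 :
    _ →ₗc[k] Wreath k A Q).comp f.hom) = 1 := by
    rw [sndPt_comp, sndPt_point, Pts.one_comp]
  exact this

theorem left_inl (f : Measuring k Q A) : left k A Q (inl k A Q f) = f := by
  rw [inl_apply, left_mk, Bialgebra.counit_one, one_smul]

theorem inl_injective : Function.Injective (inl k A Q) :=
  Function.LeftInverse.injective left_inl

end Wreath

end Evaluation

/-! ### The embedding of a cleft extension -/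

section Embedding

variable {k : Type u} [Field k] {A Q : Type u} [Ring A] [HopfAlgebra k A] [IsCocomm k A]
  [Ring Q] [HopfAlgebra k Q] [IsCocomm k Q]
  {F : Type u} [AddCommGroup F] [Module k F] [Coalgebra k F] [IsCocomm k F]

open Measuring Wreath

/-- Since x is a coalgebra map, (id ⊗ π)Δ(x(y)) is the pair of the points x and πx at y, and πx is
trivial. -/
theorem mem_hker {E : Type*} [Ring E] [HopfAlgebra k E] [IsCocomm k E] (π : E →ₐc[k] Q)
    (x : Pts k F E) (hx : Pts.map π x = 1) (y : F) : x.hom y ∈ hker k π := by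
  change _ = _
  rw [← CoalgHomClass.map_comp_comul_apply, ← pair_one_apply x.hom y, ← hx, LinearMap.lTensor,
    ← LinearMap.comp_apply, ← TensorProduct.map_comp]
  rfl

namespace Extension

variable (X : Extension k A Q)

/-- Apply ε to the first factor of the identity that defines the Hopf kernel. -/
theorem π_ι (a : A) : X.π (X.ι a) = counit (R := k) a • (1 : Q) := by
  have h : X.ι a ∈ hker k X.π := X.exact ▸ Set.mem_range_self a
  have h' := congrArg (fun t => TensorProduct.lid k Q (counit.rTensor Q t)) h
  have e : ∀ z : X.E ⊗[k] X.E, TensorProduct.lid k Q (counit.rTensor Q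
      ((X.π : X.E →ₗ[k] Q).lTensor X.E z)) =
        X.π (TensorProduct.lid k X.E (counit.rTensor X.E z)) := by
    intro z
    induction z with
    | zero => simp
    | add z w hz hw => simp only [map_add, hz, hw]
    | tmul a b => simp
  have h₂ := (e (comul (R := k) (X.ι a))).symm.trans h'
  simpa using h₂

theorem map_π_map_ι (b : Pts k F A) : Pts.map X.π (Pts.map X.ι b) = 1 := by
  ext x
  refine (X.π_ι _).trans ?_
  refine (congrArg (· • (1 : Q)) (CoalgHomClass.counit_comp_apply b.hom x)).trans ?_
  exact (Algebra.algebraMap_eq_smul_one _).symm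

/-- Points in the kernel of `π` come from points of `A`. -/
theorem exists_map_ι_eq (x : Pts k F X.E) (hx : Pts.map X.π x = 1) :
    ∃ b : Pts k F A, Pts.map X.ι b = x := by
  have h : ∀ y, ∃ a, (X.ι : A →ₗc[k] X.E) a = x.hom y := by
    intro y
    have hy := mem_hker X.π x hx y
    rw [← X.exact] at hy
    exact hy
  -- The values of x lie in ι(A) by exactness; injectivity of ι makes the lift a coalgebra map.
  obtain ⟨g, hg⟩ := exists_factor (X.ι : A →ₗc[k] X.E) X.injective x.hom h
  exact ⟨⟨g⟩, Pts.ext (CoalgHom.ext hg)⟩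

variable {X}

theorem map_π_push {γ : Q →ₗc[k] X.E} (hγ : ∀ q, X.π (γ q) = q) (c : Pts k F Q) :
    Pts.map X.π (Pts.push γ c) = c := Pts.ext (CoalgHom.ext fun x => hγ (c.hom x))

/-- Colinearity is comultiplicativity of γ combined with πγ = id. The convolution inverse is the
inverse point S ∘ γ. -/
theorem isCleavage_of_section {γ : Q →ₗc[k] X.E} (hγ : ∀ q, X.π (γ q) = q) :
    IsCleavage k X.π γ where
  comodule q := by
    rw [← CoalgHomClass.map_comp_comul_apply, LinearMap.lTensor, LinearMap.rTensor,
      ← LinearMap.comp_apply, ← TensorProduct.map_comp]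
    have : (X.π : X.E →ₗ[k] Q) ∘ₗ γ.toLinearMap = LinearMap.id := LinearMap.ext hγ
    change TensorProduct.map (LinearMap.id ∘ₗ γ.toLinearMap)
      ((X.π : X.E →ₗ[k] Q) ∘ₗ γ.toLinearMap) _ = _
    rw [this]
    rfl
  invertible := by
    let p : Pts k Q X.E := ⟨γ⟩
    refine ⟨⟨p.toLin, p⁻¹.toLin, ?_, ?_⟩, rfl⟩
    · rw [← Pts.toLin_mul, mul_inv_cancel, Pts.toLin_one]
    · rw [← Pts.toLin_mul, inv_mul_cancel, Pts.toLin_one]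

variable (X) in
/-- The point `f` of `A^Q` over `E` is the cocycle `e ↦ (c ↦ γ(c) e γ(c π(e))⁻¹)`. -/
def IsCocycle (γ : Q →ₗc[k] X.E) (f : Pts k X.E (Measuring k Q A)) : Prop :=
  ∀ {F : Type u} [AddCommGroup F] [Module k F] [Coalgebra k F] [IsCocomm k F]
    (e : Pts k F X.E) (c : Pts k F Q), Pts.map X.ι (evalPts (f.comp e.hom) c) =
      Pts.push γ c * e * (Pts.push γ (c * Pts.map X.π e))⁻¹

/-- It is enough to construct the value at the universal pair (e₀, c₀) over E ⊗ Q, where π kills the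
expression; any other pair (e, c) is a pullback of this one. -/
theorem exists_isCocycle {γ : Q →ₗc[k] X.E} (hγ : ∀ q, X.π (γ q) = q) :
    ∃ f, X.IsCocycle γ f := by
  let e₀ : Pts k (X.E ⊗[k] Q) X.E := ⟨fst⟩
  let c₀ : Pts k (X.E ⊗[k] Q) Q := ⟨snd⟩
  obtain ⟨U, hU⟩ := X.exists_map_ι_eq
    (Pts.push γ c₀ * e₀ * (Pts.push γ (c₀ * Pts.map X.π e₀))⁻¹) (by
      rw [map_mul, map_mul, map_inv, map_π_push hγ, map_π_push hγ, mul_inv_cancel])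
  refine ⟨liftPts U, ?_⟩
  intro F _ _ _ _ e c
  have he : e₀.comp (pair e.hom c.hom) = e := Pts.ext (fst_pair _ _)
  have hc : c₀.comp (pair e.hom c.hom) = c := Pts.ext (snd_pair _ _)
  rw [evalPts_liftPts_comp, ← Pts.map_comp, hU, Pts.mul_comp, Pts.mul_comp, Pts.inv_comp,
    Pts.push_comp, Pts.push_comp, Pts.mul_comp, Pts.map_comp, he, hc]

end Extension

/-- An embedding of an extension into `A ≀ Q` over `Q` that is a section of the evaluation at `1`
on `A`. -/
structure IsRealization (X : Extension k A Q) (j : X.E →ₐc[k] Wreath k A Q) : Prop where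
  injective : Function.Injective j
  right_apply : ∀ e, right k A Q (j e) = X.π e
  ι_apply : ∀ a, ∃ f, j (X.ι a) = mk f 1 ∧ evalOne k A Q f = a

/-- Meant for γ, which is no homomorphism: fixing 1 is enough for the trivial point. -/
theorem Pts.push_one {G G' : Type*} [Ring G] [HopfAlgebra k G] [Ring G'] [HopfAlgebra k G']
    (φ : G →ₗc[k] G') (hφ : φ 1 = 1) : Pts.push φ (1 : Pts k F G) = 1 := by
  ext x
  change φ (algebraMap k G _) = algebraMap k G' _
  rw [Algebra.algebraMap_eq_smul_one, map_smul, hφ, ← Algebra.algebraMap_eq_smul_one]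

/-- Applying ε to the first factor of the comodule identity gives πγ = id. The element γ(1) is
group-like and lies over 1, so right multiplication by its antipode normalizes γ and keeps it a
section. -/
theorem CleftExtension.exists_section (X : CleftExtension k A Q) :
    ∃ γ : Q →ₗc[k] X.E, (∀ q, X.π (γ q) = q) ∧ γ 1 = 1 := by
  obtain ⟨γ, hγ⟩ := X.cleft
  have h₁ : ∀ q, X.π (γ q) = q := by
    intro q
    have h := congrArg (fun t => TensorProduct.lid k Q (counit.rTensor Q t)) (hγ.comodule q)
    have e₁ : ∀ z : X.E ⊗[k] X.E, TensorProduct.lid k Q (counit.rTensor Q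
        ((X.π : X.E →ₗ[k] Q).lTensor X.E z)) =
          X.π (TensorProduct.lid k X.E (counit.rTensor X.E z)) := by
      intro z
      induction z with
      | zero => simp
      | add z w hz hw => simp only [map_add, hz, hw]
      | tmul a b => simp
    have e₂ : ∀ z : Q ⊗[k] Q, TensorProduct.lid k Q (counit.rTensor Q
        ((γ : Q →ₗ[k] X.E).rTensor Q z)) = TensorProduct.lid k Q (counit.rTensor Q z) := by
      intro z
      induction z with
      | zero => simp
      | add z w hz hw => simp only [map_add, hz, hw]
      | tmul a b => simp
    have h₂ := (e₁ _).symm.trans (h.trans (e₂ _))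
    simpa using h₂
  have hg : IsGroupLikeElem k (γ 1) := (IsGroupLikeElem.one (R := k) (A := Q)).map γ
  refine ⟨(⟨γ⟩ * Pts.const _ hg.antipode : Pts k Q X.E).hom, fun q => ?_, ?_⟩
  · have h₂ := congrArg X.π hg.mul_antipode_cancel
    rw [map_mul, h₁, map_one X.π, one_mul] at h₂
    rw [Pts.mul_const_apply, map_mul, h₂, mul_one]
    exact h₁ q
  · rw [Pts.mul_const_apply]
    exact hg.mul_antipode_cancel

theorem Pts.comp_hom_comp {F' E G : Type*} [AddCommGroup F'] [Module k F'] [Coalgebra k F']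
    [IsCocomm k F'] [Ring E] [HopfAlgebra k E] [Ring G] [HopfAlgebra k G] [IsCocomm k E]
    [IsCocomm k G] (f : Pts k E G) (e : Pts k F E) (h : F' →ₗc[k] F) :
    (f.comp e.hom).comp h = f.comp (e.comp h).hom := Pts.comp_comp f e.hom h

theorem Wreath.fstPt_push_point {E : Type u} [Ring E] [HopfAlgebra k E] [IsCocomm k E]
    (f : Pts k E (Measuring k Q A)) (q : Pts k E Q) (e : Pts k F E) :
    fstPt (Pts.push (point f q) e).hom = f.comp e.hom := by
  rw [Pts.push, fstPt_comp, fstPt_point]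

theorem Wreath.sndPt_push_point {E : Type u} [Ring E] [HopfAlgebra k E] [IsCocomm k E]
    (f : Pts k E (Measuring k Q A)) (q : Pts k E Q) (e : Pts k F E) :
    sndPt (Pts.push (point f q) e).hom = q.comp e.hom := by
  rw [Pts.push, sndPt_comp, sndPt_point]

namespace Extension.IsCocycle

variable {X : Extension k A Q} {γ : Q →ₗc[k] X.E} {f : Pts k X.E (Measuring k Q A)}

/-- The cocycle identity: insert γ(cπ(x))⁻¹ γ(cπ(x)) between x and y in γ(c) xy γ(cπ(xy))⁻¹. The
second half is f_y at cπ(x), which is the value of π(x) ★ f_y at c. -/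
theorem comp_mul (hf : X.IsCocycle γ f) (x y : Pts k F X.E) :
    f.comp (x * y).hom = f.comp x.hom * actPts (Pts.map X.π x) (f.comp y.hom) := by
  apply evalPts_ext
  rw [Pts.mul_comp, actPts_comp, evalPts_mul, evalPts_actPts, Pts.comp_hom_comp,
    Pts.comp_hom_comp, Pts.comp_hom_comp]
  apply Pts.map_injective X.injective
  rw [map_mul, hf, hf, hf, Pts.mul_comp, Pts.map_comp, map_mul]
  group

/-- The embedding `e ↦ ∑ f(e₁) # π(e₂)`. -/
def embedding (hf : X.IsCocycle γ f) : X.E →ₐc[k] Wreath k A Q :=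
  bialgHomOfPts (point f ⟨X.π⟩) <| by
    have h₁ : ∀ e : Pts k (X.E ⊗[k] X.E) X.E,
        fstPt (Pts.push (point f ⟨X.π⟩) e).hom = f.comp e.hom := fstPt_push_point f ⟨X.π⟩
    have h₂ : ∀ e : Pts k (X.E ⊗[k] X.E) X.E,
        sndPt (Pts.push (point f ⟨X.π⟩) e).hom = Pts.map X.π e := sndPt_push_point f ⟨X.π⟩
    apply pts_ext
    · rw [fstPt_mul, h₁, h₁, h₁, h₂, hf.comp_mul]
    · rw [sndPt_mul, h₂, h₂, h₂, map_mul]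

/-- The cocycle formula at c = 1, where the outer γ disappears by normalization. -/
theorem map_evalOne (hf : X.IsCocycle γ f) (hγ₁ : γ 1 = 1) (e : Pts k F X.E) :
    Pts.map X.ι (Pts.map (evalOne k A Q) (f.comp e.hom)) =
      e * (Pts.push γ (Pts.map X.π e))⁻¹ := by
  rw [← evalPts_at_one, hf, Pts.push_one γ hγ₁, one_mul, one_mul]

theorem embedding_injective (hf : X.IsCocycle γ f) (hγ₁ : γ 1 = 1) :
    Function.Injective hf.embedding := by
  -- The left inverse f # q ↦ ι(f@1) γ(q), a coalgebra map; it recovers e because ι(f_e@1) = e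
  -- γ(π(e))⁻¹.
  let L : Pts k (Wreath k A Q) X.E :=
    Pts.map X.ι (Pts.map (evalOne k A Q) (fstPt (CoalgHom.id k _))) *
      Pts.push γ (sndPt (CoalgHom.id k _))
  have hL : L.comp (point f ⟨X.π⟩) = ⟨CoalgHom.id k X.E⟩ := by
    have h := hf.map_evalOne hγ₁ (⟨CoalgHom.id k X.E⟩ : Pts k X.E X.E)
    rw [Pts.comp_id] at h
    rw [Pts.mul_comp, Pts.map_comp, Pts.map_comp, Pts.push_comp, ← fstPt_comp, ← sndPt_comp,
      CoalgHom.id_comp, fstPt_point, sndPt_point, h]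
    exact inv_mul_cancel_right _ _
  exact Function.LeftInverse.injective (g := L.hom)
    fun e => CoalgHom.congr_fun (congrArg Pts.hom hL) e

/-- The composite πι is trivial, so the second component of the embedding is the unit point on ι(A).
-/
theorem embedding_ι (hf : X.IsCocycle γ f) (a : A) :
    hf.embedding (X.ι a) = Wreath.mk (f.hom (X.ι a)) 1 := by
  let a₀ : Pts k A X.E := ⟨X.ι⟩
  have h₀ : Pts.map X.π a₀ = 1 := X.map_π_map_ι (⟨CoalgHom.id k A⟩ : Pts k A A)
  have h : (point f ⟨X.π⟩ : X.E →ₗc[k] Wreath k A Q).comp a₀.hom = point (f.comp a₀.hom) 1 := by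
    apply ext_pt
    · rw [fstPt_comp, fstPt_point, fstPt_point]
    · rw [sndPt_comp, sndPt_point, sndPt_point]
      exact h₀
  exact (CoalgHom.congr_fun h a).trans (point_one_apply (f.comp a₀.hom) a)

theorem evalOne_ι (hf : X.IsCocycle γ f) (hγ₁ : γ 1 = 1) (a : A) :
    evalOne k A Q (f.hom (X.ι a)) = a := by
  let a₀ : Pts k A A := ⟨CoalgHom.id k A⟩
  have h : Pts.map (evalOne k A Q) (f.comp (Pts.map X.ι a₀).hom) = a₀ := by
    apply Pts.map_injective X.injective
    rw [hf.map_evalOne hγ₁, X.map_π_map_ι, Pts.push_one γ hγ₁, inv_one, mul_one]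
  exact CoalgHom.congr_fun (congrArg Pts.hom h) a

theorem isRealization (hf : X.IsCocycle γ f) (hγ₁ : γ 1 = 1) :
    IsRealization X hf.embedding where
  injective := hf.embedding_injective hγ₁
  right_apply := CoalgHom.congr_fun (snd_pair f.hom (X.π : X.E →ₗc[k] Q))
  ι_apply a := ⟨_, hf.embedding_ι a, hf.evalOne_ι hγ₁ a⟩

end Extension.IsCocycle

/-- Every cleft extension embeds into the wreath product. -/
theorem CleftExtension.exists_isRealization (X : CleftExtension k A Q) :
    ∃ j, IsRealization X.toExtension j := by
  obtain ⟨γ, hγ, hγ₁⟩ := X.exists_section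
  obtain ⟨f, hf⟩ := Extension.exists_isCocycle hγ
  exact ⟨_, hf.isRealization hγ₁⟩

end Embedding

/-! ### Realizations and their images -/

section Realization

/-- The antipode is the inverse of the identity point, and the group homomorphism `Pts.map φ`
preserves inverses. -/
theorem map_antipode {k G G' : Type*} [Field k] [Ring G] [HopfAlgebra k G] [IsCocomm k G] [Ring G']
    [HopfAlgebra k G'] [IsCocomm k G'] (φ : G →ₐc[k] G') (x : G) :
    φ (HopfAlgebra.antipode k x) = HopfAlgebra.antipode k (φ x) :=
  CoalgHom.congr_fun (congrArg Pts.hom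
    (map_inv (Pts.map φ) (⟨CoalgHom.id k G⟩ : Pts k G G))) x

variable {k : Type u} [Field k] {A Q : Type u} [Ring A] [HopfAlgebra k A] [IsCocomm k A]
  [Ring Q] [HopfAlgebra k Q] [IsCocomm k Q]

open Measuring Wreath

theorem Wreath.inl_mem_hker (f : Measuring k Q A) : inl k A Q f ∈ hker k (rightHom k A Q) :=
  mem_hker (rightHom k A Q) (Pts.map (inl k A Q) ⟨CoalgHom.id k _⟩) (sndPt_map_inl _) f

namespace IsRealization

variable {X : Extension k A Q} {j : X.E →ₐc[k] Wreath k A Q}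

/-- The image of j meets A^Q only in the image of A. Indeed f # 1 is in the Hopf kernel of τ, and
injectivity of j ⊗ id pulls this back: e is in the Hopf kernel of π, so it is some ι(a), and a is
found by evaluating at 1. -/
theorem exists_ι_eq (hj : IsRealization X j) {e : X.E} {f : Measuring k Q A}
    (h : j e = inl k A Q f) : X.ι (evalOne k A Q f) = e := by
  have he : e ∈ hker k X.π := by
    apply TensorProduct.map_injective_of_flat_flat (j : X.E →ₗ[k] Wreath k A Q)
      (LinearMap.id : Q →ₗ[k] Q) hj.injective Function.injective_id
    have h₁ : (rightHom k A Q : Wreath k A Q →ₗ[k] Q).lTensor _ (comul (R := k) (j e)) =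
        j e ⊗ₜ[k] 1 := by
      rw [h]
      exact inl_mem_hker f
    rw [← CoalgHomClass.map_comp_comul_apply, LinearMap.lTensor, ← LinearMap.comp_apply,
      ← TensorProduct.map_comp] at h₁
    refine Eq.trans ?_ h₁
    rw [LinearMap.lTensor, ← LinearMap.comp_apply, ← TensorProduct.map_comp]
    exact congrArg (fun t => TensorProduct.map (j : X.E →ₗ[k] Wreath k A Q) t (comul (R := k) e))
      (LinearMap.ext fun e => (hj.right_apply e).symm)
  rw [← X.exact] at he
  obtain ⟨a, rfl⟩ := he
  obtain ⟨f', hf', rfl⟩ := hj.ι_apply a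
  rw [← inl_apply, h] at hf'
  rw [inl_injective hf']

/-- The image of a realization. -/
def subalgebra (hj : IsRealization X j) : WreathSubalgebra k A Q where
  toSubalgebra := (j : X.E →ₐ[k] Wreath k A Q).range
  comul_mem := by
    rintro _ ⟨e, rfl⟩
    refine ⟨TensorProduct.map (j : X.E →ₐ[k] Wreath k A Q).rangeRestrict.toLinearMap
      (j : X.E →ₐ[k] Wreath k A Q).rangeRestrict.toLinearMap (comul (R := k) e), ?_⟩
    rw [← LinearMap.comp_apply, ← TensorProduct.map_comp]
    exact CoalgHomClass.map_comp_comul_apply j e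
  antipode_mem := by
    rintro _ ⟨e, rfl⟩
    exact ⟨HopfAlgebra.antipode k e, map_antipode j e⟩
  onto q := by
    obtain ⟨e, rfl⟩ := X.surjective q
    exact ⟨j e, ⟨e, rfl⟩, hj.right_apply e⟩
  bijOn := by
    refine ⟨fun _ _ => Set.mem_univ _, ?_, ?_⟩
    -- By `exists_ι_eq` the preimages e and e' are determined by f@1 and f'@1.
    · rintro f ⟨e, he⟩ f' ⟨e', he'⟩ h
      have h₁ : j e = inl k A Q f := he.trans (inl_apply f).symm
      have h₂ : j e' = inl k A Q f' := he'.trans (inl_apply f').symm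
      apply inl_injective
      rw [← h₁, ← h₂, ← hj.exists_ι_eq h₁, ← hj.exists_ι_eq h₂, h]
    · intro a _
      obtain ⟨f, hf, rfl⟩ := hj.ι_apply a
      exact ⟨f, ⟨_, hf⟩, rfl⟩

theorem carrier_subalgebra (hj : IsRealization X j) : hj.subalgebra.carrier = Set.range j := rfl

end IsRealization

theorem realizes_iff {X : CleftExtension k A Q} {H : WreathSubalgebra k A Q} :
    Realizes X H ↔ ∃ j, IsRealization X.toExtension j ∧ Set.range j = H.carrier :=
  ⟨fun ⟨j, h₁, h₂, h₃, h₄⟩ => ⟨j, ⟨h₁, h₃, h₄⟩, h₂⟩,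
    fun ⟨j, h₁, h₂⟩ => ⟨j, h₁.injective, h₂, h₁.right_apply, h₁.ι_apply⟩⟩

theorem CleftExtension.exists_realizes (X : CleftExtension k A Q) :
    ∃ H, Realizes X H := by
  obtain ⟨j, hj⟩ := X.exists_isRealization
  exact ⟨hj.subalgebra, realizes_iff.2 ⟨j, hj, hj.carrier_subalgebra.symm⟩⟩

/-- Two injective bialgebra maps with the same range differ by an isomorphism. -/
theorem exists_bialgEquiv_of_range_eq {E E' W : Type*} [Ring E] [HopfAlgebra k E] [Ring E']
    [HopfAlgebra k E'] [Ring W] [HopfAlgebra k W] (i : E →ₐc[k] W) (i' : E' →ₐc[k] W)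
    (hi : Function.Injective i) (hi' : Function.Injective i') (h : Set.range i = Set.range i') :
    ∃ φ : E ≃ₐc[k] E', ∀ e, i' (φ e) = i e := by
  obtain ⟨g, hg⟩ := exists_factor (i' : E' →ₗc[k] W) hi' (i : E →ₗc[k] W)
    fun e => (h ▸ Set.mem_range_self e : i e ∈ Set.range i')
  replace hg : ∀ e, i' (g e) = i e := hg
  -- The coalgebra map g that factors i through i' is multiplicative because this can be tested
  -- after the injection i'.
  let ψ : E →ₐc[k] E' :=
    { g with
      map_one' := hi' ((hg 1).trans ((map_one i).trans (map_one i').symm))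
      map_mul' := fun a b => hi' <| by
        refine (hg _).trans ?_
        rw [map_mul, map_mul, ← hg, ← hg]
        rfl }
  have hψ : Function.Bijective ψ := by
    constructor
    · intro a b hab
      apply hi
      rw [← hg, ← hg]
      exact congrArg i' hab
    · intro e'
      obtain ⟨e, he⟩ : i' e' ∈ Set.range i := h ▸ Set.mem_range_self e'
      exact ⟨e, hi' ((hg e).trans he)⟩
  exact ⟨BialgEquiv.ofBijective ψ hψ, hg⟩

/-- Serves both notions of isomorphism: m is the identity for equivalences and the automorphism
induced by (α, ω) in general. The compatibility with ι comes from `exists_ι_eq`. -/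
theorem IsRealization.exists_equiv {X Y : Extension k A Q} {j : X.E →ₐc[k] Wreath k A Q}
    {j' : Y.E →ₐc[k] Wreath k A Q} (hj : IsRealization X j) (hj' : IsRealization Y j')
    (m : Wreath k A Q →ₐc[k] Wreath k A Q) (hm : Function.Injective m)
    (h : Set.range j' = m '' Set.range j) {α : A → A} {ω : Q → Q}
    (hω : ∀ w, right k A Q (m w) = ω (right k A Q w))
    (hα : ∀ f, ∃ f', m (inl k A Q f) = inl k A Q f' ∧ evalOne k A Q f' = α (evalOne k A Q f)) :
    ∃ φ : X.E ≃ₐc[k] Y.E, (∀ a, φ (X.ι a) = Y.ι (α a)) ∧ ∀ e, Y.π (φ e) = ω (X.π e) := by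
  obtain ⟨φ, hφ⟩ := exists_bialgEquiv_of_range_eq (m.comp j) j' (hm.comp hj.injective)
    hj'.injective (by rw [h, ← Set.range_comp]; rfl)
  replace hφ : ∀ e, j' (φ e) = m (j e) := hφ
  refine ⟨φ, fun a => ?_, fun e => ?_⟩
  · obtain ⟨f, hf, rfl⟩ := hj.ι_apply a
    obtain ⟨f', hf', hα'⟩ := hα f
    rw [← hα']
    refine (hj'.exists_ι_eq ?_).symm
    rw [hφ, hf, ← inl_apply, hf']
  · rw [← hj'.right_apply, hφ, hω, hj.right_apply]

/-- Extensions realized by the same subalgebra are equivalent. -/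
theorem Realizes.equivalent {X Y : CleftExtension k A Q} {H : WreathSubalgebra k A Q}
    (hX : Realizes X H) (hY : Realizes Y H) : X.Equivalent Y := by
  obtain ⟨j, hj, hr⟩ := realizes_iff.1 hX
  obtain ⟨j', hj', hr'⟩ := realizes_iff.1 hY
  exact hj.exists_equiv hj' (BialgHom.id k _) Function.injective_id
    (by rw [hr, hr']; exact (Set.image_id _).symm) (α := id) (ω := id) (fun _ => rfl)
    fun f => ⟨f, rfl, rfl⟩

theorem Realizes.of_equivalent {X Y : CleftExtension k A Q} {H : WreathSubalgebra k A Q}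
    (hX : Realizes X H) (h : Y.Equivalent X) : Realizes Y H := by
  obtain ⟨φ, h₁, h₂⟩ := h
  obtain ⟨j, hj, hr⟩ := realizes_iff.1 hX
  refine realizes_iff.2 ⟨j.comp φ, ⟨hj.injective.comp φ.toEquiv.injective, fun e => ?_,
    fun a => ?_⟩, ?_⟩
  · rw [← h₂, ← hj.right_apply]
    rfl
  · obtain ⟨f, hf, hfa⟩ := hj.ι_apply a
    refine ⟨f, ?_, hfa⟩
    rw [← hf, ← h₁]
    rfl
  · rw [← hr]
    exact φ.toEquiv.surjective.range_comp j

/-! ### Conjugation by group-like elements -/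

section Conjugation

variable {G G' : Type*} [Ring G] [HopfAlgebra k G] [IsCocomm k G] [Ring G'] [HopfAlgebra k G']
  [IsCocomm k G']

theorem map_conj (φ : G →ₐc[k] G') (x : G) (hx : IsGroupLikeElem k x) (a : G) :
    φ (conj x hx a) = conj (φ x) (hx.map φ) (φ a) := by
  rw [conj_apply, map_mul, map_mul, map_antipode]
  rfl

theorem conj_mul (x y : G) (hx : IsGroupLikeElem k x) (hy : IsGroupLikeElem k y) (a : G) :
    conj (x * y) (hx.mul hy) a = conj x hx (conj y hy a) := by
  rw [conj_apply, conj_apply, conj_apply, HopfAlgebra.antipode_mul_antidistrib]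
  simp only [mul_assoc]

theorem conj_surjective (x : G) (hx : IsGroupLikeElem k x) : Function.Surjective (conj x hx) := by
  intro a
  refine ⟨HopfAlgebra.antipode k x * a * x, ?_⟩
  calc _ = (x * HopfAlgebra.antipode k x) * a * (x * HopfAlgebra.antipode k x) := by
        rw [conj_apply]; simp only [mul_assoc]
    _ = a := by rw [hx.mul_antipode_cancel, one_mul, mul_one]

theorem conj_one_apply (h : IsGroupLikeElem k (1 : G)) (a : G) : conj 1 h a = a := by
  rw [conj_apply, one_mul, HopfAlgebra.antipode_one, mul_one]

/-- Any w is the sum of left(w₁) # right(w₂); for a group-like y the sum is the single term left(y)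
# τ(y). -/
theorem Wreath.eq_inl_of_isGroupLikeElem {y : Wreath k A Q} (hy : IsGroupLikeElem k y)
    (h : right k A Q y = 1) : y = inl k A Q (left k A Q y) := by
  have h₁ := map_fst_snd_comul (k := k) (Y := Measuring k Q A) (Z := Q) y
  have h₂ : comul (R := k) y = y ⊗ₜ y := hy.comul_eq_tmul_self
  refine h₁.symm.trans ?_
  refine (congrArg _ h₂).trans ?_
  rw [inl_apply, ← h]
  rfl

namespace IsRealization

variable {X : Extension k A Q} {j : X.E →ₐc[k] Wreath k A Q}

/-- Modulo the group-like elements of the subalgebra, every group-like element of `A ≀ Q` has the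
form `f # 1` with `f@1 = 1`. -/
theorem exists_isGroupLikeElem (hj : IsRealization X j) {γ : Q →ₗc[k] X.E}
    (hγ : ∀ q, X.π (γ q) = q) {x : Wreath k A Q} (hx : IsGroupLikeElem k x) :
    ∃ h, IsGroupLikeElem k h ∧ ∃ f, x * j h = inl k A Q f ∧ evalOne k A Q f = 1 := by
  have hg : IsGroupLikeElem k (right k A Q x) := hx.map _
  -- The coalgebra map γ lifts the group-like τ(x) to a group-like of E; dividing x by it gives an
  -- element over 1.
  have he : IsGroupLikeElem k (HopfAlgebra.antipode k (γ (right k A Q x))) := (hg.map γ).antipode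
  have hy : IsGroupLikeElem k (x * j (HopfAlgebra.antipode k (γ (right k A Q x)))) :=
    hx.mul (he.map j)
  have hτ : right k A Q (x * j (HopfAlgebra.antipode k (γ (right k A Q x)))) = 1 := by
    change rightHom k A Q _ = 1
    rw [map_mul, rightHom_apply, rightHom_apply, hj.right_apply, map_antipode, hγ,
      hg.mul_antipode_cancel]
  have hf := eq_inl_of_isGroupLikeElem hy hτ
  generalize left k A Q (x * j (HopfAlgebra.antipode k (γ (right k A Q x)))) = f at hf
  have hf' : IsGroupLikeElem k f := by
    rw [hf] at hy
    have := hy.map (left k A Q)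
    rwa [left_inl] at this
  have hu : IsGroupLikeElem k (evalOne k A Q f) := hf'.map _
  -- A further factor from ι(A), the inverse of the group-like f@1, makes the value at 1 trivial.
  obtain ⟨f₂, hf₂, hu₂⟩ := hj.ι_apply (HopfAlgebra.antipode k (evalOne k A Q f))
  refine ⟨_, he.mul (hu.antipode.map X.ι), f * f₂, ?_, ?_⟩
  · rw [map_mul, ← mul_assoc, hf, hf₂, map_mul, inl_apply f₂]
  · rw [map_mul, hu₂, hu.mul_antipode_cancel]

/-- Both τ and evaluation at 1 are Hopf maps that send the conjugating element to 1, so neither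
notices the conjugation. -/
theorem conj (hj : IsRealization X j) {f : Measuring k Q A}
    (hf : IsGroupLikeElem k (inl k A Q f)) (h₁ : evalOne k A Q f = 1) :
    IsRealization X ((conj (inl k A Q f) hf).comp j) where
  injective := (conj_injective _ hf).comp hj.injective
  right_apply e := by
    have hr : rightHom k A Q (inl k A Q f) = 1 := by
      have hf' := hf.map (left k A Q)
      rw [left_inl] at hf'
      rw [rightHom_apply, inl_apply, right_mk, hf'.counit_eq_one, one_smul]
    refine (map_conj (rightHom k A Q) _ hf (j e)).trans ?_
    simp only [hr]
    rw [conj_one_apply, rightHom_apply, hj.right_apply]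
  ι_apply a := by
    obtain ⟨s, hs, rfl⟩ := hj.ι_apply a
    refine ⟨f * s * HopfAlgebra.antipode k f, ?_, ?_⟩
    · change HopfWreath.conj _ hf (j _) = _
      rw [hs, ← inl_apply, ← inl_apply, conj_apply, map_mul, map_mul, map_antipode]
    · rw [map_mul, map_mul, map_antipode, h₁, one_mul, HopfAlgebra.antipode_one, mul_one]

end IsRealization

/-- Conjugate subalgebras realize the same extensions. -/
theorem Realizes.of_isConj {X : CleftExtension k A Q} {H H' : WreathSubalgebra k A Q}
    (hX : Realizes X H) (h : H.IsConj H') : Realizes X H' := by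
  obtain ⟨j, hj, hr⟩ := realizes_iff.1 hX
  obtain ⟨x, hx, hH'⟩ := h
  obtain ⟨γ, hγ, -⟩ := X.exists_section
  obtain ⟨h, hh, f, hf, h₁⟩ := hj.exists_isGroupLikeElem hγ hx
  have hy : IsGroupLikeElem k (x * j h) := hx.mul (hh.map j)
  have hy' := hy
  rw [hf] at hy'
  refine realizes_iff.2 ⟨_, hj.conj hy' h₁, ?_⟩
  -- Here f # 1 = x j(h). Conjugation by h permutes E, so the new realization has image xHS(x).
  have e : ∀ e, conj (inl k A Q f) hy' (j e) = conj x hx (j (conj h hh e)) := by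
    intro e
    rw [map_conj, ← conj_mul]
    simp only [hf]
  have e₂ : ⇑((conj (inl k A Q f) hy').comp j) = conj x hx ∘ j ∘ conj h hh := funext e
  rw [e₂, Set.range_comp, (conj_surjective h hh).range_comp, hr, hH']
  rfl

end Conjugation

end Realization

/-! ### Uniqueness of the realization up to conjugation -/

section Uniqueness

variable {k : Type u} [Field k] {A Q : Type u} [Ring A] [HopfAlgebra k A] [IsCocomm k A]
  [Ring Q] [HopfAlgebra k Q] [IsCocomm k Q]
  {F : Type u} [AddCommGroup F] [Module k F] [Coalgebra k F] [IsCocomm k F]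

open Measuring Wreath

/-- The coalgebra map `f # q ↦ ε(q) f@1` from `A ≀ Q` to `A`, on points. -/
def Wreath.leftOne (w : Pts k F (Wreath k A Q)) : Pts k F A := evalPts (fstPt w.hom) 1

/-- The value of q ★ l at 1 is l@q: the value at 1 of a product sees the second factor at the point
τ(v). -/
theorem Wreath.leftOne_mul (v w : Pts k F (Wreath k A Q)) :
    leftOne (v * w) = leftOne v * evalPts (fstPt w.hom) (sndPt v.hom) := by
  rw [leftOne, fstPt_mul, evalPts_mul, evalPts_actPts, one_mul]
  rfl

theorem Wreath.leftOne_comp {F' : Type u} [AddCommGroup F'] [Module k F'] [Coalgebra k F']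
    [IsCocomm k F'] (w : Pts k F (Wreath k A Q)) (h : F' →ₗc[k] F) :
    (leftOne w).comp h = leftOne (w.comp h) := by
  rw [leftOne, evalPts_comp, ← fstPt_comp, Pts.one_comp]
  rfl

theorem Wreath.leftOne_eq (w : Pts k F (Wreath k A Q)) :
    leftOne w = Pts.map (evalOne k A Q) (fstPt w.hom) := evalPts_at_one _

namespace IsRealization

variable {X : Extension k A Q} {j : X.E →ₐc[k] Wreath k A Q}

theorem sndPt_map (hj : IsRealization X j) (e : Pts k F X.E) :
    sndPt (Pts.map j e).hom = Pts.map X.π e :=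
  Pts.ext (CoalgHom.ext fun x => hj.right_apply (e.hom x))

theorem leftOne_map_ι (hj : IsRealization X j) (b : Pts k F A) :
    leftOne (Pts.map j (Pts.map X.ι b)) = b := by
  rw [leftOne_eq]
  ext x
  change evalOne k A Q (left k A Q (j (X.ι (b.hom x)))) = b.hom x
  obtain ⟨f, hf, hfb⟩ := hj.ι_apply (b.hom x)
  rw [hf, ← inl_apply, left_inl, hfb]

theorem leftOne_map_mul (hj : IsRealization X j) (x y : Pts k F X.E) :
    leftOne (Pts.map j (x * y)) =
      leftOne (Pts.map j x) * evalPts (fstPt (Pts.map j y).hom) (Pts.map X.π x) := by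
  rw [map_mul, leftOne_mul, hj.sndPt_map]

/-- Left A-linearity of θ. It is used to compare two realizations here, and again to produce a
section when cleftness is proved. -/
theorem leftOne_map_ι_mul (hj : IsRealization X j) (b : Pts k F A) (y : Pts k F X.E) :
    leftOne (Pts.map j (Pts.map X.ι b * y)) = b * leftOne (Pts.map j y) := by
  rw [hj.leftOne_map_mul, hj.leftOne_map_ι, X.map_π_map_ι]
  rfl

/-- Two realizations of a cleft extension differ by conjugation with `t # 1`, where `t` is the
group-like element `c ↦ θ'(γ(c))⁻¹ θ(γ(c))` of `A^Q`. -/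
theorem exists_conj {j' : X.E →ₐc[k] Wreath k A Q} (hj : IsRealization X j)
    (hj' : IsRealization X j') {γ : Q →ₗc[k] X.E} (hγ : ∀ q, X.π (γ q) = q) :
    ∃ x, ∃ hx : IsGroupLikeElem k x, ∀ e, j' e = HopfWreath.conj x hx (j e) := by
  let t : Pts k Q A := (leftOne (Pts.map j' (⟨γ⟩ : Pts k Q X.E)))⁻¹ *
    leftOne (Pts.map j (⟨γ⟩ : Pts k Q X.E))
  have ht : ∀ {F : Type u} [AddCommGroup F] [Module k F] [Coalgebra k F] [IsCocomm k F]
      (c : Pts k F Q), t.comp c.hom = (leftOne (Pts.map j' (Pts.push γ c)))⁻¹ *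
        leftOne (Pts.map j (Pts.push γ c)) := by
    intro F _ _ _ _ c
    rw [Pts.mul_comp, Pts.inv_comp, leftOne_comp, leftOne_comp, Pts.map_comp, Pts.map_comp]
    rfl
  -- A function from Q to A is a point of A^Q over the base field, and the image of 1 under it is a
  -- group-like element.
  let T : Pts k k (Measuring k Q A) := liftPts (t.comp snd)
  have hT : ∀ {F : Type u} [AddCommGroup F] [Module k F] [Coalgebra k F] [IsCocomm k F]
      (h : F →ₗc[k] k) (c : Pts k F Q), evalPts (T.comp h) c = t.comp c.hom := by
    intro F _ _ _ _ h c
    rw [evalPts_liftPts_comp, Pts.comp_comp, snd_pair]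
  have hx : IsGroupLikeElem k (inl k A Q (T.hom 1)) :=
    ((isGroupLikeElem_self.2 rfl).map T.hom).map (inl k A Q)
  refine ⟨_, hx, fun e => ?_⟩
  let e₀ : Pts k X.E X.E := ⟨CoalgHom.id k X.E⟩
  let x₀ : Pts k X.E (Wreath k A Q) := Pts.map (inl k A Q) (T.comp (counitCoalgHom k X.E))
  have hx₀ : Pts.const _ hx = x₀ := by
    ext e
    change counit (R := k) e • inl k A Q (T.hom 1) = inl k A Q (T.hom (counit (R := k) e))
    rw [← map_smul, ← map_smul, smul_eq_mul, mul_one]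
  -- The conjugation formula as an identity at the universal point of E; x₀ is T pulled back along
  -- the counit.
  have key : x₀ * Pts.map j e₀ = Pts.map j' e₀ * x₀ := by
    apply pts_ext
    · rw [fstPt_mul, fstPt_mul, fstPt_map_inl, sndPt_map_inl, one_actPts, hj'.sndPt_map]
      apply evalPts_ext
      rw [Pts.mul_comp, Pts.mul_comp, actPts_comp, evalPts_mul, evalPts_mul, evalPts_actPts,
        Pts.comp_comp, hT, hT, ← fstPt_comp, ← fstPt_comp, ← Pts.comp_hom, ← Pts.comp_hom,
        Pts.map_comp, Pts.map_comp, Pts.map_comp]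
      generalize e₀.comp (fst : X.E ⊗[k] Q →ₗc[k] X.E) = e
      generalize (sndPts : Pts k (X.E ⊗[k] Q) Q) = c
      -- The points γ(c)e and γ(cπ(e)) have the same image in Q, so they differ by a left factor b
      -- from A.
      obtain ⟨b, hb⟩ := X.exists_map_ι_eq
        (Pts.push γ c * e * (Pts.push γ (c * Pts.map X.π e))⁻¹) (by
          rw [map_mul, map_mul, map_inv, Extension.map_π_push hγ, Extension.map_π_push hγ,
            mul_inv_cancel])
      have hb' : Pts.push γ c * e = Pts.map X.ι b * Pts.push γ (c * Pts.map X.π e) :=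
        (mul_inv_eq_iff_eq_mul.1 hb.symm)
      -- Computing θ(γ(c)e) in two ways shows that the A^Q-component of j(e) has value θ(γ(c))⁻¹ b
      -- θ(γ(cπ(e))) at c. The same b serves j', so t(c) on the left and t(cπ(e)) on the right match
      -- the two values.
      have h₁ := hj.leftOne_map_mul (Pts.push γ c) e
      have h₂ := hj'.leftOne_map_mul (Pts.push γ c) e
      rw [Extension.map_π_push hγ, hb', hj.leftOne_map_ι_mul] at h₁
      rw [Extension.map_π_push hγ, hb', hj'.leftOne_map_ι_mul] at h₂
      rw [ht, ht, mul_assoc, ← h₁, eq_inv_mul_of_mul_eq h₂.symm]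
      group
    · rw [sndPt_mul, sndPt_mul, sndPt_map_inl, hj.sndPt_map, hj'.sndPt_map, one_mul, mul_one]
  rw [← hx₀] at key
  have h := CoalgHom.congr_fun (congrArg Pts.hom key) e
  rw [Pts.const_mul_apply, Pts.mul_const_apply] at h
  have h' : inl k A Q (T.hom 1) * j e = j' e * inl k A Q (T.hom 1) := h
  rw [conj_apply, h', mul_assoc, hx.mul_antipode_cancel, mul_one]

end IsRealization

/-- The subalgebras that realize a cleft extension are conjugate. -/
theorem Realizes.isConj {X : CleftExtension k A Q} {H H' : WreathSubalgebra k A Q}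
    (hH : Realizes X H) (hH' : Realizes X H') : H.IsConj H' := by
  obtain ⟨j, hj, hr⟩ := realizes_iff.1 hH
  obtain ⟨j', hj', hr'⟩ := realizes_iff.1 hH'
  obtain ⟨γ, hγ, -⟩ := X.exists_section
  obtain ⟨x, hx, h⟩ := hj.exists_conj hj' hγ
  refine ⟨x, hx, ?_⟩
  rw [← hr, ← hr', ← Set.range_comp]
  exact congrArg Set.range (funext h)

end Uniqueness

/-! ### The action of Aut A × Aut Q -/

section Automorphisms

variable {k : Type u} [Field k] {A Q : Type u} [Ring A] [HopfAlgebra k A] [IsCocomm k A]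
  [Ring Q] [HopfAlgebra k Q] [IsCocomm k Q]
  {F : Type u} [AddCommGroup F] [Module k F] [Coalgebra k F] [IsCocomm k F]

open Measuring Wreath

/-- The map `f ↦ α ∘ f ∘ ω⁻¹` of `A^Q`. -/
def Measuring.mapAut (α : A ≃ₐc[k] A) (ω : Q ≃ₐc[k] Q) : Measuring k Q A →ₗc[k] Measuring k Q A :=
  lift ((α : A →ₗc[k] A).comp ((eval k Q A).comp
    (Coalgebra.TensorProduct.map (CoalgHom.id k (Measuring k Q A)) (ω.symm : Q →ₗc[k] Q))))

theorem Measuring.eval_mapAut (α : A ≃ₐc[k] A) (ω : Q ≃ₐc[k] Q) (f : Measuring k Q A) (c : Q) :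
    eval k Q A (mapAut α ω f ⊗ₜ c) = α (eval k Q A (f ⊗ₜ ω.symm c)) := eval_lift _ _ _

theorem Measuring.evalPts_mapAut (α : A ≃ₐc[k] A) (ω : Q ≃ₐc[k] Q)
    (f : Pts k F (Measuring k Q A)) (c : Pts k F Q) :
    evalPts (Pts.push (mapAut α ω) f) c = Pts.map (α : A →ₐc[k] A)
      (evalPts f (Pts.map (ω.symm : Q →ₐc[k] Q) c)) := by
  have h : (eval k Q A).comp (Coalgebra.TensorProduct.map (mapAut α ω) (CoalgHom.id k Q)) =
      (α : A →ₗc[k] A).comp ((eval k Q A).comp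
        (Coalgebra.TensorProduct.map (CoalgHom.id k _) (ω.symm : Q →ₗc[k] Q))) := by
    apply CoalgHom.coe_linearMap_injective
    apply TensorProduct.ext'
    intro f c
    exact eval_mapAut α ω f c
  have h₁ := congrArg (fun φ => φ.comp (pair f.hom c.hom)) h
  simp only [CoalgHom.comp_assoc, map_pair, CoalgHom.id_comp] at h₁
  exact Pts.ext h₁

theorem wreathMap_mk (α : A ≃ₐc[k] A) (ω : Q ≃ₐc[k] Q) (f : Measuring k Q A) (q : Q) :
    wreathMap α ω (mk f q) = mk (mapAut α ω f) (ω q) := rfl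

theorem fstPt_push_wreathMap (α : A ≃ₐc[k] A) (ω : Q ≃ₐc[k] Q) (w : Pts k F (Wreath k A Q)) :
    fstPt (Pts.push (wreathMap α ω) w).hom = Pts.push (mapAut α ω) (fstPt w.hom) := by
  have h : (left k A Q).comp (wreathMap α ω) = (mapAut α ω).comp (left k A Q) := by
    apply CoalgHom.coe_linearMap_injective
    apply TensorProduct.ext'
    intro f q
    change counit (R := k) (ω q) • mapAut α ω f = mapAut α ω (counit (R := k) q • f)
    rw [CoalgHomClass.counit_comp_apply, map_smul]
  exact Pts.ext (congrArg (fun φ => φ.comp w.hom) h)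

theorem sndPt_push_wreathMap (α : A ≃ₐc[k] A) (ω : Q ≃ₐc[k] Q) (w : Pts k F (Wreath k A Q)) :
    sndPt (Pts.push (wreathMap α ω) w).hom = Pts.map (ω : Q →ₐc[k] Q) (sndPt w.hom) := by
  have h : (right k A Q).comp (wreathMap α ω) = (ω : Q →ₗc[k] Q).comp (right k A Q) := by
    apply CoalgHom.coe_linearMap_injective
    apply TensorProduct.ext'
    intro f q
    change counit (R := k) (mapAut α ω f) • ω q = ω (counit (R := k) f • q)
    rw [CoalgHomClass.counit_comp_apply, map_smul]
  exact Pts.ext (congrArg (fun φ => φ.comp w.hom) h)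

theorem map_symm_map {G : Type u} [Ring G] [HopfAlgebra k G] [IsCocomm k G] (ω : G ≃ₐc[k] G)
    (c : Pts k F G) : Pts.map (ω.symm : G →ₐc[k] G) (Pts.map (ω : G →ₐc[k] G) c) = c :=
  Pts.ext (CoalgHom.ext fun x => ω.toEquiv.symm_apply_apply (c.hom x))

theorem push_mapAut_mul (α : A ≃ₐc[k] A) (ω : Q ≃ₐc[k] Q) (f g : Pts k F (Measuring k Q A)) :
    Pts.push (mapAut α ω) (f * g) = Pts.push (mapAut α ω) f * Pts.push (mapAut α ω) g := by
  apply evalPts_ext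
  rw [Pts.mul_comp, evalPts_mul, Pts.push_comp, Pts.push_comp, Pts.push_comp, evalPts_mapAut,
    evalPts_mapAut, evalPts_mapAut, Pts.mul_comp, evalPts_mul, map_mul]

/-- At a point c both sides evaluate f at ω⁻¹(c)q = ω⁻¹(cω(q)). -/
theorem push_mapAut_actPts (α : A ≃ₐc[k] A) (ω : Q ≃ₐc[k] Q) (q : Pts k F Q)
    (f : Pts k F (Measuring k Q A)) : Pts.push (mapAut α ω) (actPts q f) =
      actPts (Pts.map (ω : Q →ₐc[k] Q) q) (Pts.push (mapAut α ω) f) := by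
  apply evalPts_ext
  rw [actPts_comp, evalPts_actPts, Pts.push_comp, Pts.push_comp, evalPts_mapAut,
    evalPts_mapAut, actPts_comp, evalPts_actPts, map_mul, Pts.map_comp, map_symm_map]

theorem push_wreathMap_mul (α : A ≃ₐc[k] A) (ω : Q ≃ₐc[k] Q) (v w : Pts k F (Wreath k A Q)) :
    Pts.push (wreathMap α ω) (v * w) = Pts.push (wreathMap α ω) v * Pts.push (wreathMap α ω) w := by
  apply pts_ext
  · rw [fstPt_mul, fstPt_push_wreathMap, fstPt_push_wreathMap, fstPt_push_wreathMap,
      sndPt_push_wreathMap, fstPt_mul, push_mapAut_mul, push_mapAut_actPts]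
  · rw [sndPt_mul, sndPt_push_wreathMap, sndPt_push_wreathMap, sndPt_push_wreathMap, sndPt_mul,
      map_mul]

/-- The automorphism of `A ≀ Q` induced by automorphisms of `A` and `Q`, as a bialgebra map. -/
def wreathHom (α : A ≃ₐc[k] A) (ω : Q ≃ₐc[k] Q) : Wreath k A Q →ₐc[k] Wreath k A Q :=
  bialgHomOfPts (wreathMap α ω) (push_wreathMap_mul α ω _ _)

theorem wreathHom_apply (α : A ≃ₐc[k] A) (ω : Q ≃ₐc[k] Q) (w : Wreath k A Q) :
    wreathHom α ω w = wreathMap α ω w := rfl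

theorem wreathMap_symm_wreathMap (α : A ≃ₐc[k] A) (ω : Q ≃ₐc[k] Q) (w : Wreath k A Q) :
    wreathMap α.symm ω.symm (wreathMap α ω w) = w := by
  let w₀ : Pts k (Wreath k A Q) (Wreath k A Q) := ⟨CoalgHom.id k _⟩
  have h : Pts.push (wreathMap α.symm ω.symm) (Pts.push (wreathMap α ω) w₀) = w₀ := by
    apply pts_ext
    · rw [fstPt_push_wreathMap, fstPt_push_wreathMap]
      apply evalPts_ext
      rw [Pts.push_comp, evalPts_mapAut, Pts.push_comp, evalPts_mapAut, map_symm_map]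
      congr 1
      exact map_symm_map ω _
    · rw [sndPt_push_wreathMap, sndPt_push_wreathMap, map_symm_map]
  exact CoalgHom.congr_fun (congrArg Pts.hom h) w

theorem wreathHom_injective (α : A ≃ₐc[k] A) (ω : Q ≃ₐc[k] Q) :
    Function.Injective (wreathHom α ω) :=
  Function.LeftInverse.injective (wreathMap_symm_wreathMap α ω)

theorem right_wreathHom (α : A ≃ₐc[k] A) (ω : Q ≃ₐc[k] Q) (w : Wreath k A Q) :
    right k A Q (wreathHom α ω w) = ω (right k A Q w) :=
  CoalgHom.congr_fun (congrArg Pts.hom (sndPt_push_wreathMap α ω ⟨CoalgHom.id k _⟩)) w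

theorem wreathHom_inl (α : A ≃ₐc[k] A) (ω : Q ≃ₐc[k] Q) (f : Measuring k Q A) :
    ∃ f', wreathHom α ω (inl k A Q f) = inl k A Q f' ∧
      evalOne k A Q f' = α (evalOne k A Q f) := by
  refine ⟨mapAut α ω f, ?_, ?_⟩
  · rw [inl_apply, inl_apply, wreathHom_apply, wreathMap_mk, map_one]
  · rw [evalOne_apply, eval_mapAut, map_one, evalOne_apply]

/-- Extensions that are realized by subalgebras in the same orbit of `Aut A × Aut Q` are
isomorphic. -/
theorem Realizes.isomorphic {X Y : CleftExtension k A Q} {H H' : WreathSubalgebra k A Q}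
    (hX : Realizes X H) (hY : Realizes Y H') {α : A ≃ₐc[k] A} {ω : Q ≃ₐc[k] Q}
    (h : H'.carrier = wreathMap α ω '' H.carrier) : X.Isomorphic Y := by
  obtain ⟨j, hj, hr⟩ := realizes_iff.1 hX
  obtain ⟨j', hj', hr'⟩ := realizes_iff.1 hY
  obtain ⟨φ, h₁, h₂⟩ := hj.exists_equiv hj' (wreathHom α ω) (wreathHom_injective α ω)
    (by rw [hr, hr', h]; rfl) (right_wreathHom α ω) (wreathHom_inl α ω)
  exact ⟨α, φ, ω, h₁, h₂⟩

/-- If j realizes X, then j ∘ φ⁻¹ followed by the automorphism of A ≀ Q realizes Y: the twists of A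
and Q by φ⁻¹ are undone by α and ω. -/
theorem CleftExtension.Isomorphic.exists_realizes {X Y : CleftExtension k A Q}
    (h : X.Isomorphic Y) : ∃ H H' : WreathSubalgebra k A Q, Realizes X H ∧ Realizes Y H' ∧
      ∃ (α : A ≃ₐc[k] A) (ω : Q ≃ₐc[k] Q), H'.carrier = wreathMap α ω '' H.carrier := by
  obtain ⟨α, φ, ω, h₁, h₂⟩ := h
  obtain ⟨H, hH⟩ := X.exists_realizes
  obtain ⟨j, hj, hr⟩ := realizes_iff.1 hH
  have hφ : ∀ e, φ (φ.symm e) = e := φ.toEquiv.apply_symm_apply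
  have hφ' : ∀ e, φ.symm (φ e) = e := φ.toEquiv.symm_apply_apply
  have hj' : IsRealization Y.toExtension ((wreathHom α ω).comp (j.comp φ.symm)) := by
    refine ⟨(wreathHom_injective α ω).comp (hj.injective.comp φ.symm.toEquiv.injective),
      fun e => ?_, fun a => ?_⟩
    · refine (right_wreathHom α ω _).trans ?_
      refine (congrArg ω (hj.right_apply (φ.symm e))).trans ?_
      rw [← h₂, hφ]
    · obtain ⟨f, hf, hfa⟩ := hj.ι_apply (α.symm a)
      obtain ⟨f', hf', hfa'⟩ := wreathHom_inl α ω f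
      have ha : α (α.symm a) = a := α.toEquiv.apply_symm_apply a
      refine ⟨f', ?_, by rw [hfa', hfa, ha]⟩
      rw [← inl_apply, ← hf', inl_apply, ← hf, ← hφ' (X.ι _), h₁, ha]
      rfl
  refine ⟨H, hj'.subalgebra, hH, realizes_iff.2 ⟨_, hj', hj'.carrier_subalgebra.symm⟩, α, ω, ?_⟩
  rw [hj'.carrier_subalgebra, ← hr, ← Set.range_comp]
  exact φ.symm.toEquiv.surjective.range_comp (wreathMap α ω ∘ j)

end Automorphisms

/-! ### Hopf subalgebras as Hopf algebras -/

namespace HopfSubalgebra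

variable {k : Type u} [Field k] {W : Type u} [Ring W] [HopfAlgebra k W] (H : HopfSubalgebra k W)

/-- A Hopf subalgebra as a type. -/
def Carrier : Type u := H.toSubalgebra

instance : Ring H.Carrier := inferInstanceAs (Ring H.toSubalgebra)
instance : Algebra k H.Carrier := inferInstanceAs (Algebra k H.toSubalgebra)

/-- The inclusion of a Hopf subalgebra as an algebra homomorphism. -/
def valAlg : H.Carrier →ₐ[k] W := H.toSubalgebra.val

theorem valAlg_injective : Function.Injective H.valAlg := Subtype.val_injective

theorem map_valAlg_injective :
    Function.Injective (TensorProduct.map H.valAlg.toLinearMap H.valAlg.toLinearMap) :=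
  TensorProduct.map_injective_of_flat_flat _ _ H.valAlg_injective H.valAlg_injective

/-- The restriction of the comultiplication to a Hopf subalgebra. -/
def comulRestrict : H.Carrier →ₗ[k] H.Carrier ⊗[k] H.Carrier :=
  (LinearEquiv.ofInjective _ H.map_valAlg_injective).symm.toLinearMap ∘ₗ
    (comul ∘ₗ H.valAlg.toLinearMap).codRestrict
      (LinearMap.range (TensorProduct.map H.valAlg.toLinearMap H.valAlg.toLinearMap))
      fun x => H.comul_mem x.1 x.2

theorem map_comulRestrict (x : H.Carrier) :
    TensorProduct.map H.valAlg.toLinearMap H.valAlg.toLinearMap (H.comulRestrict x) =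
      comul (R := k) (H.valAlg x) :=
  congrArg Subtype.val ((LinearEquiv.ofInjective _ H.map_valAlg_injective).apply_symm_apply
    ((comul ∘ₗ H.valAlg.toLinearMap).codRestrict
      (LinearMap.range (TensorProduct.map H.valAlg.toLinearMap H.valAlg.toLinearMap))
      (fun x => H.comul_mem x.1 x.2) x))

instance : Coalgebra k H.Carrier :=
  coalgebraOfInjective H.valAlg.toLinearMap H.valAlg_injective H.comulRestrict
    (LinearMap.ext H.map_comulRestrict)

instance [IsCocomm k W] : IsCocomm k H.Carrier :=
  cocommOfInjective H.valAlg.toLinearMap H.valAlg_injective H.comulRestrict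
    (LinearMap.ext H.map_comulRestrict)

theorem counit_eq (x : H.Carrier) : counit (R := k) x = counit (R := k) (H.valAlg x) := rfl

theorem map_comul (x : H.Carrier) :
    TensorProduct.map H.valAlg.toLinearMap H.valAlg.toLinearMap (comul (R := k) x) =
      comul (R := k) (H.valAlg x) := H.map_comulRestrict x

/-- The axioms are inherited from W, because the inclusion and its tensor square are injective over
a field. -/
instance : Bialgebra k H.Carrier :=
  Bialgebra.mk' k H.Carrier
    (by rw [counit_eq, map_one, Bialgebra.counit_one])
    (by intro a b; rw [counit_eq, map_mul, Bialgebra.counit_mul]; rfl)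
    (by
      apply H.map_valAlg_injective
      rw [map_comul, map_one, Bialgebra.comul_one]
      exact (map_one (Algebra.TensorProduct.map H.valAlg H.valAlg)).symm)
    (by
      intro a b
      apply H.map_valAlg_injective
      rw [map_comul, map_mul, Bialgebra.comul_mul, ← map_comul, ← map_comul]
      exact (map_mul (Algebra.TensorProduct.map H.valAlg H.valAlg) _ _).symm)

/-- The restriction of the antipode to a Hopf subalgebra. -/
def antipodeRestrict : H.Carrier →ₗ[k] H.Carrier :=
  (HopfAlgebra.antipode k ∘ₗ H.valAlg.toLinearMap).codRestrict
    H.toSubalgebra.toSubmodule fun x => H.antipode_mem x.1 x.2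

theorem valAlg_antipodeRestrict (x : H.Carrier) :
    H.valAlg (H.antipodeRestrict x) = HopfAlgebra.antipode k (H.valAlg x) := rfl

instance : HopfAlgebra k H.Carrier where
  antipode := H.antipodeRestrict
  mul_antipode_rTensor_comul := by
    ext x
    apply H.valAlg_injective
    have e : ∀ z : H.Carrier ⊗[k] H.Carrier,
        H.valAlg (LinearMap.mul' k _ (H.antipodeRestrict.rTensor _ z)) =
          LinearMap.mul' k W ((HopfAlgebra.antipode k).rTensor W
            (TensorProduct.map H.valAlg.toLinearMap H.valAlg.toLinearMap z)) := by
      intro z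
      induction z with
      | zero => simp
      | add z w hz hw => simp only [map_add, hz, hw]
      | tmul a b => simp [valAlg_antipodeRestrict]
    refine (e _).trans ?_
    rw [map_comul, HopfAlgebra.mul_antipode_rTensor_comul_apply]
    exact (H.valAlg.commutes _).symm
  mul_antipode_lTensor_comul := by
    ext x
    apply H.valAlg_injective
    have e : ∀ z : H.Carrier ⊗[k] H.Carrier,
        H.valAlg (LinearMap.mul' k _ (H.antipodeRestrict.lTensor _ z)) =
          LinearMap.mul' k W ((HopfAlgebra.antipode k).lTensor W
            (TensorProduct.map H.valAlg.toLinearMap H.valAlg.toLinearMap z)) := by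
      intro z
      induction z with
      | zero => simp
      | add z w hz hw => simp only [map_add, hz, hw]
      | tmul a b => simp [valAlg_antipodeRestrict]
    refine (e _).trans ?_
    rw [map_comul, HopfAlgebra.mul_antipode_lTensor_comul_apply]
    exact (H.valAlg.commutes _).symm

/-- The inclusion of a Hopf subalgebra as a bialgebra map. -/
def val : H.Carrier →ₐc[k] W :=
  { H.valAlg with
    map_smul' := map_smul H.valAlg
    counit_comp := rfl
    map_comp_comul := LinearMap.ext H.map_comul }

theorem val_injective : Function.Injective H.val := Subtype.val_injective

theorem val_mem (x : H.Carrier) : H.val x ∈ H.carrier := x.2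

theorem range_val : Set.range H.val = H.carrier := Subtype.range_val

/-- Bialgebra maps with values in a Hopf subalgebra. -/
theorem exists_codRestrict {G : Type u} [Ring G] [HopfAlgebra k G] (φ : G →ₐc[k] W)
    (hφ : ∀ a, φ a ∈ H.carrier) : ∃ ψ : G →ₐc[k] H.Carrier, ∀ a, H.val (ψ a) = φ a := by
  obtain ⟨g, hg⟩ := Measuring.exists_factor (H.val : H.Carrier →ₗc[k] W) H.val_injective
    (φ : G →ₗc[k] W) fun a => ⟨⟨φ a, hφ a⟩, rfl⟩
  replace hg : ∀ a, H.val (g a) = φ a := hg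
  exact ⟨{ g with
    map_one' := H.val_injective ((hg 1).trans ((map_one φ).trans (map_one H.val).symm))
    map_mul' := fun a b => H.val_injective <| by
      refine (hg _).trans ?_
      rw [map_mul, map_mul, ← hg, ← hg]
      rfl }, hg⟩

/-- Stability under contraction of Δ is a form of Δ(H) ⊆ H ⊗ H that passes to H ∩ A^Q. -/
theorem contract_comul_mem {x : W} (hx : x ∈ H.carrier) (χ : W →ₗ[k] k) :
    contract (comul (R := k) x) χ ∈ H.carrier := by
  have h : ∀ z : H.Carrier ⊗[k] H.Carrier,
      contract (TensorProduct.map H.valAlg.toLinearMap H.valAlg.toLinearMap z) χ ∈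
        H.toSubalgebra := by
    intro z
    induction z with
    | zero => simp [contract_apply]
    | add z w hz hw =>
      have : contract (TensorProduct.map H.valAlg.toLinearMap H.valAlg.toLinearMap (z + w)) χ =
          contract (TensorProduct.map H.valAlg.toLinearMap H.valAlg.toLinearMap z) χ +
          contract (TensorProduct.map H.valAlg.toLinearMap H.valAlg.toLinearMap w) χ := by
        simp only [contract_apply, map_add]
      rw [this]
      exact add_mem hz hw
    | tmul a b =>
      simp only [contract_apply, TensorProduct.map_tmul, LinearMap.lTensor_tmul,
        TensorProduct.rid_tmul]
      exact H.toSubalgebra.smul_mem a.2 _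
  let y : H.Carrier := ⟨x, hx⟩
  have hy := h (comul (R := k) y)
  rw [H.map_comul y] at hy
  exact hy

end HopfSubalgebra

/-- A projection onto a subspace stable under the comultiplication preserves the
comultiplication of elements of the subspace. -/
theorem map_comul_of_stable {k : Type u} [Field k] {B : Type*} [AddCommGroup B] [Module k B]
    [Coalgebra k B] [IsCocomm k B] {S : Submodule k B}
    (hS : ∀ x ∈ S, ∀ χ : B →ₗ[k] k, contract (comul (R := k) x) χ ∈ S) {p : B →ₗ[k] B}
    (hp : ∀ x ∈ S, p x = x) {x : B} (hx : x ∈ S) :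
    TensorProduct.map p p (comul (R := k) x) = comul (R := k) x := by
  have h₁ : TensorProduct.map p LinearMap.id (comul (R := k) x) = comul (R := k) x := by
    apply tensor_ext_right
    intro χ
    have e : ∀ z : B ⊗[k] B, TensorProduct.rid k B (χ.lTensor B
        (TensorProduct.map p LinearMap.id z)) = p (contract z χ) := by
      intro z
      induction z with
      | zero => simp [contract_apply]
      | add z w hz hw => simp only [map_add, hz, hw, contract_apply]
      | tmul a b => simp [contract_apply]
    rw [e, hp _ (hS x hx χ), contract_apply]
  -- Cocommutativity transfers the result from the first tensor factor to the second.
  have h₂ : TensorProduct.map LinearMap.id p (comul (R := k) x) = comul (R := k) x := by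
    have := congrArg (TensorProduct.comm k B B) h₁
    rwa [← TensorProduct.map_comm, comm_comul] at this
  have e : TensorProduct.map p p = TensorProduct.map p LinearMap.id ∘ₗ
      TensorProduct.map (LinearMap.id : B →ₗ[k] B) p := by
    rw [← TensorProduct.map_comp]; rfl
  rw [e, LinearMap.comp_apply, h₂, h₁]

variable {k : Type u} [Field k] {A Q : Type u} [Ring A] [HopfAlgebra k A] [IsCocomm k A]
  [Ring Q] [HopfAlgebra k Q] [IsCocomm k Q]

open Measuring Wreath

/-! ### Coalgebra sections from A-linear retractions -/

section Cleft

/-- An idempotent coalgebra map splits. -/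
theorem exists_coalgebra_range {E : Type u} [AddCommGroup E] [Module k E] [Coalgebra k E]
    [IsCocomm k E] (P : E →ₗc[k] E) (hP : ∀ e, P (P e) = P e) :
    ∃ (R : Type u) (_ : AddCommGroup R) (_ : Module k R) (_ : Coalgebra k R) (_ : IsCocomm k R)
      (i : R →ₗc[k] E), Function.Injective i ∧ Set.range i = Set.range P := by
  let R := LinearMap.range P.toLinearMap
  let p : E →ₗ[k] R := P.toLinearMap.rangeRestrict
  have hi : Function.Injective R.subtype := R.injective_subtype
  let Δ : R →ₗ[k] R ⊗[k] R := TensorProduct.map p p ∘ₗ comul ∘ₗ R.subtype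
  have hΔ : TensorProduct.map R.subtype R.subtype ∘ₗ Δ = comul ∘ₗ R.subtype := by
    ext ⟨_, e, rfl⟩
    change TensorProduct.map R.subtype R.subtype (TensorProduct.map p p (comul (R := k) (P e))) =
      comul (R := k) (P e)
    rw [← LinearMap.comp_apply, ← TensorProduct.map_comp]
    -- Since P is an idempotent coalgebra map, P ⊗ P fixes Δ(P(e)), so the image of P is a
    -- subcoalgebra.
    refine (CoalgHomClass.map_comp_comul_apply P (P e)).trans ?_
    rw [hP]
  let c : Coalgebra k R := coalgebraOfInjective R.subtype hi Δ hΔ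
  exact ⟨R, inferInstance, inferInstance, c, cocommOfInjective R.subtype hi Δ hΔ,
    ⟨R.subtype, rfl, hΔ⟩, hi, Subtype.range_val⟩

/-- An `A`-linear coalgebra map `E → A` gives a coalgebra section of `E → Q`. -/
theorem Extension.exists_section_of_retraction (X : Extension k A Q) (ρ : X.E →ₗc[k] A)
    (hρ : ∀ {F : Type u} [AddCommGroup F] [Module k F] [Coalgebra k F] [IsCocomm k F]
      (b : Pts k F A) (e : Pts k F X.E),
      Pts.push ρ (Pts.map X.ι b * e) = b * Pts.push ρ e) :
    ∃ γ : Q →ₗc[k] X.E, ∀ q, X.π (γ q) = q := by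
  -- On points P(e) = ι(ρ(e))⁻¹ e. Linearity of ρ gives ρ(P(e)) = 1, so P projects each A-orbit to
  -- its representative with trivial ρ.
  let P : Pts k X.E X.E :=
    (Pts.map X.ι (Pts.push ρ ⟨CoalgHom.id k X.E⟩))⁻¹ * ⟨CoalgHom.id k X.E⟩
  have hP : ∀ {F : Type u} [AddCommGroup F] [Module k F] [Coalgebra k F] [IsCocomm k F]
      (e : Pts k F X.E), Pts.push P.hom e = (Pts.map X.ι (Pts.push ρ e))⁻¹ * e := by
    intro F _ _ _ _ e
    have h : (⟨CoalgHom.id k X.E⟩ : Pts k X.E X.E).comp e.hom = e :=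
      Pts.ext (CoalgHom.id_comp _)
    change P.comp e.hom = _
    rw [Pts.mul_comp, Pts.inv_comp, Pts.map_comp, Pts.push_comp, h]
  have hρP : ∀ {F : Type u} [AddCommGroup F] [Module k F] [Coalgebra k F] [IsCocomm k F]
      (e : Pts k F X.E), Pts.push ρ (Pts.push P.hom e) = 1 := by
    intro F _ _ _ _ e
    rw [hP, ← map_inv, hρ, inv_mul_cancel]
  have hPP : ∀ e, P.hom (P.hom e) = P.hom e := by
    have h : Pts.push P.hom P = P := by
      have h₁ : Pts.push ρ P = 1 := hρP ⟨CoalgHom.id k X.E⟩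
      rw [hP, h₁, map_one, inv_one, one_mul]
    exact fun e => CoalgHom.congr_fun (congrArg Pts.hom h) e
  have hπP : ∀ e, X.π (P.hom e) = X.π e := by
    have h : Pts.map X.π P = Pts.map X.π ⟨CoalgHom.id k X.E⟩ := by
      rw [map_mul, map_inv, X.map_π_map_ι, inv_one, one_mul]
    exact fun e => CoalgHom.congr_fun (congrArg Pts.hom h) e
  -- The subcoalgebra R of representatives should map isomorphically to Q; surjectivity will follow
  -- from πP = π.
  obtain ⟨R, _, _, _, _, i, hi, hr⟩ := exists_coalgebra_range P.hom hPP
  have hPi : ∀ r, P.hom (i r) = i r := by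
    intro r
    obtain ⟨e, he⟩ : i r ∈ Set.range P.hom := hr ▸ Set.mem_range_self r
    rw [← he, hPP]
  let f : R →ₗc[k] Q := (X.π : X.E →ₗc[k] Q).comp i
  have hf : Function.Bijective f := by
    constructor
    -- On points: if x' and y' agree under π, then x' = ι(b)y', and linearity with ρ(x') = ρ(y') = 1
    -- forces b = 1.
    · apply injective_of_mono
      intro F _ _ _ _ x y hxy
      let x' : Pts k F X.E := ⟨i.comp x⟩
      let y' : Pts k F X.E := ⟨i.comp y⟩
      have hx' : Pts.push ρ x' = 1 := by
        have : Pts.push P.hom x' = x' := Pts.ext (CoalgHom.ext fun a => hPi (x a))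
        rw [← this, hρP]
      have hy' : Pts.push ρ y' = 1 := by
        have : Pts.push P.hom y' = y' := Pts.ext (CoalgHom.ext fun a => hPi (y a))
        rw [← this, hρP]
      have hπ : Pts.map X.π x' = Pts.map X.π y' := Pts.ext hxy
      obtain ⟨b, hb⟩ := X.exists_map_ι_eq (x' * y'⁻¹) (by
        rw [map_mul, map_inv, hπ, mul_inv_cancel])
      have hxy' : x' = Pts.map X.ι b * y' := mul_inv_eq_iff_eq_mul.1 hb.symm
      have hb₁ : b = 1 := by
        have := hρ b y'
        rw [← hxy', hx', hy', mul_one] at this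
        exact this.symm
      rw [hb₁, map_one, one_mul] at hxy'
      ext a
      exact hi (CoalgHom.congr_fun (congrArg Pts.hom hxy') a)
    · intro q
      obtain ⟨e, rfl⟩ := X.surjective q
      obtain ⟨r, hre⟩ : P.hom e ∈ Set.range i := hr ▸ Set.mem_range_self e
      refine ⟨r, ?_⟩
      change X.π (i r) = _
      rw [hre, hπP]
  let φ := CoalgEquiv.ofBijective (f := f) hf
  exact ⟨i.comp (φ.symm : Q →ₗc[k] R), fun q => φ.apply_symm_apply q⟩

end Cleft

/-! ### Members of 𝒮 as cleft extensions -/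

namespace WreathSubalgebra

variable (H : WreathSubalgebra k A Q)

/-- The inverse of the evaluation at `1` from `H ∩ A^Q` to `A`. -/
theorem exists_section : ∃ s : A →ₐc[k] Measuring k Q A,
    (∀ a, inl k A Q (s a) ∈ H.carrier) ∧ (∀ a, evalOne k A Q (s a) = a) ∧
      ∀ f, inl k A Q f ∈ H.carrier → s (evalOne k A Q f) = f := by
  -- S is H ∩ A^Q. Evaluation at 1 is injective there, so linearity and multiplicativity of its
  -- inverse are tested at 1.
  let S : Submodule k (Measuring k Q A) :=
    H.toSubalgebra.toSubmodule.comap (inl k A Q : Measuring k Q A →ₗ[k] Wreath k A Q)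
  have mem_S : ∀ f, f ∈ S ↔ inl k A Q f ∈ H.carrier := fun f => Iff.rfl
  have mem_S' : ∀ f, f ∈ S ↔ Wreath.mk f 1 ∈ H.carrier := fun f => by rw [mem_S, inl_apply]
  have inj : ∀ f ∈ S, ∀ f' ∈ S, evalOne k A Q f = evalOne k A Q f' → f = f' :=
    fun f hf f' hf' h => H.bijOn.injOn ((mem_S' f).1 hf) ((mem_S' f').1 hf') h
  have surj : ∀ a, ∃ f ∈ S, evalOne k A Q f = a := by
    intro a
    obtain ⟨f, hf, hfa⟩ := H.bijOn.surjOn (Set.mem_univ a)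
    exact ⟨f, (mem_S' f).2 hf, hfa⟩
  choose s hsS hs using surj
  have hs' : ∀ f ∈ S, s (evalOne k A Q f) = f := fun f hf => inj _ (hsS _) _ hf (hs _)
  let sl : A →ₗ[k] Measuring k Q A :=
    { toFun := s
      map_add' := fun a b => inj _ (hsS _) _ (S.add_mem (hsS _) (hsS _)) (by
        rw [map_add, hs, hs, hs])
      map_smul' := fun r a => inj _ (hsS _) _ (S.smul_mem _ (hsS _)) (by
        rw [map_smul, hs, hs]; rfl) }
  -- A functional χ on A^Q extends to A ≀ Q as χ ∘ left, so the stability of H under contraction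
  -- restricts to S.
  have stable : ∀ f ∈ S, ∀ χ : Measuring k Q A →ₗ[k] k, contract (comul (R := k) f) χ ∈ S := by
    intro f hf χ
    have h := H.contract_comul_mem ((mem_S f).1 hf) (χ ∘ₗ (left k A Q).toLinearMap)
    have e : ∀ z : Measuring k Q A ⊗[k] Measuring k Q A,
        contract (TensorProduct.map (inl k A Q : Measuring k Q A →ₗ[k] Wreath k A Q)
          (inl k A Q : Measuring k Q A →ₗ[k] Wreath k A Q) z) (χ ∘ₗ (left k A Q).toLinearMap) =
        inl k A Q (contract z χ) := by
      intro z
      induction z with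
      | zero => simp [contract_apply]
      | add z w hz hw =>
        simp only [contract_apply, map_add] at hz hw ⊢
        rw [hz, hw]
      | tmul a b =>
        simp only [contract_apply, TensorProduct.map_tmul, LinearMap.lTensor_tmul,
          TensorProduct.rid_tmul, map_smul]
        exact congrArg (fun t => χ t • inl k A Q a) (left_inl b)
    rw [mem_S, ← e]
    have e₂ := CoalgHomClass.map_comp_comul_apply (inl k A Q) f
    exact e₂ ▸ h
  have counit_sl : counit ∘ₗ sl = counit := by
    ext a
    have h := CoalgHomClass.counit_comp_apply (evalOne k A Q) (s a)
    rw [hs] at h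
    exact h.symm
  -- The map f ↦ s(f@1) is the identity on S, and S is stable, so its tensor square fixes Δ(s(a)).
  -- Evaluation at 1 is a coalgebra map, which turns this into (s ⊗ s)Δ(a) = Δ(s(a)).
  have comul_sl : TensorProduct.map sl sl ∘ₗ comul = comul ∘ₗ sl := by
    ext a
    have h := map_comul_of_stable stable (p := sl ∘ₗ (evalOne k A Q : Measuring k Q A →ₗ[k] A))
      hs' (hsS a)
    rw [TensorProduct.map_comp, LinearMap.comp_apply] at h
    have h₂ := CoalgHomClass.map_comp_comul_apply (evalOne k A Q) (s a)
    rw [hs] at h₂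
    exact (congrArg (TensorProduct.map sl sl) h₂).symm.trans h
  refine ⟨{ sl with
    counit_comp := counit_sl
    map_comp_comul := comul_sl
    map_one' := inj _ (hsS _) _ ?_ ?_
    map_mul' := fun a b => inj _ (hsS _) _ ?_ ?_ }, hsS, hs, fun f hf => hs' f hf⟩
  · rw [mem_S, map_one]
    exact H.one_mem
  · rw [map_one]
    exact hs 1
  · rw [mem_S, map_mul]
    exact H.mul_mem (hsS a) (hsS b)
  · rw [map_mul]
    exact (hs _).trans (congrArg₂ (· * ·) (hs a).symm (hs b).symm)

/-- Apply left ⊗ id to the kernel identity: one side is the sum of left(w₁) # τ(w₂), which is w.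
With `inl_mem_hker`, the Hopf kernel of τ is exactly A^Q. -/
theorem eq_inl_left_of_mem_hker {w : Wreath k A Q} (hw : w ∈ hker k (rightHom k A Q)) :
    w = inl k A Q (left k A Q w) := by
  have h : TensorProduct.map (left k A Q).toLinearMap (right k A Q).toLinearMap
      (comul (R := k) w) = w := map_fst_snd_comul (Y := Measuring k Q A) (Z := Q) w
  have h₂ := congrArg (TensorProduct.map (left k A Q).toLinearMap LinearMap.id) hw
  rw [LinearMap.lTensor, ← LinearMap.comp_apply, ← TensorProduct.map_comp] at h₂
  rw [inl_apply]
  exact h.symm.trans h₂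

/-- The middle term is H itself, with ι inverse to evaluation at 1 on H ∩ A^Q, π the restriction of
τ and j the inclusion. Cleftness is a separate matter. -/
theorem exists_extension : ∃ X : Extension k A Q, ∃ j : X.E →ₐc[k] Wreath k A Q,
    IsRealization X j ∧ Set.range j = H.carrier := by
  obtain ⟨s, hsH, hs, hs'⟩ := H.exists_section
  obtain ⟨ι, hι⟩ := H.exists_codRestrict ((inl k A Q).comp s) hsH
  replace hι : ∀ a, H.val (ι a) = inl k A Q (s a) := hι
  have hinj : Function.Injective ι := by
    intro a b h
    rw [← hs a, ← hs b]
    congr 1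
    apply inl_injective
    rw [← hι, ← hι, h]
  let π : H.Carrier →ₐc[k] Q := (rightHom k A Q).comp H.val
  -- Tensoring the inclusion of H with the identity of Q stays injective, so the Hopf kernel of π is
  -- the part of A^Q inside H.
  have hker_iff : ∀ e : H.Carrier, e ∈ hker k π ↔ H.val e ∈ hker k (rightHom k A Q) := by
    intro e
    have hinj' : Function.Injective (TensorProduct.map (H.val : H.Carrier →ₗ[k] Wreath k A Q)
        (LinearMap.id : Q →ₗ[k] Q)) :=
      TensorProduct.map_injective_of_flat_flat _ _ H.val_injective Function.injective_id
    have h₁ : TensorProduct.map (H.val : H.Carrier →ₗ[k] Wreath k A Q) LinearMap.id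
        ((π : H.Carrier →ₗ[k] Q).lTensor H.Carrier (comul (R := k) e)) =
        (rightHom k A Q : Wreath k A Q →ₗ[k] Q).lTensor _ (comul (R := k) (H.val e)) := by
      have h₂ : ∀ z : H.Carrier ⊗[k] H.Carrier,
          TensorProduct.map (H.val : H.Carrier →ₗ[k] Wreath k A Q) LinearMap.id
            ((π : H.Carrier →ₗ[k] Q).lTensor H.Carrier z) =
          (rightHom k A Q : Wreath k A Q →ₗ[k] Q).lTensor _
            (TensorProduct.map (H.val : H.Carrier →ₗ[k] Wreath k A Q)
              (H.val : H.Carrier →ₗ[k] Wreath k A Q) z) := by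
        intro z
        induction z with
        | zero => simp only [map_zero]
        | add z w hz hw => simp only [map_add, hz, hw]
        | tmul a b => rfl
      exact (h₂ _).trans (congrArg _ (CoalgHomClass.map_comp_comul_apply H.val e))
    constructor
    · intro h
      exact h₁.symm.trans (congrArg _ h)
    · intro h
      exact hinj' (h₁.trans h)
  have hsurj : Function.Surjective π := by
    intro q
    obtain ⟨w, hw, rfl⟩ := H.onto q
    exact ⟨⟨w, hw⟩, rfl⟩
  have hexact : Set.range ι = hker k π := by
    ext e
    rw [hker_iff]
    constructor
    · rintro ⟨a, rfl⟩
      rw [hι]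
      exact inl_mem_hker _
    · intro h
      have he := eq_inl_left_of_mem_hker h
      refine ⟨evalOne k A Q (left k A Q (H.val e)), H.val_injective ?_⟩
      have hm : inl k A Q (left k A Q (H.val e)) ∈ H.carrier := by
        rw [← he]
        exact H.val_mem e
      exact (hι _).trans ((congrArg (inl k A Q) (hs' _ hm)).trans he.symm)
  exact ⟨⟨H.Carrier, ι, π, hinj, hsurj, hexact⟩, H.val,
    ⟨H.val_injective, fun _ => rfl, fun a => ⟨s a, (hι a).trans (inl_apply _), hs a⟩⟩, H.range_val⟩

/-- Every member of `𝒮` realizes a cleft extension. -/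
theorem exists_realizes : ∃ X, Realizes X H := by
  obtain ⟨X, j, hj, hr⟩ := H.exists_extension
  -- The retraction is θ, the value at 1 of the A^Q-component; `leftOne_map_ι_mul` gives its
  -- A-linearity.
  obtain ⟨γ, hγ⟩ := X.exists_section_of_retraction
    ((evalOne k A Q : Measuring k Q A →ₗc[k] A).comp ((left k A Q).comp (j : X.E →ₗc[k] _))) (by
      intro F _ _ _ _ b e
      have h := hj.leftOne_map_ι_mul b e
      rw [leftOne_eq, leftOne_eq] at h
      exact h)
  exact ⟨⟨X, γ, Extension.isCleavage_of_section hγ⟩, realizes_iff.2 ⟨j, hj, hr⟩⟩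

end WreathSubalgebra

/-! ### The bijection -/

/-- The class of subalgebras that realize a cleft extension. -/
def classifying : Quotient (CleftExtension.setoid k A Q) ≃
    Quotient (WreathSubalgebra.setoid k A Q) where
  toFun := Quotient.lift (fun X => Quotient.mk _ X.exists_realizes.choose) fun X Y h =>
    Quotient.sound (s := WreathSubalgebra.setoid k A Q) (X.exists_realizes.choose_spec.isConj
      (Y.exists_realizes.choose_spec.of_equivalent h))
  invFun := Quotient.lift (fun H => Quotient.mk _ H.exists_realizes.choose) fun H H' h =>
    Quotient.sound (s := CleftExtension.setoid k A Q)
      ((H.exists_realizes.choose_spec.of_isConj h).equivalent H'.exists_realizes.choose_spec)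
  left_inv := by
    rintro ⟨X⟩
    exact Quotient.sound (s := CleftExtension.setoid k A Q)
      ((X.exists_realizes.choose.exists_realizes.choose_spec).equivalent
        X.exists_realizes.choose_spec)
  right_inv := by
    rintro ⟨H⟩
    exact Quotient.sound (s := WreathSubalgebra.setoid k A Q)
      ((H.exists_realizes.choose.exists_realizes.choose_spec).isConj
        H.exists_realizes.choose_spec)

/-- The realizers of X form one full conjugacy class: they are mutually conjugate by
`Realizes.isConj`, and conjugates of realizers are realizers by `Realizes.of_isConj`. -/
theorem classifying_mk_eq_iff (X : CleftExtension k A Q) (H : WreathSubalgebra k A Q) :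
    classifying (Quotient.mk _ X) = Quotient.mk _ H ↔ Realizes X H :=
  ⟨fun h => X.exists_realizes.choose_spec.of_isConj (Quotient.exact h),
    fun h => Quotient.sound (s := WreathSubalgebra.setoid k A Q)
      (X.exists_realizes.choose_spec.isConj h)⟩

end HopfWreath

end

/-- Cleft extensions of `A` by `Q`, up to equivalence, correspond to the Hopf subalgebras of `A ≀ Q`
that map onto `Q` and meet `A^Q` in a copy of `A`, up to conjugation: `X` corresponds to `H` when `X`
is realized by `H`. Isomorphisms that move `A` and `Q` correspond to the action of
`Aut A × Aut Q`. -/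
theorem theoremA {k A Q : Type u} [Field k]
    [Ring A] [HopfAlgebra k A] [Coalgebra.IsCocomm k A]
    [Ring Q] [HopfAlgebra k Q] [Coalgebra.IsCocomm k Q] :
    ∃ Φ : Quotient (HopfWreath.CleftExtension.setoid k A Q) ≃
        Quotient (HopfWreath.WreathSubalgebra.setoid k A Q),
      (∀ (X : HopfWreath.CleftExtension k A Q) (H : HopfWreath.WreathSubalgebra k A Q),
        Φ (Quotient.mk _ X) = Quotient.mk _ H ↔ HopfWreath.Realizes X H) ∧
      ∀ X X' : HopfWreath.CleftExtension k A Q, X.Isomorphic X' ↔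
        ∃ H H' : HopfWreath.WreathSubalgebra k A Q,
          Φ (Quotient.mk _ X) = Quotient.mk _ H ∧ Φ (Quotient.mk _ X') = Quotient.mk _ H' ∧
          ∃ (α : A ≃ₐc[k] A) (ω : Q ≃ₐc[k] Q),
            H'.carrier = HopfWreath.wreathMap α ω '' H.carrier := by
  refine ⟨HopfWreath.classifying, HopfWreath.classifying_mk_eq_iff, fun X X' => ?_⟩
  simp only [HopfWreath.classifying_mk_eq_iff]
  constructor
  · exact fun h => h.exists_realizes
  · rintro ⟨H, H', hX, hX', α, ω, h⟩
    exact hX.isomorphic hX' h
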